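/- A Pólya tree is a rooted unlabeled tree, i.e. an isomorphism class of finite rooted trees. Let $t_n$ be the number of Pólya trees with $n$ nodes, $T(z)=\sum_{n\ge1}t_nz^n$, $\rho$ the radius of convergence of $T$, and $$D(z)=\sum_{m\ge0}d_mz^m=\exp\Big(\sum_{i\ge2}\frac{T(z^i)}{i}\Big),\qquad C(z)=\sum_{n\ge1}\frac{n^{n-1}}{n!}z^n .$$ For an automorphism $\sigma$ of a Pólya tree $\tau$ (a root-preserving graph automorphism), the $C$-tree nodes are the fixed points of $\sigma$, and the $D$-forest $F(v)$ attached to a $C$-tree node $v$ is the union of the full subtrees rooted at those children of $v$ that are not fixed by $\sigma$ (possibly empty); $|F(v)|$ is its number of nodes. Let $N_m(\tau,\sigma)$ be the number of $C$-tree nodes $v$ with $|F(v)|=m$, and let $$T^{[m]}(z,u)=\sum_{\tau}z^{|\tau|}\,\frac1{|\mathrm{Aut}(\tau)|}\sum_{\sigma\in\mathrm{Aut}(\tau)}u^{N_m(\tau,\sigma)}$$ be the generating function of Pólya trees in which nodes are marked by $z$ and weighted $D$-forests of size $m$ are marked by $u$. For $n\ge1$, a random $C$-tree node $v$ of a random Pólya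 tree of size $n$ is obtained by drawing a triple $(\tau,\sigma,v)$, with $|\tau|=n$, $\sigma\in\mathrm{Aut}(\tau)$ and $v$ a fixed point of $\sigma$, with probability proportional to $1/|\mathrm{Aut}(\tau)|$; $F_n(v)$ is the $D$-forest attached to it. (Thus $\mathbb P(|F_n(v)|=m)=[z^n]\partial_uT^{[m]}(z,u)|_{u=1}\big/[z^n]\tfrac{T(z)}{1-T(z)}$.) Theorem. (i) For every $m\ge0$, as formal power series, $$T^{[m]}(z,u)=C\big(u\,z\,d_mz^m+z\,(D(z)-d_mz^m)\big).$$ (ii) We have $0<\rho<1$, the series $D(z)$ converges for all complex $|z|<\sqrt\rho$, and for every fixed $m\ge0$, as $n\to\infty$, $$\mathbb P\big(|F_n(v)|=m\big)=\frac{d_m\rho^m}{D(\rho)}\big(1+O(n^{-1})\big).$$ (iii) The probability generating function $P_n(u)=\sum_{m\ge0}\mathbb P(|F_n(v)|=m)\,u^m$ satisfies $$P_n(u)=\frac{D(\rho u)}{D(\rho)}\big(1+O(n^{-1})\big)$$ for complex $u$ with $|u|<\rho^{-1/2}$, uniformly on $|u|\le r$ for each $r<\rho^{-1/2}$. -/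

import Mathlib

noncomputable section

namespace PolyaForest

/-- A rooted tree on the vertex set `{0, …, n - 1}`. -/
structure RTree (n : ℕ) where
  /-- the underlying graph -/
  graph : SimpleGraph (Fin n)
  /-- the distinguished vertex -/
  root : Fin n
  /-- the underlying graph is a tree -/
  isTree : graph.IsTree

namespace RTree

variable {n : ℕ}

/-- Isomorphisms of rooted trees: graph isomorphisms that send root to root. -/
abbrev Iso (t s : RTree n) : Type :=
  {e : t.graph ≃g s.graph // e t.root = s.root}

/-- The automorphisms of a rooted tree. -/
abbrev Aut (t : RTree n) : Type := Iso t t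

instance (t s : RTree n) : Finite (Iso t s) := by
  have : Finite (t.graph ≃g s.graph) := DFunLike.finite _
  exact Subtype.finite

instance (t s : RTree n) : Fintype (Iso t s) := Fintype.ofFinite _

instance : Finite (RTree n) :=
  Finite.of_injective (fun t : RTree n => (t.graph, t.root)) (by
    rintro ⟨g, r, h⟩ ⟨g', r', h'⟩ e
    simp only [Prod.mk.injEq] at e
    obtain ⟨rfl, rfl⟩ := e
    rfl)

/-- Two rooted trees are equivalent if they are isomorphic. -/
instance setoid (n : ℕ) : Setoid (RTree n) where
  r t s := Nonempty (Iso t s)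
  iseqv :=
    { refl := fun t => ⟨⟨RelIso.refl _, rfl⟩⟩
      symm := fun {t s} h => h.elim fun e => ⟨⟨e.1.symm,
        (congrArg e.1.symm e.2).symm.trans (e.1.symm_apply_apply t.root)⟩⟩
      trans := fun {t s u} h k => h.elim fun e => k.elim fun f => ⟨⟨e.1.trans f.1,
        (congrArg f.1 e.2).trans f.2⟩⟩ }

/-- `v` is an ancestor of `w` (possibly `v = w`): `v` lies on the path from the root to `w`. -/
def IsAncestor (t : RTree n) (v w : Fin n) : Prop :=
  ∃ p : t.graph.Walk t.root w, p.IsPath ∧ v ∈ p.support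

/-- `c` is a child of `v`. -/
def IsChild (t : RTree n) (v c : Fin n) : Prop :=
  t.graph.Adj v c ∧ t.IsAncestor v c

/-- The `C`-tree nodes determined by an automorphism: its fixed points. -/
def cNodes (t : RTree n) (σ : t.Aut) : Set (Fin n) :=
  {v | σ.1 v = v}

/-- The nodes of the `D`-forest attached to the `C`-tree node `v`: the union of the full subtrees
of `t` rooted at those children of `v` that are moved by the automorphism. -/
def dForest (t : RTree n) (σ : t.Aut) (v : Fin n) : Set (Fin n) :=
  {w | ∃ c, t.IsChild v c ∧ σ.1 c ≠ c ∧ t.IsAncestor c w}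

/-- The number of `C`-tree nodes whose attached `D`-forest has exactly `m` nodes. -/
def numForests (t : RTree n) (σ : t.Aut) (m : ℕ) : ℕ :=
  {v | v ∈ t.cNodes σ ∧ (t.dForest σ v).ncard = m}.ncard

end RTree

/-- Pólya trees of size `n`: isomorphism classes of rooted trees with `n` nodes. -/
abbrev PolyaTree (n : ℕ) : Type := Quotient (RTree.setoid n)

instance (n : ℕ) : Fintype (PolyaTree n) := Fintype.ofFinite _

/-- A representative of a Pólya tree. The quantities that are summed over Pólya trees below do not
depend on its choice. -/
def PolyaTree.rep {n : ℕ} (T : PolyaTree n) : RTree n := Quotient.out T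

/-- `t_n`, the number of Pólya trees of size `n`. -/
def numTrees (n : ℕ) : ℕ := Fintype.card (PolyaTree n)

open PowerSeries in
/-- `T(z) = ∑ t_n z^n`. -/
def seriesT : PowerSeries ℝ := PowerSeries.mk fun n => (numTrees n : ℝ)

open PowerSeries in
/-- The formal power series `∑_{i ≥ 2} T(z^i) / i`. Since `T(z^i)` is divisible by `z^i`, only the
terms with `i ≤ n` contribute to the coefficient of `z^n`. -/
def seriesS : PowerSeries ℝ :=
  PowerSeries.mk fun n =>
    PowerSeries.coeff n
      (∑ i ∈ Finset.Icc 2 n, ((i : ℝ)⁻¹) • seriesT.subst ((X : PowerSeries ℝ) ^ i))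

/-- `D(z) = exp (∑_{i ≥ 2} T(z^i) / i)`. -/
def seriesD : PowerSeries ℝ := (PowerSeries.exp ℝ).subst seriesS

/-- `d_m = [z^m] D(z)`. -/
def d (m : ℕ) : ℝ := PowerSeries.coeff m seriesD

/-- `C(z) = ∑_{n ≥ 1} n^(n-1) z^n / n!`. -/
def seriesC : PowerSeries ℝ :=
  PowerSeries.mk fun n => if n = 0 then 0 else (n : ℝ) ^ (n - 1) / (n.factorial : ℝ)

/-- The radius of convergence of `T(z)`. -/
def rho : ℝ :=
  (FormalMultilinearSeries.ofScalars ℝ (fun n => (numTrees n : ℝ))).radius.toReal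

/-- The sum of the series `D` at a real or complex point. -/
def evalD {𝕜 : Type*} [RCLike 𝕜] (z : 𝕜) : 𝕜 := ∑' k : ℕ, ((d k : ℝ) : 𝕜) * z ^ k

/-- The bivariate generating function
`T^{[m]}(z,u) = ∑_T z^|T| (1 / |Aut T|) ∑_{σ ∈ Aut T} u^(number of D-forests of size m)`,
as a power series in `z` whose coefficients are polynomials in `u`. -/
def markedT (m : ℕ) : PowerSeries (Polynomial ℝ) :=
  PowerSeries.mk fun n => ∑ T : PolyaTree n,
    Polynomial.C ((Fintype.card T.rep.Aut : ℝ)⁻¹) *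
      ∑ σ : T.rep.Aut, (Polynomial.X : Polynomial ℝ) ^ (T.rep.numForests σ m)

/-- The expected number of `C`-tree nodes with a `D`-forest of size `m`, summed over all
Pólya trees of size `n`, for a uniformly random automorphism of each of them:
the total weight of such nodes, which equals `[z^n] ∂_u T^{[m]}(z,u)` at `u = 1`. -/
def forestWeight (n m : ℕ) : ℝ :=
  ∑ T : PolyaTree n, (Fintype.card T.rep.Aut : ℝ)⁻¹ *
    ∑ σ : T.rep.Aut, (T.rep.numForests σ m : ℝ)

/-- The total weight of all `C`-tree nodes in Pólya trees of size `n`. -/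
def cNodeWeight (n : ℕ) : ℝ :=
  ∑ T : PolyaTree n, (Fintype.card T.rep.Aut : ℝ)⁻¹ *
    ∑ σ : T.rep.Aut, ((T.rep.cNodes σ).ncard : ℝ)

/-- The probability that the `D`-forest attached to a random `C`-tree node of a random Pólya tree
of size `n` has size `m`: a triple (tree `T`, automorphism `σ`, fixed point of `σ`) is drawn with
probability proportional to its weight `1 / |Aut T|`. -/
def forestProb (n m : ℕ) : ℝ := forestWeight n m / cNodeWeight n

/-- The probability generating function of the size of the `D`-forest attached to a random
`C`-tree node. The forest does not contain the node, so its size is less than `n`. -/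
def forestPGF (n : ℕ) (u : ℂ) : ℂ := ∑ m ∈ Finset.range n, (forestProb n m : ℂ) * u ^ m

end PolyaForest

end

/-! The weight 1/|Aut τ| turns sums over Pólya trees with an automorphism into exponential
generating functions: by orbit-stabiliser, such a sum is 1/n! times a sum over labelled trees on
`Fin n` with an automorphism (`sum_polyaTree`). Labelled structures are encoded as `AutForest`, a
parent map together with a commuting permutation.

Part (i). Removing the root of a tree leaves a forest that splits uniquely into the trees with fixed
root, each again a tree of the same kind, and the trees with moved root, which form the D-forest of
the removed root. The exponential formula `egf_eq_exp_subst` handles both halves. A connected forest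
with moved roots is a cycle of i ≥ 2 copies of one tree with a twist, which gives ∑ T(z^i)/i, hence
D (`egf_movedWeight`). The result is W = B exp W with B = z(D + (u - 1) d_m z^m), and
`eq_seriesC_subst` solves it as W = C(B).

Singularity. T = z D exp T and τ exp(-τ) ≤ 1/e give x D(x) ≤ 1/e below ρ, while T = C(zD) converges
wherever D converges and x D(x) < 1/e. Since D depends on T(z^2), T(z^3), ... only, it converges up
to √ρ > ρ, so that ρ D(ρ) = 1/e (`rho_mul_tsum`).

Parts (ii) and (iii). Differentiating (i) at u = 1 gives weights d_m g_{n-1-m}, where g_n = [z^n]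
C'(zD(z)) (`forestWeight_eq`). It remains to compare ρ^(n-m) g_{n-m} with ρ^n g_n. Contour integrals
at the square root singularity are replaced by renewal theory: b(w) = e ρ w D(ρw) is a probability
law with an exponential moment, and ρ^n g_n = e [w^n] ∑ a_k b(w)^k with a_k of order k^(-1/2) and
differences of order k^(-3/2). By `exists_coeff_subst_bounds` both orders pass to ρ^n g_n, so the
ratio is 1 + O((m+1)^3/n) (`exists_abs_forestRatio_sub_one_le`). Summing against d_m (ρr)^m, where
ρr < √ρ, gives the generating function. The error is relative because 1/D = exp(-S), with S =
∑_{i≥2} T(z^i)/i, is bounded on |z| ≤ ρr (`one_le_norm_evalD_mul`). -/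

noncomputable section

namespace PolyaForest

/-! ### Formal power series: substitution and logarithmic derivatives. -/

section FormalSeries

open PowerSeries

variable {A R : Type*} [CommRing A] [CommRing R] [Algebra A R]

theorem coeff_pow_eq_zero {b : R⟦X⟧} (hb : constantCoeff b = 0) {n k : ℕ} (h : n < k) :
    coeff n (b ^ k) = 0 :=
  X_pow_dvd_iff.1 (pow_dvd_pow_of_dvd (X_dvd_iff.2 hb) k) n h

/-- The k-th power of `b` starts in degree k. The cutoff `N` is left free so that several
coefficients can share one. -/
theorem coeff_subst_eq_sum {b : R⟦X⟧} (hb : constantCoeff b = 0) (f : A⟦X⟧) {n N : ℕ}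
    (h : n < N) :
    coeff n (f.subst b) = ∑ k ∈ Finset.range N, coeff k f • coeff n (b ^ k) := by
  rw [coeff_subst' (HasSubst.of_constantCoeff_zero' hb)]
  refine finsum_eq_sum_of_support_subset _ fun k hk => ?_
  simp only [Function.mem_support] at hk
  simp only [Finset.coe_range, Set.mem_Iio]
  by_contra hkN
  exact hk (by rw [coeff_pow_eq_zero hb (by omega), smul_zero])

theorem subst_map_algebraMap {b : R⟦X⟧} (hb : constantCoeff b = 0) (f : A⟦X⟧) :
    (f.map (algebraMap A R)).subst b = f.subst b := by
  ext n
  rw [coeff_subst_eq_sum hb _ n.lt_succ_self, coeff_subst_eq_sum hb _ n.lt_succ_self]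
  simp [Algebra.smul_def]

theorem hasSubst_of_zero {b : R⟦X⟧} (hb : constantCoeff b = 0) : HasSubst b :=
  HasSubst.of_constantCoeff_zero' hb

theorem constantCoeff_subst_of_zero {b : R⟦X⟧} (hb : constantCoeff b = 0) (f : A⟦X⟧) :
    constantCoeff (f.subst b : R⟦X⟧) = algebraMap A R (constantCoeff f) := by
  rw [← coeff_zero_eq_constantCoeff_apply, coeff_subst_eq_sum hb f Nat.zero_lt_one]
  simp [Algebra.smul_def]

variable [Algebra ℚ R] [IsAddTorsionFree R]

/-- The product has derivative zero and constant coefficient one. -/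
theorem exp_subst_mul_exp_subst_neg {K : R⟦X⟧} (hK : constantCoeff K = 0) :
    (exp R).subst K * (exp R).subst (-K) = 1 := by
  have hK' : constantCoeff (-K) = 0 := by simp [hK]
  apply derivative.ext
  · rw [Derivation.leibniz, derivative_subst (hasSubst_of_zero hK),
      derivative_subst (hasSubst_of_zero hK'), derivative_exp]
    simp only [map_neg, smul_eq_mul, derivative_one]
    ring
  · simp [constantCoeff_subst_of_zero hK, constantCoeff_subst_of_zero hK']

/-- A power series is determined by its logarithmic derivative. -/
theorem eq_exp_subst_of_derivative {S K : R⟦X⟧} (hK : constantCoeff K = 0)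
    (hS : constantCoeff S = 1) (h : d⁄dX R S = d⁄dX R K * S) : S = (exp R).subst K := by
  have hK' : constantCoeff (-K) = 0 := by simp [hK]
  have h1 : S * (exp R).subst (-K) = 1 := by
    apply derivative.ext
    · rw [Derivation.leibniz, h, derivative_subst (hasSubst_of_zero hK'), derivative_exp]
      simp only [map_neg, smul_eq_mul, derivative_one]
      ring
    · simp [hS, constantCoeff_subst_of_zero hK']
  calc S = S * (exp R).subst (-K) * (exp R).subst K := by
        rw [mul_assoc, mul_comm ((exp R).subst (-K)), exp_subst_mul_exp_subst_neg hK, mul_one]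
    _ = _ := by rw [h1, one_mul]

end FormalSeries

/-! ### The tree function and its inverse z exp(-z). -/

section TreeFunction

open PowerSeries

theorem coeff_exp_neg_natCast_pow (k j : ℕ) :
    coeff j (((exp ℝ).subst (-X : ℝ⟦X⟧)) ^ k) = (-(k : ℝ)) ^ j / j.factorial := by
  have h : ((exp ℝ).subst (-X : ℝ⟦X⟧)) = rescale (-1 : ℝ) (exp ℝ) := by
    rw [rescale_eq_subst]; simp
  rw [h, ← map_pow, exp_pow_eq_rescale_exp, coeff_rescale, coeff_rescale, coeff_exp]
  simp only [one_div, map_inv₀, map_natCast]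
  rw [← mul_assoc, ← mul_pow, neg_one_mul, div_eq_mul_inv]

/-- For n ≥ 2 the coefficient is, up to 1/n!, the n-th finite difference at 0 of the polynomial
k^(n-1), whose degree is too small. -/
theorem seriesC_subst_X_mul_exp_neg :
    seriesC.subst (X * (exp ℝ).subst (-X : ℝ⟦X⟧) : ℝ⟦X⟧) = (X : ℝ⟦X⟧) := by
  ext n
  rw [coeff_subst_eq_sum (by simp) _ n.lt_succ_self]
  have h : ∀ k ∈ Finset.range (n + 1), coeff k seriesC •
      coeff n ((X * (exp ℝ).subst (-X : ℝ⟦X⟧) : ℝ⟦X⟧) ^ k) =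
      if k = 0 then 0 else (n.factorial : ℝ)⁻¹ * ((-1) ^ (n - k) * (n.choose k : ℝ) * (k : ℝ) ^ (n - 1)) := by
    intro k hk
    rw [Finset.mem_range, Nat.lt_succ_iff] at hk
    rw [mul_pow, coeff_X_pow_mul', if_pos hk, coeff_exp_neg_natCast_pow]
    simp only [seriesC, coeff_mk]
    split_ifs with h0
    · simp
    · rw [Nat.cast_choose ℝ hk, neg_pow, smul_eq_mul,
        show n - 1 = (k - 1) + (n - k) by omega, pow_add]
      have := n.factorial_ne_zero
      field_simp
  rw [Finset.sum_congr rfl h]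
  -- For n ≥ 2 the term k = 0 vanishes by itself since 0^(n-1) = 0, so the `if` can be dropped; for
  -- n = 1 it would be 0^0 = 1.
  rcases Nat.lt_or_ge n 2 with hn | hn
  · interval_cases n
    · simp
    · simp [Finset.sum_range_succ]
  · have h2 : ∀ k ∈ Finset.range (n + 1),
        (if k = 0 then 0 else (n.factorial : ℝ)⁻¹ * ((-1) ^ (n - k) * (n.choose k : ℝ) * (k : ℝ) ^ (n - 1)))
        = (n.factorial : ℝ)⁻¹ * ((-1) ^ (n - k) * (n.choose k : ℝ) * (k : ℝ) ^ (n - 1)) := by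
      intro k _
      split_ifs with h0
      · subst h0
        rw [Nat.cast_zero, zero_pow (by omega)]; simp
      · rfl
    rw [Finset.sum_congr rfl h2, ← Finset.mul_sum, coeff_X, if_neg (by omega)]
    have h3 := congrFun (fwdDiff_iter_pow_eq_zero_of_lt (R := ℝ) (j := n - 1) (n := n) (by omega)) 0
    rw [fwdDiff_iter_eq_sum_shift] at h3
    simp only [zsmul_eq_mul, nsmul_eq_mul, mul_one, zero_add, Int.cast_mul, Int.cast_pow,
      Int.cast_neg, Int.cast_one, Int.cast_natCast, Pi.zero_apply] at h3
    rw [h3, mul_zero]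

/-- The tree function `C` is characterised by `C = z exp C`. -/
theorem eq_seriesC_subst {R : Type*} [CommRing R] [Algebra ℝ R] [Algebra ℚ R] [IsAddTorsionFree R]
    {W B : R⟦X⟧} (hW : constantCoeff W = 0) (h : W = B * (exp R).subst W) :
    W = seriesC.subst B := by
  have hexp : ∀ {b : R⟦X⟧}, constantCoeff b = 0 → (exp R).subst b = (exp ℝ).subst b := by
    intro b hb
    rw [← subst_map_algebraMap hb (exp ℝ), map_exp]
  have hW' : constantCoeff (-W) = 0 := by simp [hW]
  have hX : constantCoeff (-X : ℝ⟦X⟧) = 0 := by simp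
  -- The equation says B = W exp(-W), and C is a left inverse of z exp(-z).
  have hB : B = (X * (exp ℝ).subst (-X : ℝ⟦X⟧) : ℝ⟦X⟧).subst W := by
    rw [subst_mul (hasSubst_of_zero hW), subst_X (hasSubst_of_zero hW),
      subst_comp_subst_apply (hasSubst_of_zero hX) (hasSubst_of_zero hW)]
    have : ((-X : ℝ⟦X⟧)).subst W = -W := by
      rw [← coe_substAlgHom (hasSubst_of_zero hW), map_neg, coe_substAlgHom,
        subst_X (hasSubst_of_zero hW)]
    rw [this, ← hexp hW']
    calc B = B * ((exp R).subst W * (exp R).subst (-W)) := by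
          rw [exp_subst_mul_exp_subst_neg hW, mul_one]
      _ = _ := by rw [← mul_assoc, ← h]
  rw [hB, ← subst_comp_subst_apply (hasSubst_of_zero (by simp)) (hasSubst_of_zero hW),
    seriesC_subst_X_mul_exp_neg, subst_X (hasSubst_of_zero hW)]

end TreeFunction

end PolyaForest

/-! ### Labelled forests with an automorphism, relabelling and splitting. -/

namespace PolyaForest

/-- A rooted forest on `V`, given by its parent map (which fixes the roots), together with an
automorphism. -/
@[ext] structure AutForest (V : Type) where
  /-- the parent map -/
  par : V → V
  /-- the automorphism -/
  aut : Equiv.Perm V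
  /-- every vertex has a root -/
  isForest : ∀ v, ∃ k, par (par^[k] v) = par^[k] v
  /-- the automorphism respects the parent map -/
  comm : ∀ v, aut (par v) = par (aut v)

namespace AutForest

open Equiv.Perm

variable {V V' : Type}

instance [Finite V] : Finite (AutForest V) :=
  Finite.of_injective (fun x : AutForest V => (x.par, x.aut)) fun x y h => by
    simp only [Prod.mk.injEq] at h
    exact AutForest.ext h.1 h.2

instance [Finite V] : Fintype (AutForest V) := Fintype.ofFinite _

instance [Finite V] (p : AutForest V → Prop) : Fintype {x : AutForest V // p x} :=
  Fintype.ofFinite _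

/-- The root of the tree that contains `v`. -/
def root (x : AutForest V) (v : V) : V := x.par^[Classical.choose (x.isForest v)] v

theorem par_root (x : AutForest V) (v : V) : x.par (x.root v) = x.root v :=
  Classical.choose_spec (x.isForest v)

theorem exists_iterate_eq_root (x : AutForest V) (v : V) : ∃ k, x.par^[k] v = x.root v := ⟨_, rfl⟩

/-- Iterates stay at a fixed point once they reach it, so the chosen exponent in `root` is
irrelevant. -/
theorem root_eq_of_iterate (x : AutForest V) {v r : V} (hr : x.par r = r) {k : ℕ}
    (h : x.par^[k] v = r) : x.root v = r := by
  obtain ⟨j, hj⟩ := x.exists_iterate_eq_root v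
  rw [← Function.iterate_fixed (x.par_root v) k, ← Function.iterate_fixed hr j, ← hj, ← h,
    ← Function.iterate_add_apply, ← Function.iterate_add_apply, add_comm]

theorem root_eq_self (x : AutForest V) {r : V} (hr : x.par r = r) : x.root r = r :=
  x.root_eq_of_iterate hr (k := 0) rfl

theorem root_par (x : AutForest V) (v : V) : x.root (x.par v) = x.root v := by
  obtain ⟨k, hk⟩ := x.exists_iterate_eq_root (x.par v)
  exact (x.root_eq_of_iterate (x.par_root _) (k := k + 1) hk).symm

theorem aut_iterate (x : AutForest V) (k : ℕ) (v : V) :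
    x.aut (x.par^[k] v) = x.par^[k] (x.aut v) :=
  Function.Semiconj.iterate_right (f := x.aut) (fun v => x.comm v) k v

theorem root_aut (x : AutForest V) (v : V) : x.root (x.aut v) = x.aut (x.root v) := by
  obtain ⟨k, hk⟩ := x.exists_iterate_eq_root v
  refine x.root_eq_of_iterate ?_ (k := k) ?_
  · rw [← x.comm, x.par_root]
  · rw [← x.aut_iterate, hk]

/-- Transport along a bijection of the vertex sets. -/
def relabel (x : AutForest V) (e : V ≃ V') : AutForest V' where
  par := fun v => e (x.par (e.symm v))
  aut := e.permCongr x.aut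
  isForest v := by
    obtain ⟨k, hk⟩ := x.isForest (e.symm v)
    have h : ∀ k, (fun v => e (x.par (e.symm v)))^[k] v = e (x.par^[k] (e.symm v)) := by
      intro k
      induction k with
      | zero => simp
      | succ k ih => rw [Function.iterate_succ_apply', ih, Function.iterate_succ_apply']; simp
    exact ⟨k, by rw [h]; simp [hk]⟩
  comm v := by simp [Equiv.permCongr_apply, x.comm]

@[simp] theorem relabel_par (x : AutForest V) (e : V ≃ V') (v : V) :
    (x.relabel e).par (e v) = e (x.par v) := by simp [relabel]

@[simp] theorem relabel_aut (x : AutForest V) (e : V ≃ V') (v : V) :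
    (x.relabel e).aut (e v) = e (x.aut v) := by simp [relabel, Equiv.permCongr_apply]

theorem relabel_iterate (x : AutForest V) (e : V ≃ V') (k : ℕ) (v : V) :
    (x.relabel e).par^[k] (e v) = e (x.par^[k] v) :=
  (Function.Semiconj.iterate_right (f := e) (fun v => (x.relabel_par e v).symm) k v).symm

@[simp] theorem relabel_root (x : AutForest V) (e : V ≃ V') (v : V) :
    (x.relabel e).root (e v) = e (x.root v) := by
  obtain ⟨k, hk⟩ := x.exists_iterate_eq_root v
  exact root_eq_of_iterate _ (by rw [relabel_par, x.par_root]) (by rw [relabel_iterate, hk])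

/-- Transport along a bijection of the vertex sets, as an equivalence. -/
def relabelEquiv (e : V ≃ V') : AutForest V ≃ AutForest V' where
  toFun x := x.relabel e
  invFun x := x.relabel e.symm
  left_inv x := by
    ext v <;> simp [relabel, Equiv.permCongr_apply]
  right_inv x := by
    ext v <;> simp [relabel, Equiv.permCongr_apply]

/-- `P` is a union of trees of the forest that is preserved by the automorphism. -/
structure Closed (x : AutForest V) (P : V → Prop) : Prop where
  par : ∀ v, P (x.par v) ↔ P v
  aut : ∀ v, P (x.aut v) ↔ P v

theorem Closed.not {x : AutForest V} {P : V → Prop} (h : x.Closed P) :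
    x.Closed (fun v => ¬ P v) :=
  ⟨fun v => not_congr (h.par v), fun v => not_congr (h.aut v)⟩

theorem Closed.root {x : AutForest V} {P : V → Prop} (h : x.Closed P) (v : V) :
    P (x.root v) ↔ P v := by
  obtain ⟨k, hk⟩ := x.exists_iterate_eq_root v
  rw [← hk]
  clear hk
  induction k with
  | zero => rfl
  | succ k ih => rw [Function.iterate_succ_apply', h.par, ih]

/-- The restriction of a forest with an automorphism to a closed set of vertices. -/
def restrict (x : AutForest V) (P : V → Prop) (h : x.Closed P) : AutForest {v // P v} where
  par v := ⟨x.par v, (h.par v).2 v.2⟩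
  aut := x.aut.subtypePerm fun v => h.aut v
  isForest v := by
    obtain ⟨k, hk⟩ := x.isForest v
    have hi : ∀ k, ((fun v : {v // P v} => (⟨x.par v, (h.par v).2 v.2⟩ : {v // P v}))^[k] v : V) =
        x.par^[k] v := by
      intro k
      induction k with
      | zero => rfl
      | succ k ih => rw [Function.iterate_succ_apply', Function.iterate_succ_apply', ← ih]
    exact ⟨k, Subtype.ext ((congrArg x.par (hi k)).trans (hk.trans (hi k).symm))⟩
  comm v := Subtype.ext (x.comm v)

section Restrict

variable (x : AutForest V) {P : V → Prop} (h : x.Closed P)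

@[simp] theorem restrict_par (v : {v // P v}) : ((x.restrict P h).par v : V) = x.par v := rfl

@[simp] theorem restrict_aut (v : {v // P v}) : ((x.restrict P h).aut v : V) = x.aut v := rfl

@[simp] theorem restrict_iterate (k : ℕ) (v : {v // P v}) :
    ((x.restrict P h).par^[k] v : V) = x.par^[k] v :=
  Function.Semiconj.iterate_right (f := Subtype.val) (ga := (x.restrict P h).par) (gb := x.par)
    (fun _ => rfl) k v

@[simp] theorem restrict_root (v : {v // P v}) : ((x.restrict P h).root v : V) = x.root v := by
  obtain ⟨k, hk⟩ := (x.restrict P h).exists_iterate_eq_root v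
  refine (x.root_eq_of_iterate (k := k) ?_ ?_).symm
  · rw [← restrict_par x h, par_root]
  · rw [← hk, restrict_iterate]

theorem restrict_sameCycle (v w : {v // P v}) :
    (x.restrict P h).aut.SameCycle v w ↔ x.aut.SameCycle v w := by
  simp [restrict, sameCycle_subtypePerm]

end Restrict

open Classical in
/-- A forest with an automorphism for which `P` is closed amounts to one on `P` and one on the
complement of `P`. -/
theorem bijective_restrict (P : V → Prop) : Function.Bijective
    (fun x : {x : AutForest V // x.Closed P} =>
      (x.1.restrict P x.2, x.1.restrict (fun v => ¬ P v) x.2.not)) := by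
  constructor
  · rintro ⟨x, hx⟩ ⟨y, hy⟩ h
    simp only [Prod.mk.injEq] at h
    obtain ⟨h1, h2⟩ := h
    refine Subtype.ext (AutForest.ext ?_ (Equiv.ext ?_))
    · funext v
      by_cases hv : P v
      · exact congrArg (fun z : AutForest {v // P v} => (z.par ⟨v, hv⟩ : V)) h1
      · exact congrArg (fun z : AutForest {v // ¬ P v} => (z.par ⟨v, hv⟩ : V)) h2
    · intro v
      by_cases hv : P v
      · exact congrArg (fun z : AutForest {v // P v} => (z.aut ⟨v, hv⟩ : V)) h1
      · exact congrArg (fun z : AutForest {v // ¬ P v} => (z.aut ⟨v, hv⟩ : V)) h2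
  · rintro ⟨y, z⟩
    let p : V → V := fun v => if hv : P v then y.par ⟨v, hv⟩ else z.par ⟨v, hv⟩
    let s : Equiv.Perm V := subtypeCongr y.aut z.aut
    have py : ∀ v : {v // P v}, p v = y.par v := fun v => by simp [p, v.2]
    have pz : ∀ v : {v // ¬ P v}, p v = z.par v := fun v => by simp [p, v.2]
    have sy : ∀ v : {v // P v}, s v = y.aut v := fun v => by
      simp [s, subtypeCongr.left_apply_subtype]
    have sz : ∀ v : {v // ¬ P v}, s v = z.aut v := fun v => by
      simp [s, subtypeCongr.right_apply_subtype]
    have piy : ∀ (k : ℕ) (v : {v // P v}), p^[k] v = y.par^[k] v := fun k v =>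
      (Function.Semiconj.iterate_right (f := Subtype.val) (fun v => (py v).symm) k v).symm
    have piz : ∀ (k : ℕ) (v : {v // ¬ P v}), p^[k] v = z.par^[k] v := fun k v =>
      (Function.Semiconj.iterate_right (f := Subtype.val) (fun v => (pz v).symm) k v).symm
    refine ⟨⟨⟨p, s, fun v => ?_, fun v => ?_⟩, ⟨fun v => ?_, fun v => ?_⟩⟩, ?_⟩
    · by_cases hv : P v
      · obtain ⟨k, hk⟩ := y.isForest ⟨v, hv⟩
        exact ⟨k, by rw [show p^[k] v = _ from piy k ⟨v, hv⟩, py, hk]⟩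
      · obtain ⟨k, hk⟩ := z.isForest ⟨v, hv⟩
        exact ⟨k, by rw [show p^[k] v = _ from piz k ⟨v, hv⟩, pz, hk]⟩
    · by_cases hv : P v
      · rw [show p v = _ from py ⟨v, hv⟩, show s v = _ from sy ⟨v, hv⟩, sy, py, y.comm]
      · rw [show p v = _ from pz ⟨v, hv⟩, show s v = _ from sz ⟨v, hv⟩, sz, pz, z.comm]
    · by_cases hv : P v
      · simp only [hv, iff_true]
        rw [show p v = _ from py ⟨v, hv⟩]; exact Subtype.prop _
      · simp only [hv, iff_false]
        rw [show p v = _ from pz ⟨v, hv⟩]; exact (z.par ⟨v, hv⟩).2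
    · by_cases hv : P v
      · simp only [hv, iff_true]
        rw [show s v = _ from sy ⟨v, hv⟩]; exact Subtype.prop _
      · simp only [hv, iff_false]
        rw [show s v = _ from sz ⟨v, hv⟩]; exact (z.aut ⟨v, hv⟩).2
    · refine Prod.ext (AutForest.ext ?_ (Equiv.ext ?_)) (AutForest.ext ?_ (Equiv.ext ?_))
      · exact funext fun v => Subtype.ext (py v)
      · exact fun v => Subtype.ext (sy v)
      · exact funext fun v => Subtype.ext (pz v)
      · exact fun v => Subtype.ext (sz v)

theorem sum_restrict_mul_restrict {R : Type*} [CommSemiring R] [Finite V] (P : V → Prop)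
    (F : AutForest {v // P v} → R) (G : AutForest {v // ¬ P v} → R) :
    ∑ x : {x : AutForest V // x.Closed P},
      F (x.1.restrict P x.2) * G (x.1.restrict (fun v => ¬ P v) x.2.not) =
    (∑ y, F y) * ∑ z, G z := by
  rw [Finset.sum_mul_sum, ← Fintype.sum_prod_type']
  exact (bijective_restrict P).sum_comp (fun z => F z.1 * G z.2)

end AutForest

end PolyaForest

/-! ### The exponential formula for forests with an automorphism. -/

namespace PolyaForest

theorem sum_dite_zero {ι M : Type*} [Fintype ι] [AddCommMonoid M] (p : ι → Prop) [DecidablePred p]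
    [Fintype {x // p x}] (f : {x // p x} → M) :
    ∑ x, (if h : p x then f ⟨x, h⟩ else 0) = ∑ y, f y := by
  have h : ∀ y : {x // p x}, f y = if h : p y then f ⟨y, h⟩ else 0 := fun y => by
    rw [dif_pos y.2]
  rw [Finset.sum_congr rfl fun y _ => h y,
    ← Finset.sum_filter_add_sum_filter_not Finset.univ p (fun x => if h : p x then f ⟨x, h⟩ else 0),
    Finset.sum_eq_zero (s := Finset.univ.filter fun x => ¬ p x)
      (fun x hx => dif_neg (Finset.mem_filter.1 hx).2), add_zero]
  exact Finset.sum_subtype _ (by simp) _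

namespace AutForest

open Equiv.Perm

variable {V V' : Type} {R : Type*}

/-- `w` belongs to the orbit of the tree of `v` under the automorphism. -/
def Linked (x : AutForest V) (v w : V) : Prop := x.aut.SameCycle (x.root v) (x.root w)

theorem closed_linked (x : AutForest V) (v : V) : x.Closed (x.Linked v) where
  par w := by simp [Linked, root_par]
  aut w := by simp [Linked, root_aut, sameCycle_apply_right]

/-- The roots of the forest form a single orbit of the automorphism. -/
def Connected (x : AutForest V) : Prop := Nonempty V ∧ ∀ v w, x.Linked v w

theorem connected_relabel (x : AutForest V) (e : V ≃ V') :
    (x.relabel e).Connected ↔ x.Connected := by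
  unfold Connected Linked
  rw [e.nonempty_congr]
  refine and_congr_right fun _ => ?_
  have h : ∀ v w : V, (x.relabel e).aut.SameCycle (e v) (e w) ↔ x.aut.SameCycle v w := by
    intro v w
    have : ∀ (k : ℤ) (v : V), ((x.relabel e).aut ^ k) (e v) = e ((x.aut ^ k) v) := by
      intro k v
      have h1 : (x.relabel e).aut ^ k = e.permCongr (x.aut ^ k) :=
        (map_zpow (e.permCongrHom) x.aut k).symm
      rw [h1]; simp [Equiv.permCongr_apply]
    simp [SameCycle, this]
  rw [← e.forall_congr_right]
  refine forall_congr' fun v => ?_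
  rw [← e.forall_congr_right]
  simp [h]

/-- The right side speaks of `v` and the restriction to `P` only, so a forest with prescribed block
of `v` can be split into two independent parts. -/
theorem forall_iff_linked (x : AutForest V) (P : V → Prop) (v : V) :
    (∀ w, P w ↔ x.Linked v w) ↔
      P v ∧ ∃ h : x.Closed P, (x.restrict P h).Connected := by
  constructor
  · intro h
    obtain rfl : P = x.Linked v := funext fun w => propext (h w)
    have hv : x.Linked v v := SameCycle.refl _ _
    refine ⟨hv, x.closed_linked v, ⟨⟨v, hv⟩⟩, fun a b => ?_⟩
    rw [Linked, restrict_sameCycle, restrict_root, restrict_root]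
    exact a.2.symm.trans b.2
  · rintro ⟨hv, h, hc⟩ w
    constructor
    · intro hw
      have := hc.2 ⟨v, hv⟩ ⟨w, hw⟩
      rwa [Linked, restrict_sameCycle, restrict_root, restrict_root] at this
    · rintro ⟨k, hk⟩
      rw [← h.root w, ← hk]
      have : ∀ (k : ℤ) u, P u → P ((x.aut ^ k) u) := fun k u hu =>
        by simpa [subtypePerm_zpow] using (((x.aut.subtypePerm fun v => h.aut v) ^ k) ⟨u, hu⟩).2
      exact this k _ ((h.root v).2 hv)

/-- Invariance of a function of forests under relabelling. -/
def Invariant (ω : ∀ V : Type, AutForest V → R) : Prop :=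
  ∀ {V V' : Type} [Finite V] (e : V ≃ V') (x : AutForest V), ω V' (x.relabel e) = ω V x

/-- Multiplicativity of a function of forests over decompositions into closed parts. -/
def Multiplicative [Mul R] (ω : ∀ V : Type, AutForest V → R) : Prop :=
  ∀ {V : Type} [Finite V] (P : V → Prop) (x : AutForest V) (h : x.Closed P),
    ω V x = ω _ (x.restrict P h) * ω _ (x.restrict (fun v => ¬ P v) h.not)

/-- The sum of a function over all forests on `n` vertices. -/
def total [AddCommMonoid R] (ω : ∀ V : Type, AutForest V → R) (n : ℕ) : R :=
  ∑ x : AutForest (Fin n), ω _ x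

theorem sum_eq_total [AddCommMonoid R] {ω : ∀ V : Type, AutForest V → R} (hω : Invariant ω)
    [Finite V] : ∑ x : AutForest V, ω V x = total ω (Nat.card V) := by
  let e := Finite.equivFin V
  exact Fintype.sum_equiv (relabelEquiv e) _ _ fun x => (hω e x).symm

open Classical in
/-- The restriction of a function to connected forests. -/
def conn [Zero R] (ω : ∀ V : Type, AutForest V → R) (V : Type) (x : AutForest V) : R :=
  if x.Connected then ω V x else 0

theorem Invariant.conn [Zero R] {ω : ∀ V : Type, AutForest V → R} (hω : Invariant ω) :
    Invariant (conn ω) := by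
  intro V V' _ e x
  classical
  exact if_congr (connected_relabel x e) (hω e x) rfl

open Classical in
-- Pointing: the factor `card V` chooses a vertex v, and v determines its block A. With A summed
-- first, the forest splits into a connected part on A and an arbitrary part on the complement, and
-- v is one of |A| vertices.
theorem card_nsmul_sum_closed [CommSemiring R] {ω : ∀ V : Type, AutForest V → R}
    (hm : Multiplicative ω) [Fintype V] :
    Fintype.card V • ∑ x : AutForest V, ω V x =
      ∑ A : Finset V, A.card • ((∑ y : AutForest {v // v ∈ A}, conn ω _ y) *
        ∑ z : AutForest {v // v ∉ A}, ω _ z) := by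
  calc Fintype.card V • ∑ x : AutForest V, ω V x
      = ∑ x : AutForest V, ∑ v : V, ∑ A : Finset V,
          if (∀ w, w ∈ A ↔ x.Linked v w) then ω V x else 0 := by
        rw [Finset.smul_sum]
        refine Finset.sum_congr rfl fun x _ => ?_
        rw [← Finset.card_univ, ← Finset.sum_const]
        refine Finset.sum_congr rfl fun v _ => ?_
        rw [Finset.sum_eq_single (Finset.univ.filter (x.Linked v))]
        · simp
        · intro A _ hA
          rw [if_neg]
          contrapose! hA
          ext w
          simp [hA]
        · simp
    _ = ∑ A : Finset V, ∑ x : AutForest V, ∑ v : V,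
          if (∀ w, w ∈ A ↔ x.Linked v w) then ω V x else 0 := by
        rw [Finset.sum_comm]
        simp_rw [Finset.sum_comm (s := (Finset.univ : Finset (AutForest V)))]
        rw [Finset.sum_comm]
    _ = _ := by
        refine Finset.sum_congr rfl fun A _ => ?_
        rw [← sum_restrict_mul_restrict (fun v => v ∈ A), Finset.smul_sum]
        have h1 : ∀ x : AutForest V, (∑ v : V, if (∀ w, w ∈ A ↔ x.Linked v w) then ω V x else 0) =
            if h : x.Closed (fun v => v ∈ A) then
              A.card • (conn ω _ (x.restrict (fun v => v ∈ A) h) *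
                ω _ (x.restrict (fun v => ¬ v ∈ A) h.not)) else 0 := by
          intro x
          simp_rw [x.forall_iff_linked (fun v => v ∈ A)]
          split_ifs with h
          · simp only [h, exists_true_left, conn]
            split_ifs with hc
            · simp [hc, hm (fun v => v ∈ A) x h, Finset.sum_ite_mem]
            · simp [hc]
          · simp [h]
        rw [Finset.sum_congr rfl fun x _ => h1 x]
        exact sum_dite_zero _ fun x : {x : AutForest V // x.Closed (fun v => v ∈ A)} =>
          A.card • (conn ω _ (x.1.restrict (fun v => v ∈ A) x.2) *
                ω _ (x.1.restrict (fun v => ¬ v ∈ A) x.2.not))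

theorem nsmul_total [CommSemiring R] {ω : ∀ V : Type, AutForest V → R}
    (hω : Invariant ω) (hm : Multiplicative ω) (n : ℕ) :
    n • total ω n = ∑ k ∈ Finset.range (n + 1),
      n.choose k • k • (total (conn ω) k * total ω (n - k)) := by
  classical
  have h := card_nsmul_sum_closed hm (V := Fin n)
  rw [Fintype.card_fin] at h
  rw [total, h]
  have h1 : ∀ A : Finset (Fin n), A.card • ((∑ y : AutForest {v // v ∈ A}, conn ω _ y) *
        ∑ z : AutForest {v // v ∉ A}, ω _ z) =
        A.card • (total (conn ω) A.card * total ω (n - A.card)) := by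
    intro A
    rw [sum_eq_total hω.conn, sum_eq_total hω]
    simp [Nat.card_eq_fintype_card, Fintype.card_subtype_compl]
  rw [Finset.sum_congr rfl fun A _ => h1 A, ← Finset.powerset_univ,
    Finset.sum_powerset_apply_card (fun k => k • (total (conn ω) k * total ω (n - k)))]
  simp

open PowerSeries in
/-- The exponential generating function of the totals of a function of forests. -/
def egf [CommRing R] [Algebra ℝ R] (ω : ∀ V : Type, AutForest V → R) : R⟦X⟧ :=
  PowerSeries.mk fun n => (n.factorial : ℝ)⁻¹ • total ω n

open PowerSeries in
/-- The exponential formula. -/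
theorem egf_eq_exp_subst [CommRing R] [Algebra ℝ R] [Algebra ℚ R] [IsAddTorsionFree R]
    {ω : ∀ V : Type, AutForest V → R} (hω : Invariant ω) (hm : Multiplicative ω)
    (h0 : total ω 0 = 1) : egf ω = (exp R).subst (egf (conn ω)) := by
  have hK : constantCoeff (egf (conn ω)) = 0 := by
    rw [← coeff_zero_eq_constantCoeff_apply, egf, coeff_mk]
    rw [total, Finset.sum_eq_zero, smul_zero]
    exact fun x _ => if_neg fun h => h.1.elim fun v => v.elim0
  refine eq_exp_subst_of_derivative hK ?_ ?_
  · rw [← coeff_zero_eq_constantCoeff_apply, egf, coeff_mk]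
    simp [h0]
  · ext n
    rw [coeff_derivative, coeff_mul, Finset.Nat.sum_antidiagonal_eq_sum_range_succ_mk]
    simp only [coeff_derivative, egf, coeff_mk]
    -- The pointing identity for n + 1 vertices is the coefficient of z^n in S' = K' S.
    have h := congrArg (fun r => ((n + 1).factorial : ℝ)⁻¹ • r) (nsmul_total hω hm (n + 1))
    rw [Finset.sum_range_succ'] at h
    simp only [zero_smul, smul_zero, add_zero, Nat.add_sub_add_right] at h
    rw [show (n : R) + 1 = ((n + 1 : ℕ) : R) by push_cast; rfl, smul_mul_assoc, mul_comm,
      ← nsmul_eq_mul, h, Finset.smul_sum]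
    refine Finset.sum_congr rfl fun k hk => ?_
    have hk' : k + 1 ≤ n + 1 := by simpa using hk
    have hr : ((k + 1).factorial : ℝ)⁻¹ • total (conn ω) (k + 1) * ((k : R) + 1) *
        ((n - k).factorial : ℝ)⁻¹ • total ω (n - k) =
        (((k + 1).factorial : ℝ)⁻¹ * ((n - k).factorial : ℝ)⁻¹ * ((k + 1 : ℕ) : ℝ)) •
          (total (conn ω) (k + 1) * total ω (n - k)) := by
      simp only [Algebra.smul_def, map_mul, map_natCast]
      push_cast
      ring
    rw [hr, ← Nat.cast_smul_eq_nsmul ℝ, ← Nat.cast_smul_eq_nsmul ℝ, smul_smul, smul_smul,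
      Nat.cast_choose ℝ hk', Nat.add_sub_add_right]
    congr 1
    have h1 := (n + 1).factorial_ne_zero
    have h2 := (k + 1).factorial_ne_zero
    have h3 := (n - k).factorial_ne_zero
    field_simp

end AutForest

end PolyaForest

/-! ### Attached forests, and the splitting into fixed and moved trees. -/

namespace PolyaForest

namespace AutForest

variable {V V' : Type}

/-- The vertices below those children of `v` that are moved by the automorphism. -/
def attached (x : AutForest V) (v : V) : Set V :=
  {w | ∃ c, x.par c = v ∧ c ≠ v ∧ x.aut c ≠ c ∧ ∃ k, x.par^[k] w = c}

/-- The number of fixed vertices whose attached forest has `m` vertices. -/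
def numAttached (x : AutForest V) (m : ℕ) : ℕ :=
  {v | x.aut v = v ∧ (x.attached v).ncard = m}.ncard

/-- All roots are fixed by the automorphism. -/
def FixesRoots (x : AutForest V) : Prop := ∀ v, x.aut (x.root v) = x.root v

/-- All roots are moved by the automorphism. -/
def MovesRoots (x : AutForest V) : Prop := ∀ v, x.aut (x.root v) ≠ x.root v

theorem attached_relabel (x : AutForest V) (e : V ≃ V') (v : V) :
    (x.relabel e).attached (e v) = e '' x.attached v := by
  ext w
  obtain ⟨w, rfl⟩ := e.surjective w
  simp only [attached, Set.mem_ofPred_eq, e.injective.mem_set_image]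
  rw [← e.exists_congr_right]
  simp [relabel_iterate]

theorem numAttached_relabel (x : AutForest V) (e : V ≃ V') (m : ℕ) :
    (x.relabel e).numAttached m = x.numAttached m := by
  unfold numAttached
  rw [← Set.ncard_image_of_injective _ e.injective]
  congr 1
  ext w
  obtain ⟨w, rfl⟩ := e.surjective w
  simp only [Set.mem_ofPred_eq, e.injective.mem_set_image, relabel_aut, e.apply_eq_iff_eq,
    attached_relabel, Set.ncard_image_of_injective _ e.injective]

theorem fixesRoots_relabel (x : AutForest V) (e : V ≃ V') :
    (x.relabel e).FixesRoots ↔ x.FixesRoots := by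
  unfold FixesRoots
  rw [← e.forall_congr_right]
  simp

theorem movesRoots_relabel (x : AutForest V) (e : V ≃ V') :
    (x.relabel e).MovesRoots ↔ x.MovesRoots := by
  unfold MovesRoots
  rw [← e.forall_congr_right]
  simp

theorem Closed.iterate {x : AutForest V} {P : V → Prop} (h : x.Closed P) (k : ℕ) (v : V) :
    P (x.par^[k] v) ↔ P v := by
  induction k with
  | zero => rfl
  | succ k ih => rw [Function.iterate_succ_apply', h.par, ih]

theorem attached_restrict (x : AutForest V) {P : V → Prop} (h : x.Closed P) (v : {v // P v}) :
    x.attached v = Subtype.val '' (x.restrict P h).attached v := by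
  ext w
  simp only [attached, Set.mem_ofPred_eq, Set.mem_image]
  constructor
  · rintro ⟨c, hcv, hne, hm, k, hk⟩
    have hc : P c := (h.par c).1 (hcv ▸ v.2)
    have hw : P w := (h.iterate k w).1 (hk ▸ hc)
    refine ⟨⟨w, hw⟩, ⟨⟨c, hc⟩, Subtype.ext hcv, fun e => hne (congrArg Subtype.val e),
      fun e => hm (congrArg Subtype.val e), k, Subtype.ext ?_⟩, rfl⟩
    rw [restrict_iterate, hk]
  · rintro ⟨w, ⟨c, hcv, hne, hm, k, hk⟩, rfl⟩
    refine ⟨c, congrArg Subtype.val hcv, fun e => hne (Subtype.ext e),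
      fun e => hm (Subtype.ext e), k, ?_⟩
    rw [← restrict_iterate x h, hk]

theorem ncard_attached_restrict (x : AutForest V) {P : V → Prop} (h : x.Closed P)
    (v : {v // P v}) : ((x.restrict P h).attached v).ncard = (x.attached v).ncard := by
  rw [attached_restrict x h, Set.ncard_image_of_injective _ Subtype.val_injective]

theorem numAttached_restrict [Finite V] (x : AutForest V) {P : V → Prop} (h : x.Closed P) (m : ℕ) :
    x.numAttached m = (x.restrict P h).numAttached m +
      (x.restrict (fun v => ¬ P v) h.not).numAttached m := by
  unfold numAttached
  simp only [ncard_attached_restrict]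
  rw [← Set.ncard_image_of_injective {v : {v // P v} | _} Subtype.val_injective,
    ← Set.ncard_image_of_injective {v : {v // ¬ P v} | _} Subtype.val_injective,
    ← Set.ncard_union_eq]
  · congr 1
    ext v
    simp only [Set.mem_union, Set.mem_image, Set.mem_ofPred_eq, Subtype.exists, Subtype.ext_iff,
      restrict_aut, exists_and_right, exists_eq_right]
    by_cases hv : P v <;> simp [hv]
  · rw [Set.disjoint_left]
    rintro _ ⟨v, _, rfl⟩ ⟨w, _, hw⟩
    exact w.2 (hw ▸ v.2)

theorem fixesRoots_restrict (x : AutForest V) {P : V → Prop} (h : x.Closed P) :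
    (x.restrict P h).FixesRoots ↔ ∀ v, P v → x.aut (x.root v) = x.root v := by
  simp [FixesRoots, Subtype.ext_iff]

theorem movesRoots_restrict (x : AutForest V) {P : V → Prop} (h : x.Closed P) :
    (x.restrict P h).MovesRoots ↔ ∀ v, P v → x.aut (x.root v) ≠ x.root v := by
  simp [MovesRoots, Subtype.ext_iff]

/-- The tree of a fixed vertex has a fixed root, so there are no fixed vertices at all. -/
theorem MovesRoots.numAttached_eq_zero {x : AutForest V} (h : x.MovesRoots) (m : ℕ) :
    x.numAttached m = 0 := by
  unfold numAttached
  convert Set.ncard_empty V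
  ext v
  simp only [Set.mem_ofPred_eq, Set.mem_empty_iff_false, iff_false, not_and]
  intro hv
  exact absurd (by rw [← x.root_aut, hv]) (h v)

open Classical in
/-- Forests with fixed roots, where fixed vertices with an attached forest of size `m` are marked
by `u`. -/
def fixedWeight {R : Type*} [Semiring R] (u : R) (m : ℕ) (V : Type) (x : AutForest V) : R :=
  if x.FixesRoots then u ^ x.numAttached m else 0

open Classical in
/-- The indicator of the forests whose roots are all moved by the automorphism. -/
def movedWeight (R : Type*) [Semiring R] (V : Type) (x : AutForest V) : R :=
  if x.MovesRoots then 1 else 0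

section Weights

variable {R : Type*} [CommSemiring R] (u : R) (m : ℕ)

theorem invariant_fixedWeight : Invariant (fixedWeight u m) := by
  intro V V' _ e x
  classical
  exact if_congr (fixesRoots_relabel x e) (by rw [numAttached_relabel]) rfl

theorem invariant_movedWeight : Invariant (movedWeight R) := by
  intro V V' _ e x
  classical
  exact if_congr (movesRoots_relabel x e) rfl rfl

theorem multiplicative_fixedWeight : Multiplicative (fixedWeight u m) := by
  intro V _ P x h
  classical
  have hx : x.FixesRoots ↔ (x.restrict P h).FixesRoots ∧
      (x.restrict (fun v => ¬ P v) h.not).FixesRoots := by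
    rw [fixesRoots_restrict, fixesRoots_restrict]
    exact ⟨fun H => ⟨fun v _ => H v, fun v _ => H v⟩,
      fun H v => (em (P v)).elim (H.1 v) (H.2 v)⟩
  rw [fixedWeight, fixedWeight, fixedWeight, if_congr hx rfl rfl, numAttached_restrict x h, pow_add,
    ite_zero_mul_ite_zero]

theorem multiplicative_movedWeight : Multiplicative (movedWeight R) := by
  intro V _ P x h
  classical
  have hx : x.MovesRoots ↔ (x.restrict P h).MovesRoots ∧
      (x.restrict (fun v => ¬ P v) h.not).MovesRoots := by
    rw [movesRoots_restrict, movesRoots_restrict]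
    exact ⟨fun H => ⟨fun v _ => H v, fun v _ => H v⟩,
      fun H v => (em (P v)).elim (H.1 v) (H.2 v)⟩
  rw [movedWeight, movedWeight, movedWeight, if_congr hx rfl rfl, ite_zero_mul_ite_zero, mul_one]

instance [IsEmpty V] : Unique (AutForest V) where
  default := ⟨isEmptyElim, 1, isEmptyElim, isEmptyElim⟩
  uniq _ := AutForest.ext (Subsingleton.elim _ _) (Subsingleton.elim _ _)

theorem total_fixedWeight_zero : total (fixedWeight u m) 0 = 1 := by
  have h : ∀ x : AutForest (Fin 0), x.FixesRoots := fun x v => v.elim0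
  have h' : ∀ x : AutForest (Fin 0), x.numAttached m = 0 := fun x => by
    rw [numAttached, Set.eq_empty_of_isEmpty {v : Fin 0 | _}, Set.ncard_empty]
  rw [total, Fintype.sum_unique, fixedWeight, if_pos (h _), h', pow_zero]

theorem total_movedWeight_zero : total (movedWeight R) 0 = 1 := by
  have h : ∀ x : AutForest (Fin 0), x.MovesRoots := fun x v => v.elim0
  rw [total, Fintype.sum_unique, movedWeight, if_pos (h _)]

end Weights

/-- The vertices in the trees that are moved by the automorphism. -/
def moved (x : AutForest V) : Set V := {w | x.aut (x.root w) ≠ x.root w}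

open Classical in
-- The union of the trees with fixed root is the only closed set A such that all roots in A are
-- fixed and all others moved. Marked vertices occur only inside A, and `moved` is its complement.
theorem sum_pow_numAttached_mul {R : Type*} [CommSemiring R] (u : R) (m : ℕ) [Fintype V]
    (f : ℕ → R) :
    ∑ x : AutForest V, u ^ x.numAttached m * f x.moved.ncard =
      ∑ A : Finset V, (∑ y : AutForest {v // v ∈ A}, fixedWeight u m _ y) *
        ((∑ z : AutForest {v // v ∉ A}, movedWeight R _ z) * f (Fintype.card V - A.card)) := by
  have key : ∀ x : AutForest V, u ^ x.numAttached m * f x.moved.ncard = ∑ A : Finset V,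
      if h : x.Closed (fun v => v ∈ A) then
        fixedWeight u m _ (x.restrict (fun v => v ∈ A) h) *
          (movedWeight R _ (x.restrict (fun v => ¬ v ∈ A) h.not) *
            f (Fintype.card V - A.card)) else 0 := by
    intro x
    let B : Finset V := Finset.univ.filter fun w => x.aut (x.root w) = x.root w
    have hB : x.Closed (fun v => v ∈ B) := by
      constructor
      · intro v; simp [B, root_par]
      · intro v; simp [B, root_aut]
    rw [Finset.sum_eq_single B]
    · have hf : (x.restrict (fun v => v ∈ B) hB).FixesRoots := by
        rw [fixesRoots_restrict]; simp [B]
      have hm : (x.restrict (fun v => ¬ v ∈ B) hB.not).MovesRoots := by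
        rw [movesRoots_restrict]; simp [B]
      rw [dif_pos hB, fixedWeight, movedWeight, if_pos hf, if_pos hm, numAttached_restrict x hB,
        hm.numAttached_eq_zero, add_zero, one_mul]
      congr 2
      rw [← Finset.card_compl, ← Set.ncard_coe_finset]
      congr 1
      ext w
      simp [B, moved]
    · intro A _ hA
      split_ifs with h
      · rw [fixedWeight, movedWeight]
        split_ifs with hf hm
        · exfalso
          apply hA
          rw [fixesRoots_restrict] at hf
          rw [movesRoots_restrict] at hm
          ext w
          simp only [B, Finset.mem_filter, Finset.mem_univ, true_and]
          exact ⟨hf w, fun hw => by_contra fun hn => hm w hn hw⟩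
        all_goals simp
      · rfl
    · simp
  rw [Finset.sum_congr rfl fun x _ => key x, Finset.sum_comm]
  refine Finset.sum_congr rfl fun A _ => ?_
  rw [sum_dite_zero _ fun x : {x : AutForest V // x.Closed (fun v => v ∈ A)} =>
          (fixedWeight u m _ (x.1.restrict (fun v => v ∈ A) x.2) *
          (movedWeight R _ (x.1.restrict (fun v => ¬ v ∈ A) x.2.not) *
            f (Fintype.card V - A.card)))]
  simp_rw [← mul_assoc]
  rw [← Finset.sum_mul]
  congr 1
  exact sum_restrict_mul_restrict (fun v => v ∈ A) _ _

theorem sum_pow_numAttached_mul_eq {R : Type*} [CommSemiring R] (u : R) (m n : ℕ) (f : ℕ → R) :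
    ∑ x : AutForest (Fin n), u ^ x.numAttached m * f x.moved.ncard =
      ∑ k ∈ Finset.range (n + 1), n.choose k •
        (total (fixedWeight u m) k * (total (movedWeight R) (n - k) * f (n - k))) := by
  classical
  rw [sum_pow_numAttached_mul]
  have h1 : ∀ A : Finset (Fin n), (∑ y : AutForest {v // v ∈ A}, fixedWeight u m _ y) *
        ((∑ z : AutForest {v // v ∉ A}, movedWeight R _ z) * f (Fintype.card (Fin n) - A.card)) =
        total (fixedWeight u m) A.card *
          (total (movedWeight R) (n - A.card) * f (n - A.card)) := by
    intro A
    rw [sum_eq_total (invariant_fixedWeight u m), sum_eq_total invariant_movedWeight]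
    simp [Nat.card_eq_fintype_card, Fintype.card_subtype_compl]
  rw [Finset.sum_congr rfl fun A _ => h1 A, ← Finset.powerset_univ,
    Finset.sum_powerset_apply_card (fun k => total (fixedWeight u m) k *
          (total (movedWeight R) (n - k) * f (n - k)))]
  simp

end AutForest

end PolyaForest

/-! ### Adding a common root, and the functional equation. -/

namespace PolyaForest

namespace AutForest

variable {V V' : Type}

open Classical in
/-- The parent map of the tree that arises from a forest by adding a common root. -/
def graftPar (p : V → V) : Option V → Option V
  | none => none
  | some v => if p v = v then none else some (p v)

theorem graftPar_some_of_eq {p : V → V} {v : V} (h : p v = v) : graftPar p (some v) = none := by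
  simp [graftPar, h]

theorem graftPar_some_of_ne {p : V → V} {v : V} (h : p v ≠ v) :
    graftPar p (some v) = some (p v) := by
  simp [graftPar, h]

theorem graftPar_iterate_none (p : V → V) (k : ℕ) : (graftPar p)^[k] none = none :=
  Function.iterate_fixed rfl k

theorem graftPar_iterate_some (p : V → V) (k : ℕ) (v : V) :
    (graftPar p)^[k] (some v) = none ∨ (graftPar p)^[k] (some v) = some (p^[k] v) := by
  induction k generalizing v with
  | zero => exact Or.inr rfl
  | succ k ih =>
    rw [Function.iterate_succ_apply, Function.iterate_succ_apply]
    by_cases h : p v = v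
    · rw [graftPar_some_of_eq h, graftPar_iterate_none]; exact Or.inl rfl
    · rw [graftPar_some_of_ne h]; exact ih _

theorem exists_graftPar_iterate_eq_some {p : V → V} {v w : V} :
    (∃ k, (graftPar p)^[k] (some v) = some w) ↔ ∃ k, p^[k] v = w := by
  constructor
  · rintro ⟨k, hk⟩
    rcases graftPar_iterate_some p k v with h | h
    · simp [hk] at h
    · exact ⟨k, Option.some_injective _ (h.symm.trans hk)⟩
  · rintro ⟨k, hk⟩
    induction k generalizing v with
    | zero => exact ⟨0, congrArg some hk⟩
    | succ k ih =>
      rw [Function.iterate_succ_apply] at hk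
      obtain ⟨j, hj⟩ := ih hk
      by_cases h : p v = v
      · exact ⟨j, by rw [h] at hj; exact hj⟩
      · exact ⟨j + 1, by rw [Function.iterate_succ_apply, graftPar_some_of_ne h, hj]⟩

theorem exists_graftPar_iterate_eq_none (x : AutForest V) (v : Option V) :
    ∃ k, (graftPar x.par)^[k] v = none := by
  cases v with
  | none => exact ⟨0, rfl⟩
  | some v =>
    obtain ⟨k, hk⟩ := x.isForest v
    rcases graftPar_iterate_some x.par k v with h | h
    · exact ⟨k, h⟩
    · exact ⟨k + 1, by rw [Function.iterate_succ_apply', h, graftPar_some_of_eq hk]⟩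

/-- The tree that arises from a forest by adding a common root. -/
def graft (x : AutForest V) : AutForest (Option V) where
  par := graftPar x.par
  aut := x.aut.optionCongr
  isForest v := by
    obtain ⟨k, hk⟩ := exists_graftPar_iterate_eq_none x v
    exact ⟨k, by rw [hk]; rfl⟩
  comm v := by
    cases v with
    | none => rfl
    | some v =>
      by_cases h : x.par v = v
      · have h' : x.par (x.aut v) = x.aut v := by rw [← x.comm, h]
        simp [graftPar_some_of_eq h, graftPar_some_of_eq h']
      · have h' : x.par (x.aut v) ≠ x.aut v := by
          rw [← x.comm]; exact fun e => h (x.aut.injective e)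
        simp [graftPar_some_of_ne h, graftPar_some_of_ne h', x.comm]

theorem root_graft (x : AutForest V) (v : Option V) : x.graft.root v = none := by
  obtain ⟨k, hk⟩ := exists_graftPar_iterate_eq_none x v
  exact x.graft.root_eq_of_iterate rfl hk

theorem graft_injective : Function.Injective (graft : AutForest V → AutForest (Option V)) := by
  intro x y h
  have hp : graftPar x.par = graftPar y.par := congrArg AutForest.par h
  have ha : x.aut.optionCongr = y.aut.optionCongr := congrArg AutForest.aut h
  refine AutForest.ext (funext fun v => ?_) (Equiv.optionCongr_injective ha)
  have hv := congrFun hp (some v)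
  by_cases h1 : x.par v = v <;> by_cases h2 : y.par v = v
  · rw [h1, h2]
  · simp [graftPar_some_of_eq h1, graftPar_some_of_ne h2] at hv
  · simp [graftPar_some_of_ne h1, graftPar_some_of_eq h2] at hv
  · simpa [graftPar_some_of_ne h1, graftPar_some_of_ne h2] using hv

theorem exists_graft_eq (x : AutForest (Option V)) (hx : ∀ v, x.root v = none) :
    ∃ y : AutForest V, y.graft = x := by
  have hn : x.par none = none := by
    have := x.par_root none
    rwa [hx] at this
  have han : x.aut none = none := by
    have := x.root_aut none
    rw [hx, hx] at this
    exact this.symm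
  -- The children of the removed root become roots, that is, fixed points of the new parent map;
  -- this is the default value of `getD`.
  let p : V → V := fun v => (x.par (some v)).getD v
  let s : Equiv.Perm V := Equiv.removeNone x.aut
  have hs : ∀ v, some (s v) = x.aut (some v) := fun v => by
    apply Equiv.removeNone_some
    rcases h : x.aut (some v) with _ | w
    · rw [← han] at h
      exact absurd (x.aut.injective h) (by simp)
    · exact ⟨w, rfl⟩
  have hgp : graftPar p = x.par := by
    funext v
    cases v with
    | none => exact hn.symm
    | some v =>
      rcases h : x.par (some v) with _ | w
      · exact graftPar_some_of_eq (by simp [p, h])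
      · have hpw : p v = w := by simp [p, h]
        rw [graftPar_some_of_ne, hpw]
        rw [hpw]
        rintro rfl
        have := hx (some w)
        rw [x.root_eq_self h] at this
        simp at this
  have hforest : ∀ (k : ℕ) (v : V), x.par^[k] (some v) = none → ∃ j, p (p^[j] v) = p^[j] v := by
    intro k
    induction k with
    | zero => intro v h; simp at h
    | succ k ih =>
      intro v h
      rw [Function.iterate_succ_apply] at h
      rcases h1 : x.par (some v) with _ | w
      · exact ⟨0, by simp [p, h1]⟩
      · rw [h1] at h
        obtain ⟨j, hj⟩ := ih w h
        have : p v = w := by simp [p, h1]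
        exact ⟨j + 1, by rw [Function.iterate_succ_apply, this, hj]⟩
  refine ⟨⟨p, s, fun v => ?_, fun v => ?_⟩, ?_⟩
  · obtain ⟨k, hk⟩ := x.exists_iterate_eq_root (some v)
    exact hforest k v (hk.trans (hx _))
  · have hc := x.comm (some v)
    rw [← hs v] at hc
    rcases h : x.par (some v) with _ | w
    · rw [h, han] at hc
      have h1 : p v = v := by simp [p, h]
      have h2 : p (s v) = s v := by simp [p, ← hc]
      rw [h1, h2]
    · rw [h, ← hs w] at hc
      have h1 : p v = w := by simp [p, h]
      have h2 : p (s v) = s w := by simp [p, ← hc]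
      rw [h1, h2]
  · refine AutForest.ext hgp (Equiv.ext fun v => ?_)
    cases v with
    | none => exact han.symm
    | some v => exact hs v

/-- The children of the new root are the old roots, so its attached forest consists of the trees
with moved root. -/
theorem attached_graft_none (x : AutForest V) : x.graft.attached none = some '' x.moved := by
  ext w
  simp only [attached, Set.mem_ofPred_eq, Set.mem_image, moved]
  constructor
  · rintro ⟨c, hc, hne, hm, k, hk⟩
    obtain ⟨c, rfl⟩ := Option.ne_none_iff_exists'.1 hne
    cases w with
    | none => simp [graft, graftPar_iterate_none] at hk
    | some w =>
      obtain ⟨j, hj⟩ := exists_graftPar_iterate_eq_some.1 ⟨k, hk⟩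
      have hcr : x.par c = c := by
        by_contra h
        simp [graft, graftPar_some_of_ne h] at hc
      refine ⟨w, ?_, rfl⟩
      rw [x.root_eq_of_iterate hcr hj]
      simpa [graft] using hm
  · rintro ⟨w, hw, rfl⟩
    refine ⟨some (x.root w), graftPar_some_of_eq (x.par_root w), by simp, by simpa [graft] using hw,
      exists_graftPar_iterate_eq_some.2 (x.exists_iterate_eq_root w)⟩

theorem attached_graft_some (x : AutForest V) (v : V) :
    x.graft.attached (some v) = some '' x.attached v := by
  have hpar : ∀ c : V, x.graft.par (some c) = some v ↔ x.par c = v ∧ c ≠ v := by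
    intro c
    by_cases h : x.par c = c
    · simp only [graft, graftPar_some_of_eq h, reduceCtorEq, false_iff, not_and, not_not]
      rw [h]; exact id
    · simp only [graft, graftPar_some_of_ne h, Option.some.injEq, iff_self_and]
      rintro rfl e
      exact h e.symm
  ext w
  simp only [attached, Set.mem_ofPred_eq, Set.mem_image]
  constructor
  · rintro ⟨c, hc, hne, hm, k, hk⟩
    cases c with
    | none => exact absurd hc (by simp [graft, graftPar])
    | some c =>
      cases w with
      | none => simp [graft, graftPar_iterate_none] at hk
      | some w =>
        obtain ⟨h1, h2⟩ := (hpar c).1 hc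
        exact ⟨w, ⟨c, h1, h2, by simpa [graft] using hm,
          exists_graftPar_iterate_eq_some.1 ⟨k, hk⟩⟩, rfl⟩
  · rintro ⟨w, ⟨c, h1, h2, hm, hk⟩, rfl⟩
    exact ⟨some c, (hpar c).2 ⟨h1, h2⟩, by simpa using h2, by simpa [graft] using hm,
      exists_graftPar_iterate_eq_some.2 hk⟩

open Classical in
theorem numAttached_graft [Finite V] (x : AutForest V) (m : ℕ) :
    x.graft.numAttached m = x.numAttached m + if x.moved.ncard = m then 1 else 0 := by
  have h : {v | x.graft.aut v = v ∧ (x.graft.attached v).ncard = m} =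
      some '' {v | x.aut v = v ∧ (x.attached v).ncard = m} ∪
        if x.moved.ncard = m then {none} else ∅ := by
    ext v
    cases v with
    | none =>
      simp only [Set.mem_ofPred_eq, attached_graft_none,
        Set.ncard_image_of_injective _ (Option.some_injective _)]
      split_ifs with h <;> simp [graft, h]
    | some v =>
      simp only [Set.mem_ofPred_eq, attached_graft_some,
        Set.ncard_image_of_injective _ (Option.some_injective _)]
      split_ifs with h <;> simp [graft]
  unfold numAttached
  rw [h, Set.ncard_union_eq, Set.ncard_image_of_injective _ (Option.some_injective _)]
  · split_ifs <;> simp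
  · rw [Set.disjoint_left]
    rintro _ ⟨v, _, rfl⟩
    split_ifs <;> simp

/-- The forest is a tree. -/
def IsTree (x : AutForest V) : Prop := Nonempty V ∧ ∀ v w, x.root v = x.root w

/-- The orbit of a fixed root is a single root. -/
theorem connected_and_fixesRoots (x : AutForest V) :
    x.Connected ∧ x.FixesRoots ↔ x.IsTree := by
  constructor
  · rintro ⟨⟨h0, h1⟩, h2⟩
    refine ⟨h0, fun v w => ?_⟩
    exact ((Equiv.Perm.SameCycle.eq_of_left (h1 v w)) (h2 v))
  · rintro ⟨h0, h1⟩
    refine ⟨⟨h0, fun v w => ?_⟩, fun v => ?_⟩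
    · rw [Linked, h1 v w]
    · rw [← root_aut]; exact h1 _ _

open Classical in
theorem conn_fixedWeight {R : Type*} [Semiring R] (u : R) (m : ℕ) (x : AutForest V) :
    conn (fixedWeight u m) V x = if x.IsTree then u ^ x.numAttached m else 0 := by
  rw [conn, fixedWeight, ← ite_and, if_congr x.connected_and_fixesRoots rfl rfl]

open Classical in
-- The root of a tree has n + 1 possible labels, and without it any forest on n vertices can remain.
-- The root is fixed, so it adds one factor u exactly when the moved trees have m vertices in total.
theorem total_conn_fixedWeight_succ {R : Type*} [CommSemiring R] (u : R) (m n : ℕ) :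
    total (conn (fixedWeight u m)) (n + 1) = (n + 1) • ∑ y : AutForest (Fin n),
      u ^ y.numAttached m * if y.moved.ncard = m then u else 1 := by
  have h1 : ∀ x : AutForest (Fin (n + 1)), conn (fixedWeight u m) _ x =
      ∑ r : Fin (n + 1), if ∀ v, x.root v = r then u ^ x.numAttached m else 0 := by
    intro x
    rw [conn_fixedWeight, Finset.sum_eq_single (x.root 0)]
    · refine if_congr ⟨fun h v => h.2 _ _, fun h => ⟨⟨0⟩, fun v w => ?_⟩⟩ rfl rfl
      rw [h v, h w]
    · intro r _ hr
      rw [if_neg fun h => hr (h 0).symm]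
    · simp
  have h2 : ∀ r : Fin (n + 1), (∑ x : AutForest (Fin (n + 1)),
      if ∀ v, x.root v = r then u ^ x.numAttached m else 0) =
      ∑ y : AutForest (Fin n), u ^ y.numAttached m * if y.moved.ncard = m then u else 1 := by
    intro r
    let e : Option (Fin n) ≃ Fin (n + 1) := (finSuccEquiv' r).symm
    have he : e none = r := finSuccEquiv'_symm_none r
    rw [← (relabelEquiv e).sum_comp]
    have h3 : ∀ x : AutForest (Option (Fin n)),
        (if ∀ v, (relabelEquiv e x).root v = r then u ^ (relabelEquiv e x).numAttached m else 0) =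
        if h : ∀ v, x.root v = none then u ^ x.numAttached m else 0 := by
      intro x
      change (if ∀ v, (x.relabel e).root v = r then u ^ (x.relabel e).numAttached m else 0) = _
      rw [dite_eq_ite]
      refine if_congr ?_ (by rw [numAttached_relabel]) rfl
      rw [← e.forall_congr_right, ← he]
      simp
    rw [Finset.sum_congr rfl fun x _ => h3 x]
    refine (sum_dite_zero _ fun x : {x : AutForest (Option (Fin n)) // ∀ v, x.root v = none} =>
        u ^ x.1.numAttached m).trans ?_
    have hb : Function.Bijective (fun y : AutForest (Fin n) =>
        (⟨y.graft, root_graft y⟩ : {x : AutForest (Option (Fin n)) // ∀ v, x.root v = none})) :=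
      ⟨fun y z h => graft_injective (congrArg Subtype.val h), fun x => by
        obtain ⟨y, hy⟩ := exists_graft_eq x.1 x.2
        exact ⟨y, Subtype.ext hy⟩⟩
    rw [← hb.sum_comp]
    refine Finset.sum_congr rfl fun y _ => ?_
    rw [numAttached_graft, pow_add]
    split_ifs <;> simp
  rw [total, Finset.sum_congr rfl fun x _ => h1 x, Finset.sum_comm,
    Finset.sum_congr rfl fun r _ => h2 r]
  simp

open PowerSeries in
open Classical in
/-- The functional equation of trees whose attached forests of size `m` are marked by `u`. -/
theorem egf_conn_fixedWeight {R : Type*} [CommRing R] [Algebra ℝ R] [Algebra ℚ R]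
    [IsAddTorsionFree R] (u : R) (m : ℕ) :
    egf (conn (fixedWeight u m)) =
      X * (PowerSeries.mk fun j => coeff j (egf (movedWeight R)) * if j = m then u else 1) *
        (exp R).subst (egf (conn (fixedWeight u m))) := by
  rw [← egf_eq_exp_subst (invariant_fixedWeight u m) (multiplicative_fixedWeight u m)
    (total_fixedWeight_zero u m), mul_assoc]
  ext n
  cases n with
  | zero =>
    rw [coeff_zero_X_mul, egf, coeff_mk, total, Finset.sum_eq_zero, smul_zero]
    exact fun x _ => if_neg fun h => h.1.elim fun v => v.elim0
  | succ n =>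
    -- The n + 1 choices of the root cancel against (n + 1)!, and the binomial coefficient comes
    -- from the splitting into fixed and moved trees.
    rw [coeff_succ_X_mul, mul_comm, coeff_mul, Finset.Nat.sum_antidiagonal_eq_sum_range_succ_mk, egf,
      coeff_mk, total_conn_fixedWeight_succ,
      sum_pow_numAttached_mul_eq u m n (fun j => if j = m then u else 1), ← Nat.cast_smul_eq_nsmul ℝ,
      smul_smul, Finset.smul_sum]
    refine Finset.sum_congr rfl fun k hk => ?_
    have hk' : k ≤ n := by simpa [Nat.lt_succ_iff] using hk
    simp only [egf, coeff_mk]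
    rw [← Nat.cast_smul_eq_nsmul ℝ, smul_smul, Nat.cast_choose ℝ hk', smul_mul_assoc,
      smul_mul_assoc, mul_smul_comm, smul_smul]
    congr 1
    have h1 := n.factorial_ne_zero
    have h2 := k.factorial_ne_zero
    have h3 := (n - k).factorial_ne_zero
    rw [Nat.factorial_succ]
    push_cast
    have h4 : (n : ℝ) + 1 ≠ 0 := by positivity
    field_simp

end AutForest

end PolyaForest

/-! ### Connected forests as cycles of copies of one tree. -/

namespace PolyaForest

namespace AutForest

variable {V V' : Type}

section Cyclic

variable {i k : ℕ}

/-- The forest that consists of `i + 1` copies of a given forest that are cyclically permuted,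
where the last copy is mapped to the first one with a twist by the given automorphism. -/
def cyclic (i : ℕ) (y : AutForest V) : AutForest (Fin (i + 1) × V) where
  par v := (v.1, y.par v.2)
  aut := (finRotate (i + 1)).prodShear fun j => if j = Fin.last i then y.aut else 1
  isForest v := by
    obtain ⟨k, hk⟩ := y.isForest v.2
    have h : ∀ k, (fun v : Fin (i + 1) × V => (v.1, y.par v.2))^[k] v = (v.1, y.par^[k] v.2) := by
      intro k
      induction k with
      | zero => rfl
      | succ k ih => rw [Function.iterate_succ_apply', ih, Function.iterate_succ_apply']
    exact ⟨k, by simp [h, hk]⟩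
  comm v := by
    by_cases h : v.1 = Fin.last i <;> simp [Equiv.prodShear, h, y.comm]

theorem cyclic_par (y : AutForest V) (j : Fin (i + 1)) (a : V) :
    (cyclic i y).par (j, a) = (j, y.par a) := rfl

theorem cyclic_aut_last (y : AutForest V) (a : V) :
    (cyclic i y).aut (Fin.last i, a) = (0, y.aut a) := by
  simp [cyclic, Equiv.prodShear]

theorem cyclic_aut_of_lt (y : AutForest V) {j : ℕ} (hj : j < i) (a : V) :
    (cyclic i y).aut (⟨j, by omega⟩, a) = (⟨j + 1, by omega⟩, a) := by
  have h : (⟨j, by omega⟩ : Fin (i + 1)) ≠ Fin.last i := by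
    intro h; have := congrArg Fin.val h; simp at this; omega
  exact Prod.ext (finRotate_of_lt hj) (by simp [cyclic, Equiv.prodShear, h])

theorem cyclic_aut_iterate (y : AutForest V) {j : ℕ} (hj : j < i + 1) (a : V) :
    (cyclic i y).aut^[j] (0, a) = (⟨j, hj⟩, a) := by
  induction j with
  | zero => rfl
  | succ j ih => rw [Function.iterate_succ_apply', ih (by omega), cyclic_aut_of_lt y (by omega)]

theorem cyclic_root (y : AutForest V) (j : Fin (i + 1)) (a : V) :
    (cyclic i y).root (j, a) = (j, y.root a) := by
  obtain ⟨n, hn⟩ := y.exists_iterate_eq_root a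
  refine root_eq_of_iterate _ (k := n) ?_ ?_
  · rw [cyclic_par, par_root]
  · rw [← hn]
    exact (Function.Semiconj.iterate_right (f := Prod.mk j) (fun _ => rfl) n a).symm

theorem IsTree.cyclic_connected {y : AutForest V} (hy : y.IsTree) : (cyclic i y).Connected := by
  obtain ⟨⟨a⟩, h⟩ := hy
  refine ⟨⟨(0, a)⟩, fun v w => ?_⟩
  have key : ∀ v, (cyclic i y).aut.SameCycle (0, y.root a) ((cyclic i y).root v) := by
    rintro ⟨j, b⟩
    rw [cyclic_root, h b a]
    refine ⟨(j : ℕ), ?_⟩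
    rw [zpow_natCast, Equiv.Perm.coe_pow, cyclic_aut_iterate y j.2]
  exact (key v).symm.trans (key w)

theorem IsTree.range_cyclic {y : AutForest V} (hy : y.IsTree) (a : V) :
    Set.range (fun b : V => ((0 : Fin (i + 1)), b)) =
      {w | (cyclic i y).root w = (cyclic i y).root (0, a)} := by
  ext ⟨j, b⟩
  simp [cyclic_root, hy.2 b a, eq_comm]

theorem cyclic_injective : Function.Injective (cyclic i : AutForest V → _) := by
  intro y z h
  refine AutForest.ext (funext fun a => ?_) (Equiv.ext fun a => ?_)
  · have := congrArg (fun x : AutForest (Fin (i + 1) × V) => (x.par (0, a)).2) h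
    exact this
  · have := congrArg (fun x : AutForest (Fin (i + 1) × V) => (x.aut (Fin.last i, a)).2) h
    simpa [cyclic_aut_last] using this

end Cyclic

theorem aut_iterate_root (x : AutForest V) (j : ℕ) (v : V) :
    x.root (x.aut^[j] v) = x.aut^[j] (x.root v) :=
  (Function.Semiconj.iterate_right (f := x.root) (fun v => x.root_aut v) j v)

theorem aut_iterate_par (x : AutForest V) (j : ℕ) (v : V) :
    x.par (x.aut^[j] v) = x.aut^[j] (x.par v) :=
  (Function.Semiconj.iterate_right (f := x.par) (fun v => (x.comm v).symm) j v)

/-- The roots form one cycle, and the j-th power of the automorphism carries the tree of v onto the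
j-th tree of the cycle. -/
theorem Connected.bijective_iterate [Finite V] {x : AutForest V} (hx : x.Connected) (v : V) :
    Function.Bijective fun z : Fin (Function.minimalPeriod x.aut (x.root v)) ×
      {w // x.root w = x.root v} => x.aut^[z.1] z.2 := by
  set p := Function.minimalPeriod x.aut (x.root v)
  have hp : 0 < p := Function.minimalPeriod_pos_of_mem_periodicPts
    (x.aut.injective.mem_periodicPts _)
  constructor
  · rintro ⟨j, w, hw⟩ ⟨j', w', hw'⟩ h
    simp only at h
    have h1 := congrArg x.root h
    rw [aut_iterate_root, aut_iterate_root, hw, hw'] at h1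
    have hj : (j : ℕ) = j' := Function.iterate_injOn_Iio_minimalPeriod j.2 j'.2 h1
    obtain rfl : j = j' := Fin.ext hj
    have := (x.aut.injective.iterate j) h
    subst this
    rfl
  · intro w
    obtain ⟨n, hn⟩ := (hx.2 v w).exists_nat_pow_eq
    rw [Equiv.Perm.coe_pow, ← Function.iterate_mod_minimalPeriod_eq] at hn
    obtain ⟨u, hu⟩ := (x.aut.surjective.iterate (n % p)) w
    refine ⟨(⟨n % p, Nat.mod_lt _ hp⟩, ⟨u, ?_⟩), hu⟩
    apply x.aut.injective.iterate (n % p)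
    rw [← aut_iterate_root, hu]
    exact hn.symm

theorem Connected.card_eq [Finite V] {x : AutForest V} (hx : x.Connected) (v : V) :
    Nat.card V = Function.minimalPeriod x.aut (x.root v) * {w | x.root w = x.root v}.ncard := by
  rw [← Nat.card_congr (Equiv.ofBijective _ (hx.bijective_iterate v)), Nat.card_prod, Nat.card_fin]
  rfl

/-- The pairs of a connected forest and a vertex whose tree has `k` vertices. -/
abbrev PointedConnected (V : Type) (k : ℕ) : Type :=
  {z : AutForest V × V // z.1.Connected ∧ {w | z.1.root w = z.1.root z.2}.ncard = k}

/-- The rooted trees on `k` labelled vertices with an automorphism. -/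
abbrev AutTree (k : ℕ) : Type := {y : AutForest (Fin k) // y.IsTree}

theorem card_injective_range_eq [Fintype V] (C : Set V) {k : ℕ} (hC : C.ncard = k) :
    Nat.card {f : Fin k → V // Function.Injective f ∧ Set.range f = C} = k.factorial := by
  have e : (Fin k ≃ C) ≃ {f : Fin k → V // Function.Injective f ∧ Set.range f = C} :=
    { toFun := fun e => ⟨fun a => e a, Subtype.val_injective.comp e.injective, by
        rw [Set.range_comp' Subtype.val e, e.range_eq_univ]; simp⟩
      invFun := fun f => (Equiv.ofInjective f.1 f.2.1).trans (Equiv.setCongr f.2.2)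
      left_inv := fun e => by ext; rfl
      right_inv := fun f => rfl }
  classical
  rw [← Nat.card_congr e, Nat.card_eq_fintype_card]
  have : Fintype.card C = k := by rw [← hC, ← Nat.card_coe_set_eq, Nat.card_eq_fintype_card]
  rw [Fintype.card_equiv (Fintype.equivOfCardEq (by simp [this])), Fintype.card_fin]

/-- Labelling one tree by f labels all others through e(j, b) = σ^j (f b). In these coordinates σ
just moves to the next copy, except for the return to the first one; there it acts as σ^(i+1), which
is an automorphism of the tree of v and supplies the twist. -/
theorem surjective_cyclic_relabel [Finite V] {i k : ℕ} (hk : 0 < k) (hV : Nat.card V = (i + 1) * k)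
    (x : AutForest V) (hx : x.Connected) (f : Fin k → V) (v : V) (hf : Function.Injective f)
    (hr : Set.range f = {w | x.root w = x.root v}) :
    ∃ (e : Fin (i + 1) × Fin k ≃ V) (y : AutTree k) (a : Fin k),
      (cyclic i y.1).relabel e = x ∧ (fun b => e (0, b)) = f ∧ e (0, a) = v := by
  have hC : {w | x.root w = x.root v}.ncard = k := by
    rw [← hr, ← Set.image_univ, Set.ncard_image_of_injective _ hf]
    simp
  have hp : Function.minimalPeriod x.aut (x.root v) = i + 1 := by
    have := hx.card_eq v
    rw [hC, hV] at this
    exact (Nat.eq_of_mul_eq_mul_right hk this).symm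
  let g : Fin k ≃ {w // x.root w = x.root v} := (Equiv.ofInjective f hf).trans (Equiv.setCongr hr)
  have hg : ∀ b, (g b : V) = f b := fun b => rfl
  let e : Fin (i + 1) × Fin k ≃ V := ((finCongr hp.symm).prodCongr g).trans
    (Equiv.ofBijective _ (hx.bijective_iterate v))
  have he : ∀ j b, e (j, b) = x.aut^[j] (f b) := fun j b => rfl
  let x' : AutForest V :=
    { par := x.par
      aut := x.aut ^ (i + 1)
      isForest := x.isForest
      comm := fun v => by rw [Equiv.Perm.coe_pow, aut_iterate_par] }
  have hroot : ∀ w, x'.root w = x.root w := fun w => by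
    obtain ⟨n, hn⟩ := x.exists_iterate_eq_root w
    exact x'.root_eq_of_iterate (x.par_root w) hn
  have hclosed : x'.Closed fun w => x.root w = x.root v := by
    constructor
    · intro w
      change x.root (x.par w) = _ ↔ _
      rw [root_par]
    · intro w
      change x.root ((x.aut ^ (i + 1)) w) = _ ↔ _
      have h : x.aut^[i + 1] (x.root v) = x.root v := by
        rw [← hp]; exact Function.iterate_minimalPeriod
      rw [Equiv.Perm.coe_pow, aut_iterate_root]
      conv_lhs => rw [← h]
      exact (x.aut.injective.iterate _).eq_iff
  let y : AutForest (Fin k) := (x'.restrict _ hclosed).relabel g.symm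
  have hy : y.IsTree := by
    refine ⟨⟨⟨0, hk⟩⟩, fun a b => ?_⟩
    obtain ⟨a, rfl⟩ := g.symm.surjective a
    obtain ⟨b, rfl⟩ := g.symm.surjective b
    simp only [y, relabel_root, g.symm.apply_eq_iff_eq, Subtype.ext_iff, restrict_root, hroot, a.2,
      b.2]
  have hypar : ∀ b, f (y.par b) = x.par (f b) := fun b => by
    rw [← hg, ← hg]; simp [y, relabel, x']
  have hyaut : ∀ b, f (y.aut b) = x.aut^[i + 1] (f b) := fun b => by
    rw [← hg, ← hg, ← Equiv.Perm.coe_pow]; simp [y, relabel, Equiv.permCongr_apply, x']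
  obtain ⟨a, ha⟩ : v ∈ Set.range f := by rw [hr]; rfl
  refine ⟨e, ⟨y, hy⟩, a, AutForest.ext (funext fun w => ?_) (Equiv.ext fun w => ?_), rfl, ha⟩
  · obtain ⟨⟨j, b⟩, rfl⟩ := e.surjective w
    rw [relabel_par, cyclic_par, he, he, aut_iterate_par, hypar]
  · obtain ⟨⟨j, b⟩, rfl⟩ := e.surjective w
    rw [relabel_aut]
    rcases eq_or_ne j (Fin.last i) with rfl | hj
    · rw [cyclic_aut_last, he, he, hyaut, ← Function.iterate_succ_apply' (f := x.aut)]
      rfl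
    · have hj' : (j : ℕ) < i := Fin.val_lt_last hj
      have := cyclic_aut_of_lt y hj' b
      rw [show (cyclic i y).aut (j, b) = _ from this, he, he,
        ← Function.iterate_succ_apply' (f := x.aut)]

/-- Double counting of pointed connected forests with a labelling of the pointed tree by `Fin k`.
There are k! labelings, and by `surjective_cyclic_relabel` the same data are a bijection with `Fin
(i + 1) × Fin k`, a tree with an automorphism on `Fin k`, and a vertex of it. -/
theorem card_pointedConnected [Fintype V] {i k : ℕ} (hk : 0 < k) (hV : Nat.card V = (i + 1) * k) :
    Nat.card (PointedConnected V k) * k.factorial =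
      (Nat.card V).factorial * (Nat.card (AutTree k) * k) := by
  let Z : Type := Σ z : PointedConnected V k, {f : Fin k → V // Function.Injective f ∧
    Set.range f = {w | z.1.1.root w = z.1.1.root z.1.2}}
  have hZ : Nat.card Z = Nat.card (PointedConnected V k) * k.factorial := by
    have : ∀ z : PointedConnected V k, Nat.card {f : Fin k → V // Function.Injective f ∧
        Set.range f = {w | z.1.1.root w = z.1.1.root z.1.2}} = k.factorial := fun z =>
      card_injective_range_eq _ z.2.2
    classical
    rw [Nat.card_sigma, Finset.sum_congr rfl fun z _ => this z, Finset.sum_const, smul_eq_mul,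
      Finset.card_univ, Nat.card_eq_fintype_card]
  have hY : Nat.card ((Fin (i + 1) × Fin k ≃ V) × AutTree k × Fin k) =
      (Nat.card V).factorial * (Nat.card (AutTree k) * k) := by
    classical
    rw [Nat.card_prod, Nat.card_prod, Nat.card_fin, Nat.card_eq_fintype_card,
      Fintype.card_equiv (Fintype.equivOfCardEq (by
        rw [← Nat.card_eq_fintype_card (α := V), hV]; simp)), ← Nat.card_eq_fintype_card, hV]
    simp
  have hn : ∀ (y : AutTree k) (e : Fin (i + 1) × Fin k ≃ V) (a : Fin k),
      Set.range (fun b => e (0, b)) = {w | ((cyclic i y.1).relabel e).root w =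
        ((cyclic i y.1).relabel e).root (e (0, a))} := fun y e a => by
    rw [Set.range_comp' e, y.2.range_cyclic a]
    ext w
    obtain ⟨w, rfl⟩ := e.surjective w
    rw [e.injective.mem_set_image]
    simp
  let φ : (Fin (i + 1) × Fin k ≃ V) × AutTree k × Fin k → Z := fun t =>
    ⟨⟨((cyclic i t.2.1.1).relabel t.1, t.1 (0, t.2.2)),
      (connected_relabel _ _).2 t.2.1.2.cyclic_connected, by
        simp only
        rw [← hn, ← Set.image_univ, Set.ncard_image_of_injective _ fun a b h => by simpa using h]
        simp⟩,
      ⟨fun b => t.1 (0, b), fun a b h => by simpa using h, hn _ _ _⟩⟩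
  have hφ : Function.Bijective φ := by
    constructor
    · rintro ⟨e, y, a⟩ ⟨e', y', a'⟩ h
      have h1 : (cyclic i y.1).relabel e = (cyclic i y'.1).relabel e' :=
        congrArg (fun z : Z => z.1.1.1) h
      have h2 : e (0, a) = e' (0, a') := congrArg (fun z : Z => z.1.1.2) h
      have h3 : ∀ b, e (0, b) = e' (0, b) := fun b => congrArg (fun z : Z => z.2.1 b) h
      have h4 : ∀ (e : Fin (i + 1) × Fin k ≃ V) (y : AutTree k) (j : Fin (i + 1)) (b : Fin k),
          e (j, b) = ((cyclic i y.1).relabel e).aut^[j] (e (0, b)) := by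
        intro e y j b
        rw [← (Function.Semiconj.iterate_right (f := e)
          (fun v => ((cyclic i y.1).relabel_aut e v).symm) j (0, b)), cyclic_aut_iterate y.1 j.2]
      have h5 : e = e' := Equiv.ext fun ⟨j, b⟩ => by rw [h4 e y, h4 e' y', h1, h3]
      subst h5
      have h6 : y = y' := Subtype.ext (cyclic_injective ((relabelEquiv e).injective h1))
      subst h6
      have h7 : a = a' := by simpa using h2
      subst h7
      rfl
    · rintro ⟨⟨⟨x, v⟩, hx, hc⟩, f, hf, hr⟩
      obtain ⟨e, y, a, rfl, rfl, rfl⟩ := surjective_cyclic_relabel hk hV x hx f v hf hr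
      exact ⟨(e, y, a), rfl⟩
  rw [← hZ, ← hY]
  exact (Nat.card_congr (Equiv.ofBijective φ hφ)).symm

theorem Connected.movesRoots_iff [Finite V] {x : AutForest V} (hx : x.Connected) (v : V) :
    x.MovesRoots ↔ 2 ≤ Function.minimalPeriod x.aut (x.root v) := by
  have hp : 0 < Function.minimalPeriod x.aut (x.root v) :=
    Function.minimalPeriod_pos_of_mem_periodicPts (x.aut.injective.mem_periodicPts _)
  have h1 : x.MovesRoots ↔ x.aut (x.root v) ≠ x.root v :=
    ⟨fun h => h v, fun h w hw => h ((hx.2 v w).apply_eq_self_iff.2 hw)⟩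
  have h2 : Function.minimalPeriod x.aut (x.root v) = 1 ↔ x.aut (x.root v) = x.root v :=
    Function.minimalPeriod_eq_one_iff_isFixedPt
  rw [h1, ne_eq, ← h2]
  omega

open Classical in
-- The factor n points a vertex. The pairs are sorted by the number i of trees in the cycle, each of
-- size n/i; moved roots mean i ≥ 2.
theorem natCast_mul_total_conn_movedWeight (n : ℕ) :
    (n : ℝ) * total (conn (movedWeight ℝ)) n = ∑ i ∈ Finset.Icc 2 n,
      if i ∣ n then (n.factorial : ℝ) *
        ((n / i : ℕ) * (Nat.card (AutTree (n / i)) / ((n / i).factorial : ℝ))) else 0 := by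
  have h1 : ∀ x : AutForest (Fin n), (n : ℝ) * conn (movedWeight ℝ) _ x =
      ∑ v : Fin n, ∑ i ∈ Finset.Icc 2 n, if i ∣ n then
        (if x.Connected ∧ {w | x.root w = x.root v}.ncard = n / i then 1 else 0) else 0 := by
    intro x
    by_cases hx : x.Connected
    · have : ∀ v : Fin n, (∑ i ∈ Finset.Icc 2 n, if i ∣ n then
          (if x.Connected ∧ {w | x.root w = x.root v}.ncard = n / i then 1 else 0) else 0) =
          conn (movedWeight ℝ) _ x := by
        intro v
        have hc := hx.card_eq v
        rw [Nat.card_fin] at hc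
        set p := Function.minimalPeriod x.aut (x.root v)
        set c := {w | x.root w = x.root v}.ncard
        have hn : 0 < n := v.pos
        have hcp : 0 < c := Nat.pos_of_ne_zero fun h => by rw [h] at hc; omega
        rw [conn, if_pos hx, movedWeight, if_congr (hx.movesRoots_iff v) rfl rfl]
        -- For a given vertex only one i contributes, namely the length p of the cycle of its root.
        have h2 : ∀ i ∈ Finset.Icc 2 n, (if i ∣ n then
            (if x.Connected ∧ c = n / i then (1 : ℝ) else 0) else 0) = if i = p then 1 else 0 := by
          intro i hi
          have hi' : 0 < i := by have := (Finset.mem_Icc.1 hi).1; omega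
          rw [← ite_and]
          refine if_congr ⟨?_, ?_⟩ rfl rfl
          · rintro ⟨⟨j, hj⟩, _, hcj⟩
            rw [hj, Nat.mul_div_cancel_left _ hi'] at hcj
            rw [hj, hcj] at hc
            exact Nat.eq_of_mul_eq_mul_right (hcj ▸ hcp) hc
          · rintro rfl
            refine ⟨⟨c, hc⟩, hx, ?_⟩
            conv_rhs => rw [hc]
            rw [Nat.mul_div_cancel_left _ hi']
        rw [Finset.sum_congr rfl h2, Finset.sum_ite_eq']
        refine if_congr ?_ rfl rfl
        rw [Finset.mem_Icc, and_iff_left_iff_imp]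
        intro _
        rw [hc]
        exact Nat.le_mul_of_pos_right _ hcp
      rw [Finset.sum_congr rfl fun v _ => this v]
      simp
    · simp [conn, hx]
  rw [total, Finset.mul_sum, Finset.sum_congr rfl fun x _ => h1 x, ← Fintype.sum_prod_type',
    Finset.sum_comm]
  refine Finset.sum_congr rfl fun i hi => ?_
  split_ifs with hd
  · obtain ⟨k, hk⟩ := hd
    have hi2 := Finset.mem_Icc.1 hi
    obtain ⟨j, rfl⟩ : ∃ j, i = j + 1 := ⟨i - 1, by omega⟩
    have hki : n / (j + 1) = k := by rw [hk, Nat.mul_div_cancel_left _ (by omega)]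
    have hk0 : 0 < k := Nat.pos_of_ne_zero fun h => by rw [h] at hk; omega
    rw [hki]
    have h3 := card_pointedConnected (V := Fin n) (i := j) hk0 (by rw [Nat.card_fin, hk])
    have h4 : (∑ z : AutForest (Fin n) × Fin n, if z.1.Connected ∧
        {w | z.1.root w = z.1.root z.2}.ncard = k then (1 : ℝ) else 0) =
        Nat.card (PointedConnected (Fin n) k) := by
      rw [Finset.sum_boole, Nat.card_eq_fintype_card, Fintype.card_subtype]
    rw [h4]
    rw [Nat.card_fin] at h3
    have h5 : ((Nat.card (PointedConnected (Fin n) k) : ℝ)) * k.factorial =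
      n.factorial * (Nat.card (AutTree k) * k) := by exact_mod_cast h3
    have h6 : (k.factorial : ℝ) ≠ 0 := by exact_mod_cast k.factorial_ne_zero
    field_simp
    linarith
  · simp

end AutForest

end PolyaForest

/-! ### Rooted trees as graphs versus parent maps. -/

namespace PolyaForest

/-- A map all of whose iterates end up at the fixed point `r`. -/
structure IsTreeMap {V : Type} (p : V → V) (r : V) : Prop where
  map_root : p r = r
  exists_iterate : ∀ v, ∃ k, p^[k] v = r

namespace IsTreeMap

variable {V : Type} {p q : V → V} {r : V}

theorem induction (h : IsTreeMap p r) {P : V → Prop} (h0 : P r)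
    (h1 : ∀ v, v ≠ r → P (p v) → P v) (v : V) : P v := by
  obtain ⟨k, hk⟩ := h.exists_iterate v
  induction k generalizing v with
  | zero => rw [show v = r from hk]; exact h0
  | succ k ih =>
    by_cases hv : v = r
    · rw [hv]; exact h0
    · exact h1 v hv (ih _ hk)

/-- If v reaches r after j steps, it is still there after k * j ≥ j steps, when it has also returned
to v. -/
theorem eq_root_of_iterate_self (h : IsTreeMap p r) {v : V} {k : ℕ} (hk : 0 < k)
    (hv : p^[k] v = v) : v = r := by
  obtain ⟨j, hj⟩ := h.exists_iterate v
  have h1 : ∀ i, p^[k * i] v = v := fun i => by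
    rw [Function.iterate_mul]; exact Function.iterate_fixed hv i
  have h2 : p^[k * j] v = r := by
    obtain ⟨l, hl⟩ : ∃ l, k * j = l + j := ⟨k * j - j, by
      have := Nat.le_mul_of_pos_left j hk; omega⟩
    rw [hl, Function.iterate_add_apply, hj, Function.iterate_fixed h.map_root]
  rw [← h1 j, h2]

theorem eq_root (h : IsTreeMap p r) {v : V} (hv : p v = v) : v = r :=
  h.eq_root_of_iterate_self Nat.one_pos hv

/-- The adjacency relation that is determined by a parent map. -/
def TreeAdj (p : V → V) (v w : V) : Prop := v ≠ w ∧ (p v = w ∨ p w = v)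

/-- Induction away from the root: the edge from v to q v is also an edge of p. If p traversed it in
the other direction, agreement at q v would give q (q v) = v, a 2-cycle. -/
theorem eq_of_treeAdj (hp : IsTreeMap p r) (hq : IsTreeMap q r)
    (h : ∀ v w, TreeAdj p v w ↔ TreeAdj q v w) : p = q := by
  refine funext fun v => hq.induction (P := fun v => p v = q v) ?_ (fun v hv ih => ?_) v
  · rw [hp.map_root, hq.map_root]
  · have hne : v ≠ q v := fun e => hv (hq.eq_root e.symm)
    obtain ⟨-, h1 | h1⟩ := (h v (q v)).2 ⟨hne, Or.inl rfl⟩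
    · exact h1
    · rw [ih] at h1
      exact absurd (hq.eq_root_of_iterate_self (k := 2) (by norm_num) h1) hv

end IsTreeMap

namespace RTree

open IsTreeMap

variable {n : ℕ} (t s : RTree n)

/-- The path from the root to a vertex. -/
def path (w : Fin n) : t.graph.Walk t.root w :=
  Classical.choose (t.isTree.existsUnique_path t.root w)

theorem isPath_path (w : Fin n) : (t.path w).IsPath :=
  (Classical.choose_spec (t.isTree.existsUnique_path t.root w)).1

theorem eq_path {w : Fin n} {p : t.graph.Walk t.root w} (hp : p.IsPath) : p = t.path w :=
  (t.isTree.existsUnique_path t.root w).unique hp (t.isPath_path w)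

/-- The parent of a vertex. The parent of the root is the root itself. -/
def parent (w : Fin n) : Fin n := (t.path w).penultimate

theorem path_root : t.path t.root = .nil := (t.eq_path .nil).symm

theorem parent_root : t.parent t.root = t.root := by
  rw [parent, path_root]; rfl

theorem not_nil_path {w : Fin n} (hw : w ≠ t.root) : ¬ (t.path w).Nil :=
  SimpleGraph.Walk.not_nil_of_ne hw.symm

theorem adj_parent {w : Fin n} (hw : w ≠ t.root) : t.graph.Adj (t.parent w) w :=
  SimpleGraph.Walk.adj_penultimate (t.not_nil_path hw)

theorem path_eq_concat {w : Fin n} (hw : w ≠ t.root) :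
    t.path w = (t.path (t.parent w)).concat (t.adj_parent hw) := by
  have h : (t.path w).dropLast = t.path (t.parent w) := t.eq_path (t.isPath_path w).dropLast
  rw [← h]
  exact ((t.path w).concat_dropLast (t.adj_parent hw)).symm

theorem length_path_parent {w : Fin n} (hw : w ≠ t.root) :
    (t.path (t.parent w)).length < (t.path w).length := by
  rw [t.path_eq_concat hw, SimpleGraph.Walk.length_concat]
  exact Nat.lt_succ_self _

theorem isTreeMap_parent : IsTreeMap t.parent t.root where
  map_root := t.parent_root
  exists_iterate v := by
    induction h : (t.path v).length using Nat.strong_induction_on generalizing v with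
    | _ l ih =>
      by_cases hv : v = t.root
      · exact ⟨0, hv⟩
      · obtain ⟨k, hk⟩ := ih _ (h ▸ t.length_path_parent hv) _ rfl
        exact ⟨k + 1, hk⟩

theorem parent_eq_of_mem {v w : Fin n} (h : t.graph.Adj v w) (hv : v ∈ (t.path w).support) :
    t.parent w = v := by
  rw [parent, t.isTree.isAcyclic.path_concat (t.isPath_path v) (t.isPath_path w) h hv,
    SimpleGraph.Walk.penultimate_concat]

theorem adj_iff (v w : Fin n) : t.graph.Adj v w ↔ TreeAdj t.parent v w := by
  constructor
  · intro h
    refine ⟨h.ne, ?_⟩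
    by_cases hv : v ∈ (t.path w).support
    · exact Or.inr (t.parent_eq_of_mem h hv)
    · exact Or.inl (t.parent_eq_of_mem h.symm
        (t.isTree.isAcyclic.mem_support_of_ne_mem_support_of_adj_of_isPath
          (t.isPath_path v) (t.isPath_path w) h hv))
  · rintro ⟨hne, rfl | rfl⟩
    · refine (t.adj_parent fun h => hne ?_).symm
      rw [h, t.parent_root]
    · refine t.adj_parent fun h => hne ?_
      rw [h, t.parent_root]

theorem isAncestor_iff (v w : Fin n) : t.IsAncestor v w ↔ ∃ k, t.parent^[k] w = v := by
  have h0 : t.IsAncestor v w ↔ v ∈ (t.path w).support :=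
    ⟨fun ⟨p, hp, hv⟩ => t.eq_path hp ▸ hv, fun h => ⟨_, t.isPath_path w, h⟩⟩
  rw [h0]
  refine t.isTreeMap_parent.induction (P := fun w => v ∈ (t.path w).support ↔
    ∃ k, t.parent^[k] w = v) ?_ (fun w hw ih => ?_) w
  · rw [path_root]
    simp [Function.iterate_fixed t.parent_root, eq_comm]
  · rw [t.path_eq_concat hw, SimpleGraph.Walk.support_concat, List.mem_append,
      List.mem_singleton, ih]
    constructor
    · rintro (⟨k, hk⟩ | rfl)
      · exact ⟨k + 1, hk⟩
      · exact ⟨0, rfl⟩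
    · rintro ⟨k, hk⟩
      cases k with
      | zero => exact Or.inr hk.symm
      | succ k => exact Or.inl ⟨k, hk⟩

theorem isChild_iff (v c : Fin n) : t.IsChild v c ↔ t.parent c = v ∧ c ≠ v := by
  rw [IsChild, adj_iff, isAncestor_iff]
  constructor
  · rintro ⟨⟨hne, h | h⟩, k, hk⟩
    · exfalso
      have hc : t.parent^[k + 1] c = c := by rw [Function.iterate_succ_apply', hk, h]
      have hcr := t.isTreeMap_parent.eq_root_of_iterate_self k.succ_pos hc
      rw [hcr, Function.iterate_fixed t.parent_root] at hk
      exact hne (hk.symm.trans hcr.symm)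
    · exact ⟨h, hne.symm⟩
  · rintro ⟨h, hne⟩
    exact ⟨⟨hne.symm, Or.inr h⟩, 1, h⟩

variable {t s}

theorem ext_parent (h : t.parent = s.parent) : t = s := by
  have hr : t.root = s.root := s.isTreeMap_parent.eq_root (by rw [← h, t.parent_root])
  have hg : t.graph = s.graph := by
    ext v w
    rw [adj_iff, adj_iff, h]
  cases t
  cases s
  simp only at hr hg
  subst hr hg
  rfl

theorem parent_eq_of_isTreeMap {p : Fin n → Fin n} (hp : IsTreeMap p t.root)
    (h : ∀ v w, t.graph.Adj v w ↔ TreeAdj p v w) : t.parent = p :=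
  eq_of_treeAdj t.isTreeMap_parent hp fun v w => by rw [← h, adj_iff]

/-- The parent map of t transported along e is a tree map for the graph and root of s, and there is
only one. -/
theorem iso_parent (e : Iso t s) (v : Fin n) : e.1 (t.parent v) = s.parent (e.1 v) := by
  have h : ∀ k v, (fun v => e.1 (t.parent (e.1.symm v)))^[k] v =
      e.1 (t.parent^[k] (e.1.symm v)) := by
    intro k v
    induction k with
    | zero => simp
    | succ k ih => rw [Function.iterate_succ_apply', ih, Function.iterate_succ_apply']; simp
  have hs : e.1.symm s.root = t.root :=
    (congrArg e.1.symm e.2).symm.trans (e.1.symm_apply_apply t.root)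
  have := parent_eq_of_isTreeMap (t := s) (p := fun v => e.1 (t.parent (e.1.symm v)))
    ⟨by rw [hs, t.parent_root, e.2], fun v => by
      obtain ⟨k, hk⟩ := t.isTreeMap_parent.exists_iterate (e.1.symm v)
      exact ⟨k, by rw [h, hk, e.2]⟩⟩ (fun v w => by
      rw [← e.1.symm.map_adj_iff, adj_iff]
      simp only [TreeAdj, ne_eq, EmbeddingLike.apply_eq_iff_eq]
      refine and_congr_right fun _ => or_congr ?_ ?_
      · rw [← e.1.injective.eq_iff (a := t.parent _)]; simp
      · rw [← e.1.injective.eq_iff (a := t.parent _)]; simp)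
  rw [this]
  simp

open AutForest

/-- A rooted tree with an automorphism, described by its parent map. -/
def toAutForest (t : RTree n) (σ : t.Aut) : AutForest (Fin n) where
  par := t.parent
  aut := σ.1.toEquiv
  isForest v := by
    obtain ⟨k, hk⟩ := t.isTreeMap_parent.exists_iterate v
    exact ⟨k, by rw [hk, t.parent_root]⟩
  comm v := iso_parent σ v

theorem root_toAutForest (t : RTree n) (σ : t.Aut) (v : Fin n) :
    (toAutForest t σ).root v = t.root := by
  obtain ⟨k, hk⟩ := t.isTreeMap_parent.exists_iterate v
  exact root_eq_of_iterate _ t.parent_root hk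

/-- A rooted tree with an automorphism, described by its parent map. -/
def toAutTree (t : RTree n) (σ : t.Aut) : AutTree n :=
  ⟨toAutForest t σ, ⟨t.root⟩, fun v w => by rw [root_toAutForest, root_toAutForest]⟩

/-- The graph that is determined by a parent map. -/
def treeGraph {V : Type} (p : V → V) : SimpleGraph V where
  Adj := TreeAdj p
  symm := ⟨fun _ _ h => ⟨h.1.symm, h.2.symm⟩⟩
  loopless := ⟨fun _ h => h.1 rfl⟩

/-- Every vertex reaches r, so the graph is connected; every edge joins some v ≠ r to p v, so there
are at most n - 1 edges. -/
theorem isTree_treeGraph {p : Fin n → Fin n} {r : Fin n} (h : IsTreeMap p r) :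
    (treeGraph p).IsTree := by
  set G := treeGraph p
  have hr : ∀ v, G.Reachable v r := h.induction (SimpleGraph.Reachable.refl _) fun v hv ih =>
    SimpleGraph.Reachable.trans (SimpleGraph.Adj.reachable
      (show TreeAdj p v (p v) from ⟨fun e => hv (h.eq_root e.symm), Or.inl rfl⟩)) ih
  have hc : G.Connected := by
    have : Nonempty (Fin n) := ⟨r⟩
    exact ⟨fun v w => (hr v).trans (hr w).symm⟩
  rw [SimpleGraph.isTree_iff_connected_and_card]
  refine ⟨hc, le_antisymm ?_ hc.card_vert_le_card_edgeSet_add_one⟩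
  have h1 : Nat.card {v // v ≠ r} + 1 = Nat.card (Fin n) := by
    have : 0 < n := r.pos
    rw [Nat.card_eq_fintype_card, Nat.card_fin, Fintype.card_subtype_compl]
    simp
    omega
  rw [← h1]
  have hadj : ∀ v : {v // v ≠ r}, G.Adj v (p v) := fun v =>
    ⟨fun e => v.2 (h.eq_root e.symm), Or.inl rfl⟩
  refine Nat.add_le_add_right (Nat.card_le_card_of_surjective
    (fun v : {v // v ≠ r} => (⟨s(v.1, p v.1), hadj v⟩ : G.edgeSet)) ?_) 1
  rintro ⟨e, he⟩
  induction e with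
  | _ v w =>
    obtain ⟨hne, hvw⟩ : TreeAdj p v w := he
    rcases hvw with h' | h'
    · exact ⟨⟨v, fun e => hne (by rw [← h', e, h.map_root])⟩, Subtype.ext (congrArg (fun u => s(v, u)) h')⟩
    · exact ⟨⟨w, fun e => hne (by rw [← h', e, h.map_root])⟩,
        Subtype.ext ((congrArg (fun u => s(w, u)) h').trans Sym2.eq_swap)⟩

theorem bijective_toAutTree :
    Function.Bijective (fun z : (Σ t : RTree n, t.Aut) => toAutTree z.1 z.2) := by
  constructor
  · rintro ⟨t, σ⟩ ⟨s, τ⟩ h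
    have h1 : t = s := ext_parent (congrArg (fun y : AutTree n => y.1.par) h)
    subst h1
    have h2 : σ.1.toEquiv = τ.1.toEquiv := congrArg (fun y : AutTree n => y.1.aut) h
    have h3 : σ = τ := Subtype.ext (RelIso.toEquiv_injective h2)
    rw [h3]
  · rintro ⟨x, ⟨v₀⟩, hx⟩
    have hp : IsTreeMap x.par (x.root v₀) := ⟨x.par_root v₀, fun v => by
      rw [← hx v v₀]; exact x.exists_iterate_eq_root v⟩
    let t : RTree n := ⟨_, x.root v₀, isTree_treeGraph hp⟩
    have ht : t.parent = x.par := parent_eq_of_isTreeMap hp fun v w => Iff.rfl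
    have hadj : ∀ v w, t.graph.Adj (x.aut v) (x.aut w) ↔ t.graph.Adj v w := by
      intro v w
      change TreeAdj _ _ _ ↔ TreeAdj _ _ _
      simp only [TreeAdj, ← x.comm, ne_eq, EmbeddingLike.apply_eq_iff_eq]
    refine ⟨⟨t, ⟨⟨x.aut, fun {v w} => hadj v w⟩, ?_⟩⟩, ?_⟩
    · change x.aut (x.root v₀) = x.root v₀
      rw [← root_aut, hx]
    · refine Subtype.ext (AutForest.ext ht rfl)

theorem dForest_eq (t : RTree n) (σ : t.Aut) (v : Fin n) :
    t.dForest σ v = (toAutTree t σ).1.attached v := by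
  ext w
  simp only [dForest, attached, Set.mem_ofPred_eq, isChild_iff, isAncestor_iff, and_assoc]
  rfl

theorem numForests_eq (t : RTree n) (σ : t.Aut) (m : ℕ) :
    t.numForests σ m = (toAutTree t σ).1.numAttached m := by
  simp only [numForests, numAttached, dForest_eq]
  rfl

end RTree

end PolyaForest

/-! ### From Pólya trees to labelled trees with an automorphism. -/

namespace PolyaForest

namespace RTree

open AutForest

variable {n : ℕ}

/-- The image of a rooted tree under a permutation of the vertices. -/
def image (t : RTree n) (e : Equiv.Perm (Fin n)) : RTree n where
  graph := t.graph.map e.toEmbedding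
  root := e t.root
  isTree := (SimpleGraph.Iso.map e t.graph).isTree_iff.1 t.isTree

/-- A permutation of the labels is an isomorphism from t onto exactly one tree, the image of t. This
is the orbit map of orbit-stabiliser. -/
theorem bijective_iso_toEquiv (t : RTree n) : Function.Bijective
    (fun z : (Σ s : RTree n, Iso t s) => (z.2.1.toEquiv : Equiv.Perm (Fin n))) := by
  constructor
  · rintro ⟨s, f⟩ ⟨s', f'⟩ h
    have hf : ∀ v, f.1 v = f'.1 v := fun v => congrArg (fun e : Equiv.Perm (Fin n) => e v) h
    have hs : s = s' := by
      have hr : s.root = s'.root := by rw [← f.2, ← f'.2, hf]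
      have hg : s.graph = s'.graph := by
        ext v w
        obtain ⟨v, rfl⟩ := f.1.surjective v
        obtain ⟨w, rfl⟩ := f.1.surjective w
        rw [f.1.map_adj_iff, hf, hf, f'.1.map_adj_iff]
      cases s
      cases s'
      simp only at hr hg
      subst hr hg
      rfl
    subst hs
    have : f = f' := Subtype.ext (RelIso.toEquiv_injective h)
    rw [this]
  · intro e
    exact ⟨⟨t.image e, SimpleGraph.Iso.map e t.graph, rfl⟩, rfl⟩

theorem card_iso (t s : RTree n) (h : Nonempty (Iso t s)) :
    Fintype.card (Iso t s) = Fintype.card t.Aut := by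
  obtain ⟨e⟩ := h
  have hs : e.1.symm s.root = t.root :=
    (congrArg e.1.symm e.2).symm.trans (e.1.symm_apply_apply t.root)
  refine Fintype.card_congr
    { toFun := fun f => ⟨f.1.trans e.1.symm, (congrArg e.1.symm f.2).trans hs⟩
      invFun := fun f => ⟨f.1.trans e.1, (congrArg e.1 f.2).trans e.2⟩
      left_inv := fun f => Subtype.ext (RelIso.ext fun v => e.1.apply_symm_apply _)
      right_inv := fun f => Subtype.ext (RelIso.ext fun v => e.1.symm_apply_apply _) }

instance : Fintype (RTree n) := Fintype.ofFinite _

open Classical in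
-- The n! permutations are distributed over the trees isomorphic to the representative, and each
-- receives as many as there are automorphisms.
theorem card_class_mul_card_aut (T : PolyaTree n) :
    (Finset.univ.filter fun t : RTree n => (⟦t⟧ : PolyaTree n) = T).card *
      Fintype.card T.rep.Aut = n.factorial := by
  have h1 : Nat.card (Σ s : RTree n, Iso T.rep s) = n.factorial := by
    rw [Nat.card_congr (Equiv.ofBijective _ (bijective_iso_toEquiv T.rep)),
      Nat.card_eq_fintype_card, Fintype.card_perm, Fintype.card_fin]
  have hT : (⟦T.rep⟧ : PolyaTree n) = T := Quotient.out_eq T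
  have h2 : ∀ s : RTree n, Nat.card (Iso T.rep s) =
      if (⟦s⟧ : PolyaTree n) = T then Fintype.card T.rep.Aut else 0 := by
    intro s
    split_ifs with h
    · rw [Nat.card_eq_fintype_card, card_iso]
      rw [← hT] at h
      exact Quotient.exact h.symm
    · rw [Nat.card_eq_zero]
      left
      by_contra hne
      rw [not_isEmpty_iff] at hne
      exact h (by rw [← hT]; exact (Quotient.sound hne).symm)
  rw [← h1, Nat.card_sigma, Finset.sum_congr rfl fun s _ => h2 s, ← Finset.sum_filter,
    Finset.sum_const, smul_eq_mul]

theorem sum_inv_card_aut_smul {M : Type*} [AddCommGroup M] [Module ℝ M] (F : RTree n → M)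
    (hF : ∀ t s : RTree n, Nonempty (Iso t s) → F t = F s) :
    ∑ T : PolyaTree n, (Fintype.card T.rep.Aut : ℝ)⁻¹ • F T.rep =
      (n.factorial : ℝ)⁻¹ • ∑ t, F t := by
  classical
  rw [← Finset.sum_fiberwise Finset.univ (fun t : RTree n => (⟦t⟧ : PolyaTree n)) F,
    Finset.smul_sum]
  refine Finset.sum_congr rfl fun T _ => ?_
  have hT : (⟦T.rep⟧ : PolyaTree n) = T := Quotient.out_eq T
  have h1 : ∀ t ∈ Finset.univ.filter (fun t : RTree n => (⟦t⟧ : PolyaTree n) = T),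
      F t = F T.rep := by
    intro t ht
    have h := (Finset.mem_filter.1 ht).2
    rw [← hT] at h
    exact hF _ _ (Quotient.exact h)
  rw [Finset.sum_congr rfl h1, Finset.sum_const, ← Nat.cast_smul_eq_nsmul ℝ, smul_smul]
  have h2 : ((Finset.univ.filter fun t : RTree n => (⟦t⟧ : PolyaTree n) = T).card : ℝ) *
      Fintype.card T.rep.Aut = n.factorial := by exact_mod_cast card_class_mul_card_aut T
  have h3 : (n.factorial : ℝ) ≠ 0 := by exact_mod_cast n.factorial_ne_zero
  congr 1
  rw [← h2] at h3 ⊢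
  have h4 := left_ne_zero_of_mul h3
  have h5 := right_ne_zero_of_mul h3
  field_simp

theorem toAutForest_conj {t s : RTree n} (e : Iso t s) (σ : t.Aut) (τ : s.Aut)
    (h : ∀ v, τ.1 (e.1 v) = e.1 (σ.1 v)) :
    toAutForest s τ = (toAutForest t σ).relabel e.1.toEquiv := by
  refine AutForest.ext (funext fun v => ?_) (Equiv.ext fun v => ?_)
  · obtain ⟨v, rfl⟩ := e.1.surjective v
    exact (iso_parent e v).symm.trans ((toAutForest t σ).relabel_par e.1.toEquiv v).symm
  · obtain ⟨v, rfl⟩ := e.1.surjective v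
    exact (h v).trans ((toAutForest t σ).relabel_aut e.1.toEquiv v).symm

theorem sum_aut_eq_of_iso {M : Type*} [AddCommMonoid M] (G : AutForest (Fin n) → M)
    (hG : ∀ (e : Equiv.Perm (Fin n)) x, G (x.relabel e) = G x) {t s : RTree n} (e : Iso t s) :
    ∑ σ : t.Aut, G (toAutForest t σ) = ∑ τ : s.Aut, G (toAutForest s τ) := by
  have hs : e.1.symm s.root = t.root :=
    (congrArg e.1.symm e.2).symm.trans (e.1.symm_apply_apply t.root)
  let c : t.Aut ≃ s.Aut :=
    { toFun := fun σ => ⟨(e.1.symm.trans σ.1).trans e.1,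
        (congrArg (fun v => e.1 (σ.1 v)) hs).trans ((congrArg e.1 σ.2).trans e.2)⟩
      invFun := fun τ => ⟨(e.1.trans τ.1).trans e.1.symm,
        (congrArg (fun v => e.1.symm (τ.1 v)) e.2).trans ((congrArg e.1.symm τ.2).trans hs)⟩
      left_inv := fun σ => Subtype.ext (RelIso.ext fun v => by simp)
      right_inv := fun τ => Subtype.ext (RelIso.ext fun v => by simp) }
  refine Fintype.sum_equiv c _ _ fun σ => ?_
  rw [toAutForest_conj e σ (c σ) (fun v => by simp [c]), hG]

open Classical in
/-- Sums over Pólya trees, where automorphisms are weighted uniformly, as sums over labelled trees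
with an automorphism. -/
theorem sum_polyaTree {M : Type*} [AddCommGroup M] [Module ℝ M] (G : AutForest (Fin n) → M)
    (hG : ∀ (e : Equiv.Perm (Fin n)) x, G (x.relabel e) = G x) :
    ∑ T : PolyaTree n, (Fintype.card T.rep.Aut : ℝ)⁻¹ • ∑ σ : T.rep.Aut, G (toAutForest T.rep σ) =
      (n.factorial : ℝ)⁻¹ • ∑ x : AutForest (Fin n), if x.IsTree then G x else 0 := by
  rw [sum_inv_card_aut_smul (fun t => ∑ σ : t.Aut, G (toAutForest t σ))
    (fun t s ⟨e⟩ => sum_aut_eq_of_iso G hG e)]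
  congr 1
  have h := sum_dite_zero (fun x : AutForest (Fin n) => x.IsTree)
    (fun x : AutTree n => G x.1)
  simp only [dite_eq_ite] at h
  rw [h, ← bijective_toAutTree.sum_comp (fun x : AutTree n => G x.1), Fintype.sum_sigma]
  rfl

end RTree

open AutForest RTree PowerSeries

/-- `T^{[m]}` as an exponential generating function of labelled trees with an automorphism. -/
theorem markedT_eq_egf (m : ℕ) :
    markedT m = egf (conn (fixedWeight (Polynomial.X : Polynomial ℝ) m)) := by
  classical
  ext1 n
  rw [markedT, egf, coeff_mk, coeff_mk, total]
  simp only [conn_fixedWeight]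
  rw [← sum_polyaTree _ fun e x => by rw [numAttached_relabel]]
  refine Finset.sum_congr rfl fun T _ => ?_
  rw [Polynomial.smul_eq_C_mul]
  refine congrArg _ (Finset.sum_congr rfl fun σ _ => ?_)
  rw [numForests_eq]
  rfl

/-- Burnside's lemma: with weight 1 for each automorphism, every Pólya tree contributes |Aut|/|Aut|
= 1. -/
theorem numTrees_eq (n : ℕ) :
    (numTrees n : ℝ) = (n.factorial : ℝ)⁻¹ * Nat.card (AutTree n) := by
  classical
  have h := sum_polyaTree (n := n) (M := ℝ) (fun _ => 1) (fun _ _ => rfl)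
  have h1 : ∀ T : PolyaTree n, (Fintype.card T.rep.Aut : ℝ)⁻¹ • ∑ _σ : T.rep.Aut, (1 : ℝ) = 1 := by
    intro T
    have : (Fintype.card T.rep.Aut : ℝ) ≠ 0 := by
      have := Fintype.card_pos_iff.2 (⟨⟨RelIso.refl _, rfl⟩⟩ : Nonempty T.rep.Aut)
      exact_mod_cast this.ne'
    simp [this]
  rw [Finset.sum_congr rfl fun T _ => h1 T, Finset.sum_boole, smul_eq_mul] at h
  rw [numTrees, Nat.card_eq_fintype_card, Fintype.card_subtype, ← h]
  simp

end PolyaForest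

/-! ### Identification of D and T, and the weights of the attached forests. -/

namespace PolyaForest

open AutForest RTree PowerSeries

theorem coeff_seriesS (n : ℕ) : coeff n seriesS =
    ∑ i ∈ Finset.Icc 2 n, (i : ℝ)⁻¹ * if i ∣ n then (numTrees (n / i) : ℝ) else 0 := by
  rw [seriesS, coeff_mk, map_sum]
  refine Finset.sum_congr rfl fun i hi => ?_
  have hi' : i ≠ 0 := by have := (Finset.mem_Icc.1 hi).1; omega
  rw [coeff_smul, smul_eq_mul, coeff_subst_X_pow hi']
  simp [seriesT]

theorem constantCoeff_seriesS : constantCoeff seriesS = 0 := by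
  rw [← coeff_zero_eq_constantCoeff_apply, coeff_seriesS]; simp

/-- A cycle of i trees of size k has n = ik vertices. The pointed count carries a factor k, and
division by n leaves the 1/i of the series. -/
theorem egf_conn_movedWeight : egf (conn (movedWeight ℝ)) = seriesS := by
  ext n
  rw [coeff_seriesS, egf, coeff_mk, smul_eq_mul]
  rcases Nat.eq_zero_or_pos n with rfl | hn
  · rw [total, Finset.sum_eq_zero, mul_zero]
    · simp
    · exact fun x _ => if_neg fun h => h.1.elim fun v => v.elim0
  · have h := natCast_mul_total_conn_movedWeight n
    have hn' : (n : ℝ) ≠ 0 := by exact_mod_cast hn.ne'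
    have hf : (n.factorial : ℝ) ≠ 0 := by exact_mod_cast n.factorial_ne_zero
    have h1 : total (conn (movedWeight ℝ)) n = (n : ℝ)⁻¹ * ((n : ℝ) *
        total (conn (movedWeight ℝ)) n) := by field_simp
    rw [h1, h, Finset.mul_sum, Finset.mul_sum]
    refine Finset.sum_congr rfl fun i hi => ?_
    split_ifs with hd
    · obtain ⟨k, rfl⟩ := hd
      have hi' : 0 < i := by have := (Finset.mem_Icc.1 hi).1; omega
      rw [Nat.mul_div_cancel_left _ hi', numTrees_eq]
      rw [Nat.cast_mul] at hn' ⊢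
      have h2 := left_ne_zero_of_mul hn'
      have h3 := right_ne_zero_of_mul hn'
      field_simp
    · simp

theorem egf_movedWeight : egf (movedWeight ℝ) = seriesD := by
  rw [egf_eq_exp_subst invariant_movedWeight multiplicative_movedWeight total_movedWeight_zero,
    egf_conn_movedWeight, seriesD]

/-- This combinatorial meaning makes the coefficients of D nonnegative, on which all the analysis
rests. -/
theorem d_eq (m : ℕ) : d m = (m.factorial : ℝ)⁻¹ * total (movedWeight ℝ) m := by
  rw [d, ← egf_movedWeight, egf, coeff_mk, smul_eq_mul]

theorem d_nonneg (m : ℕ) : 0 ≤ d m := by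
  rw [d_eq]
  refine mul_nonneg (by positivity) (Finset.sum_nonneg fun x _ => ?_)
  rw [movedWeight]
  split_ifs <;> norm_num

theorem d_zero : d 0 = 1 := by
  rw [d_eq, total_movedWeight_zero]; simp

theorem total_movedWeight_polynomial (n : ℕ) :
    total (movedWeight (Polynomial ℝ)) n = Polynomial.C (total (movedWeight ℝ) n) := by
  simp only [total, map_sum, movedWeight]
  refine Finset.sum_congr rfl fun x _ => ?_
  split_ifs <;> simp

/-- The functional equation `T = z D exp T`. -/
theorem seriesT_eq : seriesT = X * seriesD * (exp ℝ).subst seriesT := by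
  classical
  -- At u = 1 nothing is marked, and the size 0 is an arbitrary choice.
  have h1 : egf (conn (fixedWeight (1 : ℝ) 0)) = seriesT := by
    ext n
    rw [egf, seriesT, coeff_mk, coeff_mk, numTrees_eq, smul_eq_mul, total]
    simp only [conn_fixedWeight, one_pow]
    rw [Finset.sum_boole, Nat.card_eq_fintype_card, Fintype.card_subtype]
  have h := egf_conn_fixedWeight (1 : ℝ) 0
  rw [h1] at h
  convert h using 3
  ext n
  rw [egf_movedWeight]
  simp

/-- The argument of `C` in the formula for `T^{[m]}`. -/
def markedArg (m : ℕ) : (Polynomial ℝ)⟦X⟧ :=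
  PowerSeries.C (Polynomial.X : Polynomial ℝ) * PowerSeries.X *
      PowerSeries.map Polynomial.C (PowerSeries.monomial m (d m)) +
    PowerSeries.X * PowerSeries.map Polynomial.C (seriesD - PowerSeries.monomial m (d m))

theorem constantCoeff_markedArg (m : ℕ) : constantCoeff (markedArg m) = 0 := by
  simp [markedArg]

theorem markedT_eq (m : ℕ) : markedT m = seriesC.subst (markedArg m) := by
  classical
  have h := egf_conn_fixedWeight (Polynomial.X : Polynomial ℝ) m
  rw [← markedT_eq_egf] at h
  refine eq_seriesC_subst ?_ ?_
  · rw [h]; simp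
  · convert h using 2
    rw [markedArg, mul_comm (PowerSeries.C _), mul_assoc, ← mul_add]
    congr 1
    ext1 n
    rw [coeff_mk, egf, coeff_mk, total_movedWeight_polynomial, map_add, coeff_C_mul, coeff_map,
      coeff_map, map_sub, coeff_monomial]
    have hd : coeff n seriesD = d n := rfl
    rw [hd, Polynomial.smul_eq_C_mul, ← Polynomial.C_mul, ← d_eq]
    split_ifs with hnm
    · rw [hnm, sub_self, map_zero, add_zero, mul_comm]
    · rw [map_zero, mul_zero, zero_add, sub_zero, mul_one]

section Derivative

/-- The coefficientwise derivative at `u = 1`. -/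
def derivAtOne (F : (Polynomial ℝ)⟦X⟧) : ℝ⟦X⟧ :=
  PowerSeries.mk fun n => (Polynomial.derivative (coeff n F)).eval 1

/-- The coefficientwise evaluation at `u = 1`. -/
def evalAtOne : (Polynomial ℝ)⟦X⟧ →+* ℝ⟦X⟧ := PowerSeries.map (Polynomial.evalRingHom 1)

theorem derivAtOne_mul (F G : (Polynomial ℝ)⟦X⟧) :
    derivAtOne (F * G) = derivAtOne F * evalAtOne G + evalAtOne F * derivAtOne G := by
  ext n
  simp only [derivAtOne, evalAtOne, coeff_mk, coeff_mul, map_sum, Polynomial.derivative_mul,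
    Polynomial.eval_finsetSum, Polynomial.eval_add, Polynomial.eval_mul, map_add, coeff_map,
    Finset.sum_add_distrib, Polynomial.coe_evalRingHom]

theorem derivAtOne_pow (F : (Polynomial ℝ)⟦X⟧) (k : ℕ) :
    derivAtOne (F ^ (k + 1)) = ((k + 1 : ℕ) : ℝ⟦X⟧) * evalAtOne F ^ k * derivAtOne F := by
  induction k with
  | zero => simp
  | succ k ih =>
    rw [pow_succ, derivAtOne_mul, ih, map_pow]
    push_cast
    ring

theorem evalAtOne_markedArg (m : ℕ) : evalAtOne (markedArg m) = X * seriesD := by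
  have h : ∀ F : ℝ⟦X⟧, evalAtOne (PowerSeries.map Polynomial.C F) = F := fun F => by
    ext n; simp [evalAtOne]
  have hX : evalAtOne X = X := by simp [evalAtOne]
  have hC : evalAtOne (PowerSeries.C Polynomial.X) = 1 := by simp [evalAtOne]
  rw [markedArg, map_add, map_mul, map_mul, map_mul, h, h, hX, hC]
  ring

theorem derivAtOne_markedArg (m : ℕ) : derivAtOne (markedArg m) = PowerSeries.C (d m) * X ^ (m + 1) := by
  ext n
  rw [markedArg, derivAtOne, coeff_mk, mul_comm (PowerSeries.C _), mul_assoc, ← mul_add]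
  cases n with
  | zero => simp
  | succ n =>
    rw [coeff_succ_X_mul, map_add, coeff_C_mul, coeff_map, coeff_map, coeff_monomial]
    by_cases h : n = m <;> simp [h, coeff_X_pow]

/-- The coefficients of `C'(z D(z))`. -/
def coeffDerivC (n : ℕ) : ℝ := ∑ k ∈ Finset.range (n + 1),
  ((k + 1 : ℕ) : ℝ) ^ (k + 1) / ((k + 1).factorial : ℝ) * coeff n ((X * seriesD) ^ k)

theorem forestWeight_eq_coeff (n m : ℕ) : forestWeight n m = coeff n (derivAtOne (markedT m)) := by
  rw [derivAtOne, coeff_mk, markedT, coeff_mk]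
  simp only [map_sum, Polynomial.eval_finsetSum, Polynomial.derivative_C_mul, Polynomial.eval_mul,
    Polynomial.eval_C, Polynomial.derivative_X_pow, Polynomial.eval_pow, Polynomial.eval_X, one_pow,
    mul_one]
  rfl

/-- By the chain rule, the u-derivative of C(`markedArg m`) at 1 is d_m z^(m+1) C'(zD(z)). The
natural subtractions are guarded by m < n. -/
theorem forestWeight_eq (n m : ℕ) :
    forestWeight n m = if m < n then d m * coeffDerivC (n - 1 - m) else 0 := by
  rw [forestWeight_eq_coeff, markedT_eq, derivAtOne, coeff_mk,
    coeff_subst_eq_sum (constantCoeff_markedArg m) _ (Nat.lt_succ_self n), map_sum,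
    Polynomial.eval_finsetSum, Finset.sum_range_succ']
  have h0 : (coeff 0 seriesC) = 0 := by simp [seriesC]
  rw [h0, zero_smul, map_zero, Polynomial.eval_zero, add_zero]
  have h1 : ∀ k ∈ Finset.range n, (Polynomial.derivative (coeff (k + 1) seriesC •
      coeff n (markedArg m ^ (k + 1)))).eval 1 =
      if m < n then d m * (((k + 1 : ℕ) : ℝ) ^ (k + 1) / ((k + 1).factorial : ℝ) *
        coeff (n - 1 - m) ((X * seriesD) ^ k)) else 0 := by
    intro k _
    have h2 : (Polynomial.derivative (coeff n (markedArg m ^ (k + 1)))).eval 1 =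
        coeff n (derivAtOne (markedArg m ^ (k + 1))) := by rw [derivAtOne, coeff_mk]
    rw [Polynomial.derivative_smul, Polynomial.eval_smul, h2, derivAtOne_pow, evalAtOne_markedArg,
      derivAtOne_markedArg, show ((k + 1 : ℕ) : ℝ⟦X⟧) * (X * seriesD) ^ k *
        (PowerSeries.C (d m) * X ^ (m + 1)) = PowerSeries.C (((k + 1 : ℕ) : ℝ) * d m) *
          ((X * seriesD) ^ k * X ^ (m + 1)) by rw [map_mul, map_natCast]; ring,
      coeff_C_mul, coeff_mul_X_pow', seriesC, coeff_mk, if_neg k.succ_ne_zero,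
      show n - (m + 1) = n - 1 - m by omega]
    simp only [Nat.succ_le_iff, smul_eq_mul, Nat.add_sub_cancel]
    split_ifs
    · rw [pow_succ]; ring
    · simp
  rw [Finset.sum_congr rfl h1]
  split_ifs with hm
  · rw [← Finset.mul_sum, coeffDerivC]
    congr 1
    symm
    -- The sum up to n may be cut at n - 1 - m because (zD)^k starts in degree k.
    refine Finset.sum_subset (fun k hk => ?_) fun k _ hk => ?_
    · simp only [Finset.mem_range] at hk ⊢; omega
    · rw [coeff_pow_eq_zero (by simp) (by simpa [Nat.lt_succ_iff] using hk), mul_zero]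
  · simp

/-- No vertex is its own proper descendant, so v is missing from its forest. Hence `Finset.range n`
exhausts the possible sizes. -/
theorem ncard_dForest_lt {n : ℕ} (t : RTree n) (σ : t.Aut) (v : Fin n) :
    (t.dForest σ v).ncard < n := by
  have hv : v ∉ t.dForest σ v := by
    rintro ⟨c, hc, -, ha⟩
    obtain ⟨hpar, hne⟩ := (t.isChild_iff v c).1 hc
    obtain ⟨k, hk⟩ := (t.isAncestor_iff c v).1 ha
    have hv : t.parent^[k + 1] v = v := by rw [Function.iterate_succ_apply', hk, hpar]
    have hr := t.isTreeMap_parent.eq_root_of_iterate_self k.succ_pos hv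
    rw [hr, Function.iterate_fixed t.parent_root] at hk
    exact hne (hk.symm.trans hr.symm)
  calc (t.dForest σ v).ncard < (Set.univ : Set (Fin n)).ncard :=
        Set.ncard_lt_ncard ⟨Set.subset_univ _, fun h => hv (h (Set.mem_univ v))⟩
    _ = n := by simp

theorem sum_numForests {n : ℕ} (t : RTree n) (σ : t.Aut) :
    ∑ m ∈ Finset.range n, t.numForests σ m = (t.cNodes σ).ncard := by
  classical
  rw [Set.ncard_eq_toFinset_card' (t.cNodes σ),
    Finset.card_eq_sum_card_fiberwise (f := fun v => (t.dForest σ v).ncard)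
      (t := Finset.range n) fun v _ => by simpa using ncard_dForest_lt t σ v]
  refine Finset.sum_congr rfl fun m _ => ?_
  rw [RTree.numForests, Set.ncard_eq_toFinset_card']
  congr 1
  ext v
  simp

theorem cNodeWeight_eq (n : ℕ) :
    cNodeWeight n = ∑ m ∈ Finset.range n, d m * coeffDerivC (n - 1 - m) := by
  have h1 : ∀ m ∈ Finset.range n, d m * coeffDerivC (n - 1 - m) = forestWeight n m := by
    intro m hm
    rw [forestWeight_eq, if_pos (Finset.mem_range.1 hm)]
  rw [Finset.sum_congr rfl h1]
  unfold forestWeight cNodeWeight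
  rw [Finset.sum_comm]
  refine Finset.sum_congr rfl fun T _ => ?_
  rw [← Finset.mul_sum, Finset.sum_comm]
  congr 1
  refine Finset.sum_congr rfl fun σ _ => ?_
  rw [← sum_numForests, Nat.cast_sum]

end Derivative

end PolyaForest

/-! ### Evaluation of series with nonnegative coefficients in [0, ∞]. -/

namespace PolyaForest

open PowerSeries
open scoped ENNReal

/-- The value of a power series with nonnegative coefficients at a nonnegative point. -/
def evalE (f : ℝ⟦X⟧) (x : ℝ≥0∞) : ℝ≥0∞ := ∑' n, ENNReal.ofReal (coeff n f) * x ^ n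

/-- All coefficients are nonnegative. -/
def NonnegCoeff (f : ℝ⟦X⟧) : Prop := ∀ n, 0 ≤ coeff n f

theorem NonnegCoeff.mul {f g : ℝ⟦X⟧} (hf : NonnegCoeff f) (hg : NonnegCoeff g) :
    NonnegCoeff (f * g) := fun n => by
  rw [coeff_mul]
  exact Finset.sum_nonneg fun i _ => mul_nonneg (hf _) (hg _)

theorem nonnegCoeff_one : NonnegCoeff 1 := fun n => by
  rw [coeff_one]; split_ifs <;> norm_num

theorem nonnegCoeff_X : NonnegCoeff X := fun n => by
  rw [coeff_X]; split_ifs <;> norm_num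

theorem NonnegCoeff.pow {f : ℝ⟦X⟧} (hf : NonnegCoeff f) (k : ℕ) : NonnegCoeff (f ^ k) := by
  induction k with
  | zero => rw [pow_zero]; exact nonnegCoeff_one
  | succ k ih => rw [pow_succ]; exact ih.mul hf

theorem NonnegCoeff.subst {F f : ℝ⟦X⟧} (hF : NonnegCoeff F) (hf : NonnegCoeff f)
    (h0 : constantCoeff f = 0) : NonnegCoeff (F.subst f) := fun n => by
  rw [coeff_subst_eq_sum h0 F n.lt_succ_self]
  exact Finset.sum_nonneg fun k _ => mul_nonneg (hF k) (hf.pow k n)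

theorem nonnegCoeff_exp : NonnegCoeff (exp ℝ) := fun n => by
  rw [coeff_exp]; simp

theorem nonnegCoeff_seriesT : NonnegCoeff seriesT := fun n => by
  rw [seriesT, coeff_mk]; positivity

theorem nonnegCoeff_seriesD : NonnegCoeff seriesD := d_nonneg

theorem nonnegCoeff_seriesC : NonnegCoeff seriesC := fun n => by
  rw [seriesC, coeff_mk]; split_ifs <;> positivity

theorem nonnegCoeff_seriesS : NonnegCoeff seriesS := fun n => by
  rw [coeff_seriesS]
  exact Finset.sum_nonneg fun i _ => mul_nonneg (by positivity) (by split_ifs <;> positivity)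

theorem constantCoeff_seriesT : constantCoeff seriesT = 0 := by
  rw [seriesT_eq]; simp

theorem numTrees_zero : numTrees 0 = 0 := by
  have h := constantCoeff_seriesT
  rw [← coeff_zero_eq_constantCoeff_apply, seriesT, coeff_mk] at h
  exact_mod_cast h

section EvalE

variable {f g : ℝ⟦X⟧} (x : ℝ≥0∞)

theorem evalE_mul (hf : NonnegCoeff f) (hg : NonnegCoeff g) :
    evalE (f * g) x = evalE f x * evalE g x := by
  unfold evalE
  rw [← ENNReal.tsum_mul_right]
  simp_rw [← ENNReal.tsum_mul_left]
  rw [← ENNReal.tsum_prod,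
    ← (Finset.HasAntidiagonal.sigmaAntidiagonalEquivProd (A := ℕ)).tsum_eq (fun p : ℕ × ℕ => ENNReal.ofReal (coeff p.1 f) *
      x ^ p.1 * (ENNReal.ofReal (coeff p.2 g) * x ^ p.2)), ENNReal.tsum_sigma']
  refine tsum_congr fun n => ?_
  rw [tsum_fintype, coeff_mul, ENNReal.ofReal_sum_of_nonneg fun i _ => mul_nonneg (hf _) (hg _),
    Finset.sum_mul, ← Finset.sum_coe_sort]
  refine Finset.sum_congr rfl fun p _ => ?_
  have hp := Finset.HasAntidiagonal.mem_antidiagonal.1 p.2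
  have hx : x ^ n = x ^ p.1.1 * x ^ p.1.2 := by rw [← pow_add, hp]
  rw [ENNReal.ofReal_mul (hf _), hx]
  simp only [Finset.HasAntidiagonal.sigmaAntidiagonalEquivProd_apply]
  ring

theorem evalE_one : evalE 1 x = 1 := by
  rw [evalE, tsum_eq_single 0 fun n hn => by simp [coeff_one, hn]]
  simp

theorem evalE_X : evalE X x = x := by
  rw [evalE, tsum_eq_single 1 fun n hn => by simp [coeff_X, hn]]
  simp

theorem evalE_pow (hf : NonnegCoeff f) (k : ℕ) : evalE (f ^ k) x = evalE f x ^ k := by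
  induction k with
  | zero => rw [pow_zero, pow_zero, evalE_one]
  | succ k ih => rw [pow_succ, pow_succ, evalE_mul x (hf.pow k) hf, ih]

/-- Sums in [0, ∞] may be interchanged freely, so no convergence is assumed; it is read off
afterwards as finiteness. -/
theorem evalE_subst {F : ℝ⟦X⟧} (hF : NonnegCoeff F) (hf : NonnegCoeff f)
    (h0 : constantCoeff f = 0) : evalE (F.subst f) x = evalE F (evalE f x) := by
  have h1 : ∀ n, ENNReal.ofReal (coeff n (F.subst f)) * x ^ n =
      ∑' k, ENNReal.ofReal (coeff k F) * (ENNReal.ofReal (coeff n (f ^ k)) * x ^ n) := by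
    intro n
    rw [coeff_subst_eq_sum h0 F n.lt_succ_self]
    simp only [smul_eq_mul]
    rw [ENNReal.ofReal_sum_of_nonneg
      fun k _ => mul_nonneg (hF k) (hf.pow k n), Finset.sum_mul,
      tsum_eq_sum (s := Finset.range (n + 1))]
    · refine Finset.sum_congr rfl fun k _ => ?_
      rw [ENNReal.ofReal_mul (hF k), mul_assoc]
    · intro k hk
      rw [coeff_pow_eq_zero h0 (by simpa [Nat.lt_succ_iff] using hk)]
      simp
  rw [evalE, tsum_congr h1, ENNReal.tsum_comm]
  refine tsum_congr fun k => ?_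
  rw [ENNReal.tsum_mul_left, ← evalE_pow x hf]
  rfl

theorem evalE_ofReal (hf : NonnegCoeff f) {r : ℝ} (hr : 0 ≤ r)
    (hs : Summable fun n => coeff n f * r ^ n) :
    evalE f (ENNReal.ofReal r) = ENNReal.ofReal (∑' n, coeff n f * r ^ n) := by
  rw [evalE, ENNReal.ofReal_tsum_of_nonneg (fun n => mul_nonneg (hf n) (pow_nonneg hr n)) hs]
  refine tsum_congr fun n => ?_
  rw [ENNReal.ofReal_mul (hf n), ENNReal.ofReal_pow hr]

theorem summable_iff_evalE (hf : NonnegCoeff f) {r : ℝ} (hr : 0 ≤ r) :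
    (Summable fun n => coeff n f * r ^ n) ↔ evalE f (ENNReal.ofReal r) ≠ ∞ := by
  constructor
  · intro h
    rw [evalE_ofReal hf hr h]
    exact ENNReal.ofReal_ne_top
  · intro h
    have := ENNReal.summable_toReal h
    refine this.congr fun n => ?_
    rw [ENNReal.toReal_mul, ENNReal.toReal_pow, ENNReal.toReal_ofReal (hf n),
      ENNReal.toReal_ofReal hr]

theorem hasSum_exp (s : ℝ) : HasSum (fun n => coeff n (exp ℝ) * s ^ n) (Real.exp s) := by
  have h := NormedSpace.expSeries_div_hasSum_exp (𝔸 := ℝ) s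
  rw [← Real.exp_eq_exp_ℝ] at h
  refine h.congr_fun fun n => ?_
  rw [coeff_exp]
  simp [div_eq_inv_mul]

theorem evalE_exp {s : ℝ} (hs : 0 ≤ s) :
    evalE (exp ℝ) (ENNReal.ofReal s) = ENNReal.ofReal (Real.exp s) := by
  rw [evalE_ofReal nonnegCoeff_exp hs (hasSum_exp s).summable, (hasSum_exp s).tsum_eq]

end EvalE

end PolyaForest

/-! ### Bounds for partial sums of T near 0. -/

namespace PolyaForest

open PowerSeries
open scoped ENNReal

section PartialSums

/-- The partial sum of a power series up to the power `N`. -/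
def partialEval (f : ℝ⟦X⟧) (N : ℕ) (x : ℝ) : ℝ := ∑ n ∈ Finset.range (N + 1), coeff n f * x ^ n

variable {f g : ℝ⟦X⟧} {N : ℕ} {x : ℝ}

theorem partialEval_nonneg (hf : NonnegCoeff f) (hx : 0 ≤ x) : 0 ≤ partialEval f N x :=
  Finset.sum_nonneg fun n _ => mul_nonneg (hf n) (pow_nonneg hx n)

/-- The left side runs over the pairs of exponents with sum at most N, a part of the full square on
the right. -/
theorem partialEval_mul_le (hf : NonnegCoeff f) (hg : NonnegCoeff g) (hx : 0 ≤ x) :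
    partialEval (f * g) N x ≤ partialEval f N x * partialEval g N x := by
  unfold partialEval
  rw [Finset.sum_mul_sum, ← Finset.sum_product']
  have h : ∀ n ∈ Finset.range (N + 1), coeff n (f * g) * x ^ n =
      ∑ p ∈ Finset.HasAntidiagonal.antidiagonal n, coeff p.1 f * x ^ p.1 * (coeff p.2 g * x ^ p.2) := by
    intro n _
    rw [coeff_mul, Finset.sum_mul]
    refine Finset.sum_congr rfl fun p hp => ?_
    rw [← Finset.HasAntidiagonal.mem_antidiagonal.1 hp, pow_add]
    ring
  rw [Finset.sum_congr rfl h, Finset.sum_sigma']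
  refine le_of_eq_of_le (Finset.sum_nbij (i := fun z => z.2)
    (t := (Finset.range (N + 1) ×ˢ Finset.range (N + 1)).filter fun p => p.1 + p.2 ≤ N)
    (g := fun p => coeff p.1 f * x ^ p.1 * (coeff p.2 g * x ^ p.2)) ?_ ?_ ?_ ?_) ?_
  · rintro ⟨n, p⟩ h
    simp only [Finset.mem_sigma, Finset.mem_range, Finset.HasAntidiagonal.mem_antidiagonal, Finset.mem_filter,
      Finset.mem_product] at h ⊢
    omega
  · rintro ⟨n, p⟩ h ⟨n', p'⟩ h' e
    simp only [Finset.coe_sigma, Set.mem_sigma_iff, Finset.mem_coe, Finset.HasAntidiagonal.mem_antidiagonal] at h h'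
    simp only at e
    subst e
    obtain rfl : n = n' := h.2.symm.trans h'.2
    rfl
  · rintro p h
    simp only [Finset.mem_coe, Finset.mem_filter] at h
    exact ⟨⟨p.1 + p.2, p⟩, by simpa [Nat.lt_succ_iff] using h.2, rfl⟩
  · intro z _; rfl
  · exact Finset.sum_le_sum_of_subset_of_nonneg (Finset.filter_subset _ _) fun p _ _ =>
      mul_nonneg (mul_nonneg (hf _) (pow_nonneg hx _)) (mul_nonneg (hg _) (pow_nonneg hx _))

theorem partialEval_pow_le (hf : NonnegCoeff f) (hx : 0 ≤ x) (k : ℕ) :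
    partialEval (f ^ k) N x ≤ partialEval f N x ^ k := by
  induction k with
  | zero =>
    rw [pow_zero, pow_zero, partialEval, Finset.sum_eq_single 0]
    · simp
    · intro n _ hn; simp [coeff_one, hn]
    · simp
  | succ k ih =>
    rw [pow_succ, pow_succ]
    exact (partialEval_mul_le (hf.pow k) hf hx).trans
      (mul_le_mul_of_nonneg_right ih (partialEval_nonneg hf hx))

theorem partialEval_subst_le {F : ℝ⟦X⟧} (hF : NonnegCoeff F) (hf : NonnegCoeff f)
    (h0 : constantCoeff f = 0) (hx : 0 ≤ x) :
    partialEval (F.subst f) N x ≤ partialEval F N (partialEval f N x) := by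
  have h : ∀ n ∈ Finset.range (N + 1), coeff n (F.subst f) * x ^ n =
      ∑ k ∈ Finset.range (N + 1), coeff k F * (coeff n (f ^ k) * x ^ n) := by
    intro n hn
    rw [coeff_subst_eq_sum h0 F (Finset.mem_range.1 hn), Finset.sum_mul]
    refine Finset.sum_congr rfl fun k _ => ?_
    rw [smul_eq_mul, mul_assoc]
  rw [partialEval, Finset.sum_congr rfl h, Finset.sum_comm, partialEval]
  refine Finset.sum_le_sum fun k _ => ?_
  rw [← Finset.mul_sum]
  exact mul_le_mul_of_nonneg_left (partialEval_pow_le hf hx k) (hF k)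

theorem partialEval_exp_le (hx : 0 ≤ x) : partialEval (exp ℝ) N x ≤ Real.exp x :=
  sum_le_hasSum _ (fun n _ => mul_nonneg (nonnegCoeff_exp n) (pow_nonneg hx n)) (hasSum_exp x)

theorem partialEval_exp_subst_le (hf : NonnegCoeff f) (h0 : constantCoeff f = 0) (hx : 0 ≤ x) :
    partialEval ((exp ℝ).subst f) N x ≤ Real.exp (partialEval f N x) :=
  (partialEval_subst_le nonnegCoeff_exp hf h0 hx).trans
    (partialEval_exp_le (partialEval_nonneg hf hx))

theorem partialEval_X_mul (f : ℝ⟦X⟧) (N : ℕ) (x : ℝ) :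
    partialEval (X * f) (N + 1) x = x * partialEval f N x := by
  unfold partialEval
  rw [Finset.sum_range_succ', Finset.mul_sum]
  simp only [coeff_succ_X_mul, coeff_zero_X_mul, zero_mul, add_zero]
  exact Finset.sum_congr rfl fun n _ => by rw [pow_succ]; ring

theorem partialEval_le_tsum (hf : NonnegCoeff f) (hx : 0 ≤ x)
    (hs : Summable fun n => coeff n f * x ^ n) : partialEval f N x ≤ ∑' n, coeff n f * x ^ n :=
  hs.sum_le_tsum _ fun n _ => mul_nonneg (hf n) (pow_nonneg hx n)

theorem summable_of_partialEval_le (hf : NonnegCoeff f) (hx : 0 ≤ x) {B : ℝ}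
    (h : ∀ N, partialEval f N x ≤ B) : Summable fun n => coeff n f * x ^ n := by
  refine summable_of_sum_range_le (c := B) (fun n => mul_nonneg (hf n) (pow_nonneg hx n))
    fun N => ?_
  refine le_trans ?_ (h N)
  exact Finset.sum_le_sum_of_subset_of_nonneg (Finset.range_mono (Nat.le_succ N))
    fun n _ _ => mul_nonneg (hf n) (pow_nonneg hx n)

/-- The factors 1/i are bounded by 1, and for each i ≤ N the multiples of i up to N are a part of
all exponents ik with k ≤ N. -/
theorem partialEval_seriesS_le (N : ℕ) (hx : 0 ≤ x) :
    partialEval seriesS N x ≤ ∑ i ∈ Finset.Icc 2 N, partialEval seriesT N (x ^ i) := by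
  have h1 : ∀ n ∈ Finset.range (N + 1), coeff n seriesS * x ^ n ≤
      ∑ i ∈ Finset.Icc 2 N, ∑ k ∈ Finset.range (N + 1),
        if n = i * k then (numTrees k : ℝ) * (x ^ i) ^ k else 0 := by
    intro n hn
    have hn' : n ≤ N := by simpa [Nat.lt_succ_iff] using hn
    rw [coeff_seriesS, Finset.sum_mul]
    have hnn : ∀ i k, 0 ≤ if n = i * k then (numTrees k : ℝ) * (x ^ i) ^ k else 0 := by
      intro i k
      split_ifs <;> positivity
    refine (Finset.sum_le_sum fun i hi => ?_).trans (Finset.sum_le_sum_of_subset_of_nonneg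
      (Finset.Icc_subset_Icc_right hn') fun i _ _ => Finset.sum_nonneg fun k _ => hnn i k)
    have hi2 := (Finset.mem_Icc.1 hi).1
    split_ifs with hd
    · obtain ⟨k, rfl⟩ := hd
      have hi0 : 0 < i := by omega
      rw [Nat.mul_div_cancel_left _ hi0]
      refine le_trans ?_ (Finset.single_le_sum (fun k _ => hnn i k)
        (Finset.mem_range.2 (Nat.lt_succ_iff.2 ((Nat.le_mul_of_pos_left k hi0).trans hn'))))
      rw [if_pos rfl, ← pow_mul]
      refine mul_le_mul_of_nonneg_right ?_ (by positivity)
      refine mul_le_of_le_one_left (by positivity) (inv_le_one_of_one_le₀ ?_)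
      exact_mod_cast hi0
    · rw [mul_zero, zero_mul]
      exact Finset.sum_nonneg fun k _ => hnn i k
  refine (Finset.sum_le_sum h1).trans ?_
  rw [Finset.sum_comm]
  refine Finset.sum_le_sum fun i _ => ?_
  rw [Finset.sum_comm, partialEval]
  refine Finset.sum_le_sum fun k _ => ?_
  rw [Finset.sum_ite_eq', seriesT, coeff_mk]
  split_ifs
  · exact le_rfl
  · positivity

end PartialSums

/-- The factor z in T = z D exp T raises degrees by one, so the functional equation becomes a
recursive bound in N. -/
theorem partialEval_seriesT_succ_le (N : ℕ) {x : ℝ} (hx : 0 ≤ x) :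
    partialEval seriesT (N + 1) x ≤
      x * Real.exp (∑ i ∈ Finset.Icc 1 (N + 1), partialEval seriesT N (x ^ i)) := by
  have h1 : seriesT = X * (seriesD * (exp ℝ).subst seriesT) := by
    rw [← mul_assoc]; exact seriesT_eq
  have hN : NonnegCoeff ((exp ℝ).subst seriesT) :=
    nonnegCoeff_exp.subst nonnegCoeff_seriesT constantCoeff_seriesT
  rw [h1, partialEval_X_mul]
  refine mul_le_mul_of_nonneg_left ?_ hx
  refine (partialEval_mul_le nonnegCoeff_seriesD hN hx).trans ?_
  rw [← h1]
  have h2 : partialEval seriesD N x ≤ Real.exp (partialEval seriesS N x) :=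
    partialEval_exp_subst_le nonnegCoeff_seriesS constantCoeff_seriesS hx
  have h3 : partialEval ((exp ℝ).subst seriesT) N x ≤ Real.exp (partialEval seriesT N x) :=
    partialEval_exp_subst_le nonnegCoeff_seriesT constantCoeff_seriesT hx
  refine (mul_le_mul h2 h3 (partialEval_nonneg hN hx) (Real.exp_nonneg _)).trans ?_
  rw [← Real.exp_add]
  refine Real.exp_le_exp.2 ?_
  have h4 := partialEval_seriesS_le N hx
  have h5 : ∑ i ∈ Finset.Icc 2 N, partialEval seriesT N (x ^ i) ≤
      ∑ i ∈ Finset.Icc 2 (N + 1), partialEval seriesT N (x ^ i) :=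
    Finset.sum_le_sum_of_subset_of_nonneg (Finset.Icc_subset_Icc_right (Nat.le_succ N))
      fun i _ _ => partialEval_nonneg nonnegCoeff_seriesT (pow_nonneg hx i)
  have h6 := Finset.sum_Ioc_add_eq_sum_Icc (f := fun i => partialEval seriesT N (x ^ i))
    (show 1 ≤ N + 1 by omega)
  rw [pow_one, show Finset.Ioc 1 (N + 1) = Finset.Icc 2 (N + 1) from rfl] at h6
  linarith

theorem sum_Icc_pow_le {x : ℝ} (hx : 0 ≤ x) (hx1 : x < 1) (a N : ℕ) :
    ∑ i ∈ Finset.Icc a N, x ^ i ≤ x ^ a / (1 - x) := by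
  have h : HasSum (fun i : ℕ => x ^ a * x ^ i) (x ^ a * (1 - x)⁻¹) :=
    (hasSum_geometric_of_lt_one hx hx1).mul_left _
  rw [div_eq_mul_inv, ← h.tsum_eq]
  have h2 : ∑ i ∈ Finset.Icc a N, x ^ i = ∑ j ∈ Finset.range (N + 1 - a), x ^ a * x ^ j := by
    rw [← Finset.Ico_succ_right_eq_Icc, Finset.sum_Ico_eq_sum_range]
    exact Finset.sum_congr rfl fun j _ => pow_add x a j
  rw [h2]
  exact h.summable.sum_le_tsum _ fun i _ => by positivity

/-- By induction the exponent in the recursion is at most e ∑ x^i ≤ e/3 < 1. All powers x^i stay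
below 1/4, so the hypothesis applies to them. -/
theorem partialEval_seriesT_le (N : ℕ) {x : ℝ} (hx : 0 ≤ x) (hx4 : x ≤ 1 / 4) :
    partialEval seriesT N x ≤ Real.exp 1 * x := by
  induction N generalizing x with
  | zero =>
    simp only [partialEval, zero_add, Finset.range_one, Finset.sum_singleton, pow_zero, mul_one,
      seriesT, coeff_mk, numTrees_zero, Nat.cast_zero]
    positivity
  | succ N ih =>
    refine (partialEval_seriesT_succ_le N hx).trans ?_
    rw [mul_comm]
    refine mul_le_mul_of_nonneg_right (Real.exp_le_exp.2 ?_) hx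
    have h1 : ∑ i ∈ Finset.Icc 1 (N + 1), partialEval seriesT N (x ^ i) ≤
        ∑ i ∈ Finset.Icc 1 (N + 1), Real.exp 1 * x ^ i := by
      refine Finset.sum_le_sum fun i hi => ih (pow_nonneg hx i) ?_
      exact (pow_le_of_le_one hx (by linarith) (by have := (Finset.mem_Icc.1 hi).1; omega)).trans hx4
    rw [← Finset.mul_sum] at h1
    have h2 := sum_Icc_pow_le hx (by linarith) 1 (N + 1)
    have h3 : x ^ 1 / (1 - x) ≤ 1 / 3 := by
      rw [pow_one, div_le_iff₀ (by linarith)]; linarith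
    have h4 := Real.exp_one_lt_d9
    have h5 := Real.exp_pos 1
    nlinarith

end PolyaForest

/-! ### The dominant singularity ρ, where z D(z) = 1/e. -/

namespace PolyaForest

open PowerSeries
open scoped ENNReal NNReal

/-- T has no constant term, so T(x^i) ≤ x^(i-2) T(x^2) for i ≥ 2, and the exponent of D is dominated
by a geometric series. This is why D converges up to √ρ. -/
theorem summable_seriesD_of_sq {x : ℝ} (hx : 0 ≤ x) (hx1 : x < 1)
    (h : Summable fun n => coeff n seriesT * (x ^ 2) ^ n) :
    Summable fun n => coeff n seriesD * x ^ n := by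
  set τ := ∑' n, coeff n seriesT * (x ^ 2) ^ n
  have hT : ∀ N, ∀ i ∈ Finset.Icc 2 N,
      partialEval seriesT N (x ^ i) ≤ x ^ (i - 2) * τ := by
    intro N i hi
    have hi2 := (Finset.mem_Icc.1 hi).1
    have h1 := partialEval_le_tsum (N := N) nonnegCoeff_seriesT (pow_nonneg hx 2) h
    refine le_trans ?_ (mul_le_mul_of_nonneg_left h1 (pow_nonneg hx (i - 2)))
    rw [partialEval, partialEval, Finset.mul_sum]
    refine Finset.sum_le_sum fun n _ => ?_
    rcases Nat.eq_zero_or_pos n with rfl | hn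
    · simp [constantCoeff_seriesT]
    · have h2 : (x ^ i) ^ n ≤ x ^ (i - 2) * (x ^ 2) ^ n := by
        rw [← pow_mul, ← pow_mul, ← pow_add]
        refine pow_le_pow_of_le_one hx hx1.le ?_
        obtain ⟨j, rfl⟩ : ∃ j, i = j + 2 := ⟨i - 2, by omega⟩
        rw [Nat.add_sub_cancel, add_mul]
        have := Nat.le_mul_of_pos_right j hn
        omega
      calc coeff n seriesT * (x ^ i) ^ n ≤ coeff n seriesT * (x ^ (i - 2) * (x ^ 2) ^ n) :=
            mul_le_mul_of_nonneg_left h2 (nonnegCoeff_seriesT n)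
        _ = _ := by ring
  have hτ : 0 ≤ τ := tsum_nonneg fun n => mul_nonneg (nonnegCoeff_seriesT n) (by positivity)
  refine summable_of_partialEval_le nonnegCoeff_seriesD hx (B := Real.exp (1 / (1 - x) * τ))
    fun N => ?_
  refine (partialEval_exp_subst_le nonnegCoeff_seriesS constantCoeff_seriesS hx).trans
    (Real.exp_le_exp.2 ((partialEval_seriesS_le N hx).trans
      ((Finset.sum_le_sum (hT N)).trans ?_)))
  rw [← Finset.sum_mul]
  refine mul_le_mul_of_nonneg_right ?_ hτ
  have h3 := sum_Icc_pow_le hx hx1 0 (N - 2)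
  rw [pow_zero] at h3
  refine le_trans ?_ h3
  rw [← Finset.sum_image (f := fun j => x ^ j) (g := fun i => i - 2) (s := Finset.Icc 2 N)]
  · refine Finset.sum_le_sum_of_subset_of_nonneg (fun j hj => ?_) fun j _ _ => pow_nonneg hx j
    simp only [Finset.mem_image, Finset.mem_Icc] at hj ⊢
    omega
  · intro i hi j hj hij
    simp only [Finset.coe_Icc, Set.mem_Icc] at hi hj
    simp only at hij
    omega

theorem mul_exp_neg_le (τ : ℝ) : τ * Real.exp (-τ) ≤ Real.exp (-1) := by
  have h := Real.add_one_le_exp (τ - 1)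
  have h2 : Real.exp (-1) = Real.exp (τ - 1) * Real.exp (-τ) := by
    rw [← Real.exp_add]; ring_nf
  rw [h2]
  exact mul_le_mul_of_nonneg_right (by linarith) (Real.exp_nonneg _)

theorem summable_seriesT_sq {x : ℝ} (hx : 0 ≤ x) (hx1 : x < 1)
    (h : Summable fun n => coeff n seriesT * x ^ n) :
    Summable fun n => coeff n seriesT * (x ^ 2) ^ n := by
  refine Summable.of_nonneg_of_le (fun n => mul_nonneg (nonnegCoeff_seriesT n) (by positivity))
    (fun n => mul_le_mul_of_nonneg_left (pow_le_pow_left₀ (by positivity) ?_ n)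
      (nonnegCoeff_seriesT n)) h
  nlinarith

/-- With τ = T(x), the functional equation reads x D(x) = τ exp(-τ), which is at most 1/e. -/
theorem mul_tsum_seriesD_le {x : ℝ} (hx : 0 ≤ x) (hx1 : x < 1)
    (h : Summable fun n => coeff n seriesT * x ^ n) :
    x * ∑' n, coeff n seriesD * x ^ n ≤ Real.exp (-1) := by
  have hD := summable_seriesD_of_sq hx hx1 (summable_seriesT_sq hx hx1 h)
  set τ := ∑' n, coeff n seriesT * x ^ n with hτdef
  have hτ : 0 ≤ τ := tsum_nonneg fun n => mul_nonneg (nonnegCoeff_seriesT n) (pow_nonneg hx n)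
  have hδ : 0 ≤ ∑' n, coeff n seriesD * x ^ n :=
    tsum_nonneg fun n => mul_nonneg (nonnegCoeff_seriesD n) (pow_nonneg hx n)
  have h1 := congrArg (fun f => evalE f (ENNReal.ofReal x)) seriesT_eq
  rw [evalE_mul _ (nonnegCoeff_X.mul nonnegCoeff_seriesD)
      (nonnegCoeff_exp.subst nonnegCoeff_seriesT constantCoeff_seriesT),
    evalE_mul _ nonnegCoeff_X nonnegCoeff_seriesD, evalE_X,
    evalE_subst _ nonnegCoeff_exp nonnegCoeff_seriesT constantCoeff_seriesT,
    evalE_ofReal nonnegCoeff_seriesT hx h, evalE_ofReal nonnegCoeff_seriesD hx hD,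
    evalE_exp hτ, ← ENNReal.ofReal_mul hx, ← ENNReal.ofReal_mul (mul_nonneg hx hδ),
    ENNReal.ofReal_eq_ofReal_iff hτ (by positivity)] at h1
  refine le_trans (le_of_eq ?_) (mul_exp_neg_le τ)
  rw [Real.exp_neg, eq_mul_inv_iff_mul_eq₀ (Real.exp_ne_zero _)]
  exact h1.symm

theorem seriesT_eq_subst : seriesT = seriesC.subst (X * seriesD) :=
  eq_seriesC_subst constantCoeff_seriesT seriesT_eq

/-- The coefficients are bounded by n^n / n! ≤ e^n. -/
theorem summable_seriesC {y : ℝ} (hy : 0 ≤ y) (hy1 : y < Real.exp (-1)) :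
    Summable fun n => coeff n seriesC * y ^ n := by
  have h1 : Real.exp 1 * y < 1 := by
    have := mul_lt_mul_of_pos_left hy1 (Real.exp_pos 1)
    rwa [← Real.exp_add, add_neg_cancel, Real.exp_zero] at this
  refine Summable.of_nonneg_of_le (fun n => mul_nonneg (nonnegCoeff_seriesC n) (pow_nonneg hy n))
    (fun n => ?_) (summable_geometric_of_lt_one (by positivity) h1)
  rw [mul_pow]
  refine mul_le_mul_of_nonneg_right ?_ (pow_nonneg hy n)
  rw [seriesC, coeff_mk, ← Real.exp_nat_mul, mul_one]
  split_ifs with h0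
  · positivity
  · refine le_trans ?_ (Real.pow_div_factorial_le_exp (n : ℝ) (by positivity) n)
    refine div_le_div_of_nonneg_right ?_ (by positivity)
    refine pow_le_pow_right₀ ?_ (Nat.sub_le n 1)
    exact_mod_cast Nat.one_le_iff_ne_zero.2 h0

theorem summable_seriesT_of_lt {x : ℝ} (hx : 0 ≤ x)
    (hD : Summable fun n => coeff n seriesD * x ^ n)
    (h : x * ∑' n, coeff n seriesD * x ^ n < Real.exp (-1)) :
    Summable fun n => coeff n seriesT * x ^ n := by
  have hδ : 0 ≤ ∑' n, coeff n seriesD * x ^ n :=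
    tsum_nonneg fun n => mul_nonneg (nonnegCoeff_seriesD n) (pow_nonneg hx n)
  rw [summable_iff_evalE nonnegCoeff_seriesT hx, seriesT_eq_subst,
    evalE_subst _ nonnegCoeff_seriesC (nonnegCoeff_X.mul nonnegCoeff_seriesD) (by simp),
    evalE_mul _ nonnegCoeff_X nonnegCoeff_seriesD, evalE_X, evalE_ofReal nonnegCoeff_seriesD hx hD,
    ← ENNReal.ofReal_mul hx, ← summable_iff_evalE nonnegCoeff_seriesC (mul_nonneg hx hδ)]
  exact summable_seriesC (mul_nonneg hx hδ) h

section Radius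

/-- The radius of convergence of `T` in `[0, ∞]`. -/
def radiusT : ℝ≥0∞ := (FormalMultilinearSeries.ofScalars ℝ (fun n => (numTrees n : ℝ))).radius

theorem rho_eq : rho = radiusT.toReal := rfl

theorem summable_of_lt_radiusT {r : ℝ≥0} (h : (r : ℝ≥0∞) < radiusT) :
    Summable fun n => coeff n seriesT * (r : ℝ) ^ n := by
  have h1 := FormalMultilinearSeries.summable_norm_mul_pow _ h
  refine h1.congr fun n => ?_
  rw [FormalMultilinearSeries.ofScalars_norm, seriesT, coeff_mk]
  simp

theorem le_radiusT_of_summable {r : ℝ≥0}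
    (h : Summable fun n => coeff n seriesT * (r : ℝ) ^ n) : (r : ℝ≥0∞) ≤ radiusT := by
  refine FormalMultilinearSeries.le_radius_of_summable_norm _ (h.congr fun n => ?_)
  rw [FormalMultilinearSeries.ofScalars_norm, seriesT, coeff_mk]
  simp

theorem one_le_tsum_seriesD {x : ℝ} (hx : 0 ≤ x)
    (hD : Summable fun n => coeff n seriesD * x ^ n) : 1 ≤ ∑' n, coeff n seriesD * x ^ n := by
  have := hD.le_tsum 0 fun n _ => mul_nonneg (nonnegCoeff_seriesD n) (pow_nonneg hx n)
  have h0 : coeff 0 seriesD = 1 := d_zero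
  rwa [h0, pow_zero, mul_one] at this

/-- D ≥ 1 at nonnegative points, so x ≤ x D(x) ≤ 1/e wherever T converges. The minimum with 1 keeps
the test point in the range x < 1 that these bounds require. -/
theorem radiusT_le : radiusT ≤ ENNReal.ofReal (Real.exp (-1)) := by
  by_contra! h
  have h1 : ENNReal.ofReal (Real.exp (-1)) < min radiusT 1 := by
    refine lt_min h ?_
    rw [ENNReal.ofReal_lt_one, ← Real.exp_zero]
    exact Real.exp_lt_exp.2 (by norm_num)
  obtain ⟨r, hr1, hr2⟩ := ENNReal.lt_iff_exists_nnreal_btwn.1 h1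
  have hs := summable_of_lt_radiusT (hr2.trans_le (min_le_left _ _))
  have hr : (r : ℝ) < 1 := by exact_mod_cast hr2.trans_le (min_le_right _ _)
  have h2 := mul_tsum_seriesD_le r.2 hr hs
  have h3 := one_le_tsum_seriesD r.2
    (summable_seriesD_of_sq r.2 hr (summable_seriesT_sq r.2 hr hs))
  have h4 : Real.exp (-1) < r := by
    have := (ENNReal.ofReal_lt_iff_lt_toReal (Real.exp_nonneg _) ENNReal.coe_ne_top).1 hr1
    simpa using this
  have h5 : (r : ℝ) ≤ r * ∑' n, coeff n seriesD * (r : ℝ) ^ n := le_mul_of_one_le_right r.2 h3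
  exact absurd (h5.trans h2) (not_le.2 h4)

theorem radiusT_ne_top : radiusT ≠ ∞ := ne_top_of_le_ne_top ENNReal.ofReal_ne_top radiusT_le

theorem rho_le : rho ≤ Real.exp (-1) := ENNReal.toReal_le_of_le_ofReal (Real.exp_nonneg _) radiusT_le

theorem rho_lt_one : rho < 1 :=
  rho_le.trans_lt (by rw [← Real.exp_zero]; exact Real.exp_lt_exp.2 (by norm_num))

theorem summable_of_lt_rho {x : ℝ} (hx : 0 ≤ x) (h : x < rho) :
    Summable fun n => coeff n seriesT * x ^ n := by
  lift x to ℝ≥0 using hx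
  refine summable_of_lt_radiusT ?_
  rw [rho_eq] at h
  rw [← ENNReal.ofReal_coe_nnreal]
  exact (ENNReal.ofReal_lt_iff_lt_toReal x.2 radiusT_ne_top).2 h

theorem le_rho_of_summable {x : ℝ} (hx : 0 ≤ x)
    (h : Summable fun n => coeff n seriesT * x ^ n) : x ≤ rho := by
  lift x to ℝ≥0 using hx
  have := ENNReal.toReal_mono radiusT_ne_top (le_radiusT_of_summable h)
  simpa [rho_eq] using this

theorem rho_pos : 0 < rho := by
  have h : (1 / 4 : ℝ) ≤ rho := le_rho_of_summable (by norm_num)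
    (summable_of_partialEval_le nonnegCoeff_seriesT (by norm_num) fun N =>
      partialEval_seriesT_le N (by norm_num) le_rfl)
  linarith

theorem summable_d_mul_pow {x : ℝ} (hx : 0 ≤ x) (h : x < √rho) :
    Summable fun n => d n * x ^ n := by
  have hsq : x ^ 2 < rho := (Real.lt_sqrt hx).1 h
  refine summable_seriesD_of_sq hx ?_ (summable_of_lt_rho (by positivity) hsq)
  nlinarith [rho_lt_one]

theorem rho_lt_sqrt : rho < √rho := by
  rw [Real.lt_sqrt rho_pos.le]
  nlinarith [rho_lt_one, rho_pos]

theorem summable_d_mul_pow_complex {z : ℂ} (h : ‖z‖ < √rho) :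
    Summable fun k : ℕ => ((d k : ℝ) : ℂ) * z ^ k := by
  refine Summable.of_norm ((summable_d_mul_pow (norm_nonneg z) h).congr fun k => ?_)
  rw [norm_mul, norm_pow, Complex.norm_real, Real.norm_of_nonneg (d_nonneg k)]

theorem continuousOn_tsum_d {b : ℝ} (hb : 0 ≤ b) (h : b < √rho) :
    ContinuousOn (fun x : ℝ => ∑' n, d n * x ^ n) (Set.Icc 0 b) := by
  refine continuousOn_tsum (fun n => by fun_prop) (summable_d_mul_pow hb h) fun n x hx => ?_
  rw [Real.norm_of_nonneg (mul_nonneg (d_nonneg n) (pow_nonneg hx.1 n))]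
  exact mul_le_mul_of_nonneg_left (pow_le_pow_left₀ hx.1 hx.2 n) (d_nonneg n)

/-- The dominant singularity of `T` is the point where `z D(z) = 1 / e`. -/
theorem rho_mul_tsum : rho * ∑' n, d n * rho ^ n = Real.exp (-1) := by
  obtain ⟨b, hb1, hb2⟩ := exists_between rho_lt_sqrt
  have hb0 : 0 ≤ b := rho_pos.le.trans hb1.le
  have hc : ContinuousOn (fun x : ℝ => x * ∑' n, d n * x ^ n) (Set.Icc 0 b) :=
    continuousOn_id.mul (continuousOn_tsum_d hb0 hb2)
  have hcat : ContinuousAt (fun x : ℝ => x * ∑' n, d n * x ^ n) rho :=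
    hc.continuousAt (Icc_mem_nhds rho_pos hb1)
  refine le_antisymm ?_ ?_
  -- The bound x D(x) ≤ 1/e holds below ρ and passes to the limit.
  · refine le_of_tendsto (hcat.tendsto.mono_left (nhdsWithin_le_nhds (s := Set.Iio rho))) ?_
    filter_upwards [self_mem_nhdsWithin, nhdsWithin_le_nhds (lt_mem_nhds rho_pos)] with x hx hx0
    exact mul_tsum_seriesD_le (le_of_lt hx0) (lt_trans hx rho_lt_one)
      (summable_of_lt_rho (le_of_lt hx0) hx)
  -- D is continuous beyond ρ. A strict inequality at ρ would persist to some x > ρ, where T = C(zD)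
  -- would still converge.
  · by_contra! h
    have h1 : ∀ᶠ x in nhdsWithin rho (Set.Ioi rho), x * ∑' n, d n * x ^ n < Real.exp (-1) :=
      nhdsWithin_le_nhds (hcat.eventually_lt_const h)
    have h2 : ∀ᶠ x in nhdsWithin rho (Set.Ioi rho), x < √rho :=
      nhdsWithin_le_nhds (gt_mem_nhds rho_lt_sqrt)
    obtain ⟨x, hx, hx2, hx3⟩ := (h1.and (h2.and self_mem_nhdsWithin)).exists
    have hx0 : 0 ≤ x := rho_pos.le.trans (le_of_lt hx3)
    exact absurd (le_rho_of_summable hx0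
      (summable_seriesT_of_lt hx0 (summable_d_mul_pow hx0 hx2) hx)) (not_le.2 hx3)

end Radius

end PolyaForest

/-! ### Reciprocals of power series without zeros in the closed unit disc. -/

namespace PolyaForest

open PowerSeries
open scoped ENNReal NNReal

theorem eq_one_of_hasSum {E : ℂ⟦X⟧} {r : ℝ} (hr : 0 < r)
    (h : ∀ w : ℂ, ‖w‖ < r → HasSum (fun n => coeff n E * w ^ n) 1) : E = 1 := by
  have h1 : HasFPowerSeriesAt (fun _ : ℂ => (1 : ℂ))
      (FormalMultilinearSeries.ofScalars ℂ fun n => coeff n E) 0 := by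
    rw [hasFPowerSeriesAt_iff]
    filter_upwards [Metric.ball_mem_nhds (0 : ℂ) hr] with w hw
    refine (h w (mem_ball_zero_iff.1 hw)).congr_fun fun n => ?_
    rw [FormalMultilinearSeries.coeff_ofScalars, smul_eq_mul, mul_comm]
  have h2 := h1.eq_formalMultilinearSeries hasFPowerSeriesAt_const
  have h3 : HasFPowerSeriesAt (fun _ : ℂ => (1 : ℂ))
      (FormalMultilinearSeries.ofScalars ℂ fun n => coeff n (1 : ℂ⟦X⟧)) 0 := by
    rw [hasFPowerSeriesAt_iff]
    refine Filter.Eventually.of_forall fun w => ?_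
    have := hasSum_single (f := fun n => w ^ n • coeff n (1 : ℂ⟦X⟧)) 0 fun n hn => by
      simp [coeff_one, hn]
    simpa [FormalMultilinearSeries.coeff_ofScalars] using this
  have h4 := h1.eq_formalMultilinearSeries h3
  ext n
  have h5 := congrArg (fun p => FormalMultilinearSeries.coeff p n) h4
  simpa only [FormalMultilinearSeries.coeff_ofScalars] using h5

/-- The reciprocal of a power series that converges beyond the closed unit disc and has no zero
there converges beyond the closed unit disc. -/
theorem exists_summable_of_mul_eq_one {Q q : ℝ⟦X⟧} (hQq : Q * q = 1) {x : ℝ} (hx : 1 < x)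
    (hs : Summable fun n => |coeff n Q| * x ^ n)
    (h0 : ∀ w : ℂ, ‖w‖ ≤ 1 → ∑' n, ((coeff n Q : ℝ) : ℂ) * w ^ n ≠ 0) :
    ∃ y : ℝ, 1 < y ∧ Summable fun n => |coeff n q| * y ^ n := by
  set f : ℂ → ℂ := fun w => ∑' n, ((coeff n Q : ℝ) : ℂ) * w ^ n with hf
  have hle : ∀ n (w : ℂ), w ∈ Metric.ball (0 : ℂ) x →
      ‖((coeff n Q : ℝ) : ℂ) * w ^ n‖ ≤ |coeff n Q| * x ^ n := by
    intro n w hw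
    rw [norm_mul, norm_pow, Complex.norm_real, Real.norm_eq_abs]
    exact mul_le_mul_of_nonneg_left
      (pow_le_pow_left₀ (norm_nonneg w) (mem_ball_zero_iff.1 hw).le n) (abs_nonneg _)
  have hd : DifferentiableOn ℂ f (Metric.ball 0 x) :=
    Complex.differentiableOn_tsum_of_summable_norm hs (fun n => by fun_prop) Metric.isOpen_ball hle
  -- By compactness f has no zero on a slightly larger disc, where 1/f has a Cauchy power series.
  have hopen : IsOpen (Metric.ball (0 : ℂ) x ∩ f ⁻¹' {0}ᶜ) :=
    hd.continuousOn.isOpen_inter_preimage Metric.isOpen_ball isOpen_compl_singleton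
  have hsub : Metric.closedBall (0 : ℂ) 1 ⊆ Metric.ball (0 : ℂ) x ∩ f ⁻¹' {0}ᶜ := fun w hw => by
    have hw' := mem_closedBall_zero_iff.1 hw
    exact ⟨mem_ball_zero_iff.2 (hw'.trans_lt hx), h0 w hw'⟩
  obtain ⟨δ, hδ, hδ2⟩ :=
    (isCompact_closedBall (0 : ℂ) 1).exists_thickening_subset_open hopen hsub
  rw [thickening_closedBall hδ zero_le_one] at hδ2
  have hR : (0 : ℝ) < 1 + δ / 2 := by positivity
  lift 1 + δ / 2 to ℝ≥0 using hR.le with R hRe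
  have hcb : Metric.closedBall (0 : ℂ) R ⊆ Metric.ball (0 : ℂ) x ∩ f ⁻¹' {0}ᶜ :=
    (Metric.closedBall_subset_ball (by rw [hRe]; linarith)).trans hδ2
  have hg : DifferentiableOn ℂ (fun w => (f w)⁻¹) (Metric.closedBall 0 R) :=
    (hd.mono fun w hw => (hcb hw).1).inv fun w hw => (hcb hw).2
  have hp := hg.hasFPowerSeriesOnBall (NNReal.coe_pos.1 hR)
  set p := cauchyPowerSeries (fun w => (f w)⁻¹) 0 R
  have hp1 : ∀ w : ℂ, ‖w‖ < R → HasSum (fun n => p.coeff n * w ^ n) (f w)⁻¹ := by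
    intro w hw
    have h1 := hp.hasSum (y := w) (by simpa [← ofReal_norm] using hw)
    rw [zero_add] at h1
    refine h1.congr_fun fun n => ?_
    rw [FormalMultilinearSeries.apply_eq_pow_smul_coeff, smul_eq_mul, mul_comm]
  have hp2 : ∀ y : ℝ≥0, y < R → Summable fun n => ‖p.coeff n‖ * (y : ℝ) ^ n := by
    intro y hy
    have h1 := p.summable_norm_mul_pow (r := y)
      ((ENNReal.coe_lt_coe.2 hy).trans_le hp.r_le)
    refine h1.congr fun n => ?_
    rw [FormalMultilinearSeries.norm_apply_eq_norm_coef]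
  have h1R : (1 : ℝ≥0) < R := by rw [← NNReal.coe_lt_coe, hRe]; push_cast; linarith
  obtain ⟨y, hy1, hyR⟩ := exists_between h1R
  -- Uniqueness of power series identifies the Cauchy coefficients of 1/f with those of the formal
  -- reciprocal q.
  have hE : map Complex.ofRealHom Q * mk (fun n => p.coeff n) = 1 := by
    refine eq_one_of_hasSum (r := y) (lt_trans one_pos hy1) fun w hw => ?_
    have hwR : ‖w‖ < R := hw.trans (by exact_mod_cast hyR)
    have hwb := hcb (mem_closedBall_zero_iff.2 hwR.le)
    have s1 : Summable fun n => ‖((coeff n Q : ℝ) : ℂ) * w ^ n‖ :=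
      Summable.of_nonneg_of_le (fun n => norm_nonneg _) (fun n => hle n w hwb.1) hs
    have s2 : Summable fun n => ‖p.coeff n * w ^ n‖ := by
      refine Summable.of_nonneg_of_le (fun n => norm_nonneg _) (fun n => ?_) (hp2 y hyR)
      rw [norm_mul, norm_pow]
      exact mul_le_mul_of_nonneg_left (pow_le_pow_left₀ (norm_nonneg w) hw.le n) (norm_nonneg _)
    have s3 := tsum_mul_tsum_eq_tsum_sum_antidiagonal_of_summable_norm s1 s2
    have s4 := (summable_norm_sum_mul_antidiagonal_of_summable_norm s1 s2).of_norm
    rw [(hp1 w hwR).tsum_eq] at s3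
    change f w * _ = _ at s3
    rw [mul_inv_cancel₀ hwb.2] at s3
    have s5 := s4.hasSum
    rw [← s3] at s5
    refine s5.congr_fun fun n => ?_
    rw [coeff_mul, Finset.sum_mul]
    refine Finset.sum_congr rfl fun ij hij => ?_
    rw [← Finset.HasAntidiagonal.mem_antidiagonal.1 hij, pow_add, coeff_map, coeff_mk]
    simp only [Complex.ofRealHom_eq_coe]
    ring
  have hq : mk (fun n => p.coeff n) = map Complex.ofRealHom q := by
    have h1 : map Complex.ofRealHom Q * map Complex.ofRealHom q = 1 := by
      rw [← map_mul, hQq, map_one]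
    calc mk (fun n => p.coeff n)
        = (map Complex.ofRealHom Q * map Complex.ofRealHom q) * mk (fun n => p.coeff n) := by
          rw [h1, one_mul]
      _ = (map Complex.ofRealHom Q * mk (fun n => p.coeff n)) * map Complex.ofRealHom q := by ring
      _ = _ := by rw [hE, one_mul]
  refine ⟨y, hy1, (hp2 y hyR).congr fun n => ?_⟩
  have h2 := congrArg (coeff n) hq
  rw [coeff_mk, coeff_map] at h2
  rw [h2, Complex.ofRealHom_eq_coe, Complex.norm_real, Real.norm_eq_abs]

end PolyaForest

/-! ### Renewal sequences with exponential moments. -/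

namespace PolyaForest

open PowerSeries Filter Topology

/-- A probability distribution on the positive integers that charges `1` and has a finite
exponential moment. -/
structure IsRenewalLaw (b : ℝ⟦X⟧) (x : ℝ) : Prop where
  nonneg : NonnegCoeff b
  zero : constantCoeff b = 0
  one_pos : 0 < coeff 1 b
  one_lt : 1 < x
  summable : Summable fun n => coeff n b * x ^ n
  hasSum : HasSum (fun n => coeff n b) 1

/-- The tail probabilities of a distribution. -/
def tailSeries (b : ℝ⟦X⟧) : ℝ⟦X⟧ := mk fun n => 1 - ∑ j ∈ Finset.range (n + 1), coeff j b

/-- The generating function of the expected number of visits of the renewal process. -/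
def renewalSeries (b : ℝ⟦X⟧) : ℝ⟦X⟧ := (mk fun _ => (1 : ℝ)).subst b

theorem coeff_one_sub_X_mul_succ (f : ℝ⟦X⟧) (n : ℕ) :
    coeff (n + 1) ((1 - X) * f) = coeff (n + 1) f - coeff n f := by
  rw [sub_mul, one_mul, map_sub, coeff_succ_X_mul]

theorem coeff_one_sub_X_mul_zero (f : ℝ⟦X⟧) : coeff 0 ((1 - X) * f) = coeff 0 f := by
  rw [sub_mul, one_mul, map_sub, coeff_zero_X_mul, sub_zero]

theorem coeff_eq_sum_one_sub_X_mul (f : ℝ⟦X⟧) (n : ℕ) :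
    coeff n f = ∑ j ∈ Finset.range (n + 1), coeff j ((1 - X) * f) := by
  induction n with
  | zero => rw [Finset.sum_range_one, coeff_one_sub_X_mul_zero]
  | succ n ih => rw [Finset.sum_range_succ, ← ih, coeff_one_sub_X_mul_succ]; ring

theorem one_sub_X_mul_mk_one : (1 - X : ℝ⟦X⟧) * mk (fun _ => (1 : ℝ)) = 1 := by
  ext n
  cases n with
  | zero => simp
  | succ n => rw [coeff_one_sub_X_mul_succ]; simp [coeff_one]

theorem one_sub_X_mul_tailSeries (b : ℝ⟦X⟧) : (1 - X) * tailSeries b = 1 - b := by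
  ext n
  cases n with
  | zero => rw [coeff_one_sub_X_mul_zero]; simp [tailSeries]
  | succ n =>
    rw [coeff_one_sub_X_mul_succ, tailSeries, coeff_mk, coeff_mk, Finset.sum_range_succ _ (n + 1),
      map_sub, coeff_one, if_neg n.succ_ne_zero]
    ring

theorem one_sub_mul_subst {b : ℝ⟦X⟧} (hb : constantCoeff b = 0) (f : ℝ⟦X⟧) :
    (1 - b) * f.subst b = ((1 - X) * f).subst b := by
  have h := hasSubst_of_zero hb
  rw [subst_mul h, subst_sub h, subst_X h]
  congr 2
  rw [← coe_substAlgHom h, map_one]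

theorem one_sub_mul_renewalSeries {b : ℝ⟦X⟧} (hb : constantCoeff b = 0) :
    (1 - b) * renewalSeries b = 1 := by
  rw [renewalSeries, one_sub_mul_subst hb, one_sub_X_mul_mk_one,
    ← coe_substAlgHom (hasSubst_of_zero hb), map_one]

/-- The renewal series 1/(1 - b) is singular at 1. The factor 1 - X removes this, and what remains
is the reciprocal of (1 - b)/(1 - X), the tail series. -/
theorem tailSeries_mul {b : ℝ⟦X⟧} (hb : constantCoeff b = 0) :
    tailSeries b * ((1 - X) * renewalSeries b) = 1 := by
  rw [mul_left_comm, ← mul_assoc, one_sub_X_mul_tailSeries, one_sub_mul_renewalSeries hb]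

namespace IsRenewalLaw

variable {b : ℝ⟦X⟧} {x : ℝ}

theorem tail_nonneg (h : IsRenewalLaw b x) (n : ℕ) : 0 ≤ coeff n (tailSeries b) := by
  rw [tailSeries, coeff_mk, sub_nonneg]
  exact sum_le_hasSum _ (fun i _ => h.nonneg i) h.hasSum

/-- Markov's inequality for the exponential moment. -/
theorem tail_mul_pow_le (h : IsRenewalLaw b x) (n : ℕ) :
    coeff n (tailSeries b) * x ^ n ≤ ∑' j, coeff j b * x ^ j := by
  have h1 : coeff n (tailSeries b) = ∑' j, coeff (j + (n + 1)) b := by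
    rw [tailSeries, coeff_mk, ← h.hasSum.tsum_eq, ← h.hasSum.summable.sum_add_tsum_nat_add (n + 1)]
    ring
  have hx0 : 0 ≤ x := zero_le_one.trans h.one_lt.le
  rw [h1, ← tsum_mul_right, ← h.summable.sum_add_tsum_nat_add (n + 1)]
  refine le_trans ?_ (le_add_of_nonneg_left (Finset.sum_nonneg fun i _ =>
    mul_nonneg (h.nonneg i) (pow_nonneg hx0 i)))
  have s1 := (summable_nat_add_iff (n + 1)).2 h.summable
  have hle : ∀ j, coeff (j + (n + 1)) b * x ^ n ≤ coeff (j + (n + 1)) b * x ^ (j + (n + 1)) :=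
    fun j => mul_le_mul_of_nonneg_left (pow_le_pow_right₀ h.one_lt.le (by omega)) (h.nonneg _)
  exact Summable.tsum_le_tsum hle (Summable.of_nonneg_of_le
    (fun j => mul_nonneg (h.nonneg _) (pow_nonneg hx0 n)) hle s1) s1

theorem summable_tail (h : IsRenewalLaw b x) {y : ℝ} (hy : 1 ≤ y) (hyx : y < x) :
    Summable fun n => |coeff n (tailSeries b)| * y ^ n := by
  have hx0 : 0 < x := zero_lt_one.trans h.one_lt
  have hy0 : 0 ≤ y := zero_le_one.trans hy
  refine Summable.of_nonneg_of_le (fun n => by positivity) (fun n => ?_)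
    ((summable_geometric_of_lt_one (div_nonneg hy0 hx0.le) ((div_lt_one hx0).2 hyx)).mul_left
      (∑' j, coeff j b * x ^ j))
  rw [abs_of_nonneg (h.tail_nonneg n), div_pow, ← mul_div_assoc, le_div_iff₀ (by positivity)]
  calc coeff n (tailSeries b) * y ^ n * x ^ n = coeff n (tailSeries b) * x ^ n * y ^ n := by ring
    _ ≤ _ := mul_le_mul_of_nonneg_right (h.tail_mul_pow_le n) (pow_nonneg hy0 n)

theorem summable_abs_tail (h : IsRenewalLaw b x) : Summable fun n => |coeff n (tailSeries b)| := by
  simpa using h.summable_tail le_rfl h.one_lt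

/-- A zero w of (1 - b)/(1 - X) satisfies b(w) = 1. As the weights sum to 1 and |w| ≤ 1, Re w^n = 1
whenever b_n > 0. Since b_1 > 0, this gives w = 1, but at 1 the tail series is at least its constant
term 1. -/
theorem tail_ne_zero (h : IsRenewalLaw b x) (w : ℂ) (hw : ‖w‖ ≤ 1) :
    ∑' n, ((coeff n (tailSeries b) : ℝ) : ℂ) * w ^ n ≠ 0 := by
  intro h0
  have hs : Summable fun n => ((coeff n (tailSeries b) : ℝ) : ℂ) * w ^ n := by
    refine Summable.of_norm_bounded h.summable_abs_tail fun n => ?_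
    rw [norm_mul, norm_pow, Complex.norm_real, Real.norm_eq_abs]
    exact mul_le_of_le_one_right (abs_nonneg _) (pow_le_one₀ (norm_nonneg w) hw)
  have hsb : Summable fun n => ((coeff n b : ℝ) : ℂ) * w ^ n := by
    refine Summable.of_norm_bounded h.hasSum.summable fun n => ?_
    rw [norm_mul, norm_pow, Complex.norm_real, Real.norm_of_nonneg (h.nonneg n)]
    exact mul_le_of_le_one_right (h.nonneg n) (pow_le_one₀ (norm_nonneg w) hw)
  have hb0 : coeff 0 b = 0 := by rw [coeff_zero_eq_constantCoeff_apply, h.zero]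
  have hQ0 : coeff 0 (tailSeries b) = 1 := by simp [tailSeries, h.zero]
  have hB : ∑' n, ((coeff n b : ℝ) : ℂ) * w ^ n = 1 := by
    have e1 := hs.tsum_eq_zero_add
    have e2 := hsb.tsum_eq_zero_add
    rw [h0, hQ0] at e1
    rw [hb0] at e2
    have e3 : ∀ n, ((coeff (n + 1) b : ℝ) : ℂ) * w ^ (n + 1) =
        w * (((coeff n (tailSeries b) : ℝ) : ℂ) * w ^ n) -
          ((coeff (n + 1) (tailSeries b) : ℝ) : ℂ) * w ^ (n + 1) := by
      intro n
      have := congrArg (coeff (n + 1)) (one_sub_X_mul_tailSeries b)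
      rw [coeff_one_sub_X_mul_succ, map_sub, coeff_one, if_neg n.succ_ne_zero] at this
      have : coeff (n + 1) b = coeff n (tailSeries b) - coeff (n + 1) (tailSeries b) := by
        linarith
      rw [this]; push_cast; ring
    rw [e2, tsum_congr e3, (hs.mul_left w).tsum_sub ((summable_nat_add_iff 1).2 hs), tsum_mul_left,
      h0]
    simp only [Complex.ofReal_one, pow_zero, mul_one, Complex.ofReal_zero] at e1 ⊢
    linear_combination e1
  have hre : HasSum (fun n => coeff n b * (w ^ n).re) 1 := by
    have e1 := hsb.hasSum
    rw [hB] at e1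
    have e2 := Complex.hasSum_re e1
    refine e2.congr_fun fun n => ?_
    rw [Complex.re_ofReal_mul]
  have hnn : ∀ n, 0 ≤ coeff n b - coeff n b * (w ^ n).re := fun n => by
    have e1 : (w ^ n).re ≤ 1 := (Complex.re_le_norm _).trans
      (by rw [norm_pow]; exact pow_le_one₀ (norm_nonneg w) hw)
    have := mul_le_mul_of_nonneg_left e1 (h.nonneg n)
    linarith
  have hz := h.hasSum.sub hre
  rw [sub_self, hasSum_zero_iff_of_nonneg hnn] at hz
  have h1 := congrFun hz 1
  simp only [pow_one, Pi.zero_apply] at h1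
  have hw1 : w.re = 1 := by
    have : coeff 1 b * (1 - w.re) = 0 := by linarith
    rcases mul_eq_zero.1 this with h2 | h2
    · exact absurd h2 h.one_pos.ne'
    · linarith
  have hwi : w.im = 0 := by
    have e1 : ‖w‖ ^ 2 ≤ 1 := pow_le_one₀ (norm_nonneg w) hw
    rw [Complex.sq_norm, Complex.normSq_apply, hw1] at e1
    nlinarith [sq_nonneg w.im]
  have hw2 : w = 1 := Complex.ext hw1 hwi
  rw [hw2] at h0
  simp only [one_pow, mul_one] at h0
  rw [← Complex.ofReal_tsum] at h0
  have h3 := h.summable_abs_tail.of_abs.le_tsum 0 fun n _ => h.tail_nonneg n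
  rw [hQ0, Complex.ofReal_eq_zero.1 h0] at h3
  linarith

/-- The differences of the expected numbers of visits decay exponentially. -/
theorem exists_summable (h : IsRenewalLaw b x) :
    ∃ y : ℝ, 1 < y ∧ Summable fun n => |coeff n ((1 - X) * renewalSeries b)| * y ^ n := by
  obtain ⟨y, hy1, hyx⟩ := exists_between h.one_lt
  exact exists_summable_of_mul_eq_one (tailSeries_mul h.zero) hy1 (h.summable_tail hy1.le hyx)
    h.tail_ne_zero

theorem coeff_renewalSeries (h : IsRenewalLaw b x) (n : ℕ) :
    coeff n (renewalSeries b) = ∑ k ∈ Finset.range (n + 1), coeff n (b ^ k) := by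
  rw [renewalSeries, coeff_subst_eq_sum h.zero _ n.lt_succ_self]
  simp

theorem coeff_renewalSeries_pos (h : IsRenewalLaw b x) (n : ℕ) :
    0 < coeff n (renewalSeries b) := by
  have h1 : ∀ n, 0 < coeff n (b ^ n) := by
    intro n
    induction n with
    | zero => simp
    | succ n ih =>
      rw [pow_succ, coeff_mul]
      refine lt_of_lt_of_le (mul_pos ih h.one_pos)
        (Finset.single_le_sum (f := fun p : ℕ × ℕ => coeff p.1 (b ^ n) * coeff p.2 b)
        (fun p _ => mul_nonneg (h.nonneg.pow n _) (h.nonneg _))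
        (a := (n, 1)) (Finset.HasAntidiagonal.mem_antidiagonal.2 rfl))
  rw [h.coeff_renewalSeries]
  exact lt_of_lt_of_le (h1 n) (Finset.single_le_sum (f := fun k => coeff n (b ^ k))
    (fun k _ => h.nonneg.pow k n) (Finset.self_mem_range_succ n))

theorem summable_abs_diff (h : IsRenewalLaw b x) :
    Summable fun n => |coeff n ((1 - X) * renewalSeries b)| := by
  obtain ⟨y, hy1, hy⟩ := h.exists_summable
  exact Summable.of_nonneg_of_le (fun n => abs_nonneg _)
    (fun n => le_mul_of_one_le_right (abs_nonneg _) (one_le_pow₀ hy1.le)) hy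

theorem exists_renewal_le (h : IsRenewalLaw b x) :
    ∃ M : ℝ, 0 < M ∧ ∀ n, coeff n (renewalSeries b) ≤ M := by
  have h0 : 0 ≤ ∑' n, |coeff n ((1 - X) * renewalSeries b)| := tsum_nonneg fun n => abs_nonneg _
  refine ⟨∑' n, |coeff n ((1 - X) * renewalSeries b)| + 1, by positivity, fun n => ?_⟩
  rw [coeff_eq_sum_one_sub_X_mul]
  refine (Finset.sum_le_sum fun j _ => le_abs_self _).trans ?_
  have := h.summable_abs_diff.sum_le_tsum (Finset.range (n + 1)) fun n _ => abs_nonneg _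
  linarith

/-- The renewal theorem: the expected numbers of visits are bounded away from zero. -/
theorem exists_le_renewal (h : IsRenewalLaw b x) :
    ∃ c : ℝ, 0 < c ∧ ∀ n, c ≤ coeff n (renewalSeries b) := by
  set q := (1 - X) * renewalSeries b with hq
  set L := ∑' n, coeff n q
  have ht : Tendsto (fun n => coeff n (renewalSeries b)) atTop (𝓝 L) := by
    have e1 := (h.summable_abs_diff.of_abs.hasSum.tendsto_sum_nat).comp (tendsto_add_atTop_nat 1)
    refine e1.congr fun n => ?_
    rw [coeff_eq_sum_one_sub_X_mul]
    rfl
  have hL0 : 0 ≤ L := ge_of_tendsto' ht fun n => (h.coeff_renewalSeries_pos n).le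
  -- Evaluating `tailSeries_mul` at 1 shows that L times the sum of the tails is 1.
  have hL : L ≠ 0 := by
    intro hL
    have e1 := tsum_mul_tsum_eq_tsum_sum_antidiagonal_of_summable_norm
      (f := fun n => coeff n (tailSeries b)) (g := fun n => coeff n q)
      (by simpa using h.summable_abs_tail) (by simpa using h.summable_abs_diff)
    simp_rw [← coeff_mul] at e1
    rw [hq, tailSeries_mul h.zero, ← hq] at e1
    change _ * L = _ at e1
    rw [hL, mul_zero, tsum_eq_single 0 fun n hn => by rw [coeff_one, if_neg hn], coeff_zero_one]
      at e1
    exact zero_ne_one e1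
  have hLpos : 0 < L := lt_of_le_of_ne hL0 hL.symm
  -- From N on the terms exceed L/2; the finitely many earlier ones are positive.
  obtain ⟨N, hN⟩ := eventually_atTop.1 (ht.eventually_const_lt (half_lt_self hLpos))
  have hne : (Finset.range (N + 1)).Nonempty := ⟨0, by simp⟩
  refine ⟨min (L / 2) ((Finset.range (N + 1)).inf' hne fun n => coeff n (renewalSeries b)),
    lt_min (by positivity) ((Finset.lt_inf'_iff hne).2 fun n _ => h.coeff_renewalSeries_pos n),
    fun n => ?_⟩
  rcases le_total N n with hn | hn
  · exact (min_le_left _ _).trans (hN n hn).le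
  · exact (min_le_right _ _).trans (Finset.inf'_le _ (by simp; omega))

end IsRenewalLaw

end PolyaForest

/-! ### Coefficients of order n^(-3/2) under convolution and composition. -/

namespace PolyaForest

open PowerSeries Filter Topology

/-- The function `(n + 1) ^ (-3 / 2)`. -/
def decay (n : ℕ) : ℝ := 1 / (((n : ℝ) + 1) * √((n : ℝ) + 1))

theorem decay_pos (n : ℕ) : 0 < decay n := by unfold decay; positivity

theorem decay_zero : decay 0 = 1 := by simp [decay]

/-- The natural factor is L^(3/2), rounded up to L^2. -/
theorem decay_le {L k n : ℕ} (hL : 1 ≤ L) (h : n + 1 ≤ L * (k + 1)) :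
    decay k ≤ (L : ℝ) ^ 2 * decay n := by
  have hL' : (1 : ℝ) ≤ L := by exact_mod_cast hL
  have h' : (n : ℝ) + 1 ≤ L * ((k : ℝ) + 1) := by exact_mod_cast h
  have hs : √((n : ℝ) + 1) ≤ L * √((k : ℝ) + 1) := by
    rw [Real.sqrt_le_left (by positivity), mul_pow, Real.sq_sqrt (by positivity)]
    refine h'.trans ?_
    have : (0 : ℝ) ≤ (k : ℝ) + 1 := by positivity
    nlinarith
  unfold decay
  rw [mul_one_div, div_le_div_iff₀ (by positivity) (by positivity), one_mul]
  calc ((n : ℝ) + 1) * √((n : ℝ) + 1) ≤ (L * ((k : ℝ) + 1)) * (L * √((k : ℝ) + 1)) :=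
        mul_le_mul h' hs (by positivity) (by positivity)
    _ = _ := by ring

theorem decay_le_one (n : ℕ) : decay n ≤ 1 := by
  unfold decay
  have h : (1 : ℝ) ≤ (n : ℝ) + 1 := by linarith [Nat.cast_nonneg (α := ℝ) n]
  exact div_le_one_of_le₀ (by nlinarith [Real.one_le_sqrt.2 h]) (by positivity)

theorem decay_succ_le (n : ℕ) : decay (n + 1) ≤ decay n := by
  simpa using decay_le (L := 1) (k := n + 1) (n := n) le_rfl (by omega)

theorem exists_pow_le_mul_pow (p : ℕ) {y : ℝ} (hy : 1 < y) :
    ∃ K : ℝ, 0 < K ∧ ∀ n : ℕ, ((n : ℝ) + 1) ^ p ≤ K * y ^ n := by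
  have hy0 : 0 < y := zero_lt_one.trans hy
  have h1 : |y⁻¹| < 1 := by rw [abs_of_pos (by positivity)]; exact inv_lt_one_of_one_lt₀ hy
  have h2 := (tendsto_pow_const_mul_const_pow_of_abs_lt_one p h1).bddAbove_range
  obtain ⟨K, hK⟩ := h2
  refine ⟨y * (|K| + 1), by positivity, fun n => ?_⟩
  have h3 := hK ⟨n + 1, rfl⟩
  simp only [inv_pow, Nat.cast_add, Nat.cast_one] at h3
  rw [mul_inv_le_iff₀ (by positivity)] at h3
  calc ((n : ℝ) + 1) ^ p ≤ K * y ^ (n + 1) := h3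
    _ ≤ (|K| + 1) * y ^ (n + 1) := by
      refine mul_le_mul_of_nonneg_right ?_ (by positivity)
      linarith [le_abs_self K]
    _ = _ := by ring

theorem exists_mul_pow_le_decay {t : ℝ} (ht : 0 < t) (ht1 : t < 1) :
    ∃ K : ℝ, 0 < K ∧ ∀ n : ℕ, ((n : ℝ) + 1) * t ^ n ≤ K * decay n := by
  obtain ⟨K, hK, h⟩ := exists_pow_le_mul_pow 3 ((one_lt_inv₀ ht).2 ht1)
  refine ⟨K, hK, fun n => ?_⟩
  have h1 := h n
  rw [inv_pow, ← div_eq_mul_inv, le_div_iff₀ (by positivity)] at h1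
  rw [decay, mul_one_div, le_div_iff₀ (by positivity)]
  refine le_trans ?_ h1
  have hn : (1 : ℝ) ≤ (n : ℝ) + 1 := by linarith [Nat.cast_nonneg (α := ℝ) n]
  have hs : √((n : ℝ) + 1) ≤ (n : ℝ) + 1 := by
    rw [Real.sqrt_le_left (by positivity)]
    nlinarith
  calc ((n : ℝ) + 1) * t ^ n * (((n : ℝ) + 1) * √((n : ℝ) + 1))
      ≤ ((n : ℝ) + 1) * t ^ n * (((n : ℝ) + 1) * ((n : ℝ) + 1)) := by gcongr
    _ = _ := by ring

/-- Convolution with an exponentially decaying sequence preserves the order `n ^ (-3 / 2)`. -/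
theorem exists_coeff_mul_le_decay {q J : ℝ⟦X⟧} {y : ℝ} (hy : 1 < y)
    (hq : Summable fun n => |coeff n q| * y ^ n) {C : ℝ}
    (hJ : ∀ n, |coeff n J| ≤ C * decay n) :
    ∃ K : ℝ, ∀ n, |coeff n (q * J)| ≤ K * decay n := by
  obtain ⟨A, hA, hA2⟩ := exists_pow_le_mul_pow 2 hy
  have hC : 0 ≤ C := by
    have := (abs_nonneg _).trans (hJ 0)
    rwa [decay_zero, mul_one] at this
  have hs : Summable fun i : ℕ => |coeff i q| * ((i : ℝ) + 1) ^ 2 := by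
    refine Summable.of_nonneg_of_le (fun i => by positivity) (fun i => ?_) (hq.mul_left A)
    calc |coeff i q| * ((i : ℝ) + 1) ^ 2 ≤ |coeff i q| * (A * y ^ i) :=
          mul_le_mul_of_nonneg_left (hA2 i) (abs_nonneg _)
      _ = _ := by ring
  refine ⟨(∑' i : ℕ, |coeff i q| * ((i : ℝ) + 1) ^ 2) * C, fun n => ?_⟩
  rw [coeff_mul]
  refine (Finset.abs_sum_le_sum_abs _ _).trans ?_
  have h1 : ∀ p ∈ Finset.HasAntidiagonal.antidiagonal n, |coeff p.1 q * coeff p.2 J| ≤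
      |coeff p.1 q| * ((p.1 : ℝ) + 1) ^ 2 * (C * decay n) := by
    intro p hp
    have hp' := Finset.HasAntidiagonal.mem_antidiagonal.1 hp
    -- For i + j = n one has n + 1 ≤ (i + 1)(j + 1); the polynomial loss in i is absorbed by the
    -- exponential decay of q.
    have h2 : decay p.2 ≤ ((p.1 : ℝ) + 1) ^ 2 * decay n := by
      have := decay_le (L := p.1 + 1) (k := p.2) (n := n) (by omega) (by rw [← hp']; nlinarith)
      push_cast at this
      exact this
    rw [abs_mul, mul_assoc]
    refine mul_le_mul_of_nonneg_left ((hJ p.2).trans ?_) (abs_nonneg _)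
    calc C * decay p.2 ≤ C * (((p.1 : ℝ) + 1) ^ 2 * decay n) := mul_le_mul_of_nonneg_left h2 hC
      _ = _ := by ring
  refine (Finset.sum_le_sum h1).trans ?_
  rw [← Finset.sum_mul, mul_assoc]
  refine mul_le_mul_of_nonneg_right ?_ (mul_nonneg hC (decay_pos n).le)
  rw [Finset.Nat.sum_antidiagonal_eq_sum_range_succ
    (fun i _ => |coeff i q| * ((i : ℝ) + 1) ^ 2)]
  exact hs.sum_le_tsum _ fun i _ => by positivity

namespace IsRenewalLaw

variable {b : ℝ⟦X⟧} {x : ℝ}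

theorem coeff_pow_mul_le (h : IsRenewalLaw b x) (n k : ℕ) :
    coeff n (b ^ k) * x ^ n ≤ (∑' j, coeff j b * x ^ j) ^ k := by
  have hx0 : 0 ≤ x := zero_le_one.trans h.one_lt.le
  refine le_trans ?_ ((partialEval_pow_le (N := n) h.nonneg hx0 k).trans
    (pow_le_pow_left₀ (partialEval_nonneg h.nonneg hx0)
      (partialEval_le_tsum h.nonneg hx0 h.summable) k))
  exact Finset.single_le_sum (f := fun i => coeff i (b ^ k) * x ^ i)
    (fun i _ => mul_nonneg (h.nonneg.pow k i) (pow_nonneg hx0 i)) (Finset.self_mem_range_succ n)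

/-- A large deviation argument. A sum of k steps reaches n with exponentially small probability if k
≤ n/L. For larger k the factor `decay k` is comparable to `decay n`, and the probabilities of
reaching n sum to a bounded renewal coefficient. -/
theorem exists_coeff_subst_le_decay (h : IsRenewalLaw b x) {e : ℝ⟦X⟧} {C : ℝ}
    (he : ∀ k, |coeff k e| ≤ C * decay k) :
    ∃ K : ℝ, ∀ n, |coeff n (e.subst b)| ≤ K * decay n := by
  have hC : 0 ≤ C := by
    have := (abs_nonneg _).trans (he 0)
    rwa [decay_zero, mul_one] at this
  have hx0 : 0 < x := zero_lt_one.trans h.one_lt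
  set y := √x with hydef
  have hy1 : 1 < y := Real.lt_sqrt_of_sq_lt (by simpa using h.one_lt)
  have hy0 : 0 < y := zero_lt_one.trans hy1
  have hyx : y ^ 2 = x := Real.sq_sqrt hx0.le
  set β := ∑' j, coeff j b * x ^ j
  have hβ : 0 ≤ β := tsum_nonneg fun j => mul_nonneg (h.nonneg j) (pow_nonneg hx0.le j)
  obtain ⟨L₀, hL₀⟩ := pow_unbounded_of_one_lt (β ^ 2) h.one_lt
  -- With β^2 ≤ x^L and Lk ≤ n one gets β^k ≤ x^(n/2) = y^n, so the bound β^k / x^n is at most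
  -- y^(-n).
  obtain ⟨L, hL1, hL⟩ : ∃ L : ℕ, 1 ≤ L ∧ β ^ 2 ≤ x ^ L :=
    ⟨L₀ + 1, by omega, hL₀.le.trans (pow_le_pow_right₀ h.one_lt.le (by omega))⟩
  obtain ⟨A, hA, hA2⟩ := exists_mul_pow_le_decay (inv_pos.2 hy0) (inv_lt_one_of_one_lt₀ hy1)
  obtain ⟨M, hM, hM2⟩ := h.exists_renewal_le
  have hterm : ∀ n k : ℕ, decay k * coeff n (b ^ k) ≤
      (L : ℝ) ^ 2 * decay n * coeff n (b ^ k) + y⁻¹ ^ n := by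
    intro n k
    have hp := h.nonneg.pow k n
    have hd := decay_pos n
    rcases le_or_gt (L * k) n with hk | hk
    · have h1 : β ^ k ≤ y ^ n := by
        refine (pow_le_pow_iff_left₀ (by positivity) (by positivity) two_ne_zero).1 ?_
        calc (β ^ k) ^ 2 = (β ^ 2) ^ k := by ring
          _ ≤ (x ^ L) ^ k := pow_le_pow_left₀ (by positivity) hL k
          _ = x ^ (L * k) := (pow_mul _ _ _).symm
          _ ≤ x ^ n := pow_le_pow_right₀ h.one_lt.le hk
          _ = (y ^ n) ^ 2 := by rw [← hyx]; ring
      have h2 : coeff n (b ^ k) ≤ y⁻¹ ^ n := by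
        have h3 := (h.coeff_pow_mul_le n k).trans h1
        rw [← hyx, ← pow_mul, mul_comm 2 n, pow_mul, sq, ← mul_assoc] at h3
        rw [inv_pow, ← one_div, le_div_iff₀ (by positivity)]
        exact le_of_mul_le_mul_right (by rwa [one_mul]) (pow_pos hy0 n)
      have h4 : decay k * coeff n (b ^ k) ≤ 1 * y⁻¹ ^ n :=
        mul_le_mul (decay_le_one k) h2 hp zero_le_one
      have h5 : 0 ≤ (L : ℝ) ^ 2 * decay n * coeff n (b ^ k) := by positivity
      linarith
    · have h1 := mul_le_mul_of_nonneg_right (decay_le (n := n) hL1 (k := k) (by nlinarith)) hp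
      have h2 : 0 ≤ y⁻¹ ^ n := by positivity
      linarith
  refine ⟨C * ((L : ℝ) ^ 2 * M + A), fun n => ?_⟩
  rw [coeff_subst_eq_sum h.zero _ n.lt_succ_self]
  refine (Finset.abs_sum_le_sum_abs _ _).trans ?_
  have h1 : ∀ k ∈ Finset.range (n + 1), |coeff k e • coeff n (b ^ k)| ≤
      C * ((L : ℝ) ^ 2 * decay n * coeff n (b ^ k) + y⁻¹ ^ n) := by
    intro k _
    rw [smul_eq_mul, abs_mul, abs_of_nonneg (h.nonneg.pow k n)]
    calc |coeff k e| * coeff n (b ^ k) ≤ C * decay k * coeff n (b ^ k) :=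
          mul_le_mul_of_nonneg_right (he k) (h.nonneg.pow k n)
      _ = C * (decay k * coeff n (b ^ k)) := by ring
      _ ≤ _ := mul_le_mul_of_nonneg_left (hterm n k) hC
  refine (Finset.sum_le_sum h1).trans ?_
  rw [← Finset.mul_sum, Finset.sum_add_distrib, ← Finset.mul_sum, ← h.coeff_renewalSeries,
    Finset.sum_const, Finset.card_range, nsmul_eq_mul]
  refine (mul_le_mul_of_nonneg_left (?_ : _ ≤ ((L : ℝ) ^ 2 * M + A) * decay n) hC).trans_eq
    (mul_assoc _ _ _).symm
  have h2 := mul_le_mul_of_nonneg_left (hM2 n)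
    (mul_nonneg (by positivity : (0 : ℝ) ≤ (L : ℝ) ^ 2) (decay_pos n).le)
  have h3 := hA2 n
  push_cast
  nlinarith

/-- The coefficients of `∑ aₖ b ^ k`, where `aₖ` has order `k ^ (-1 / 2)` and is decreasing with
differences of order `k ^ (-3 / 2)`, behave in the same way. -/
theorem exists_coeff_subst_bounds (h : IsRenewalLaw b x) {a : ℝ⟦X⟧} {c C : ℝ} (hc : 0 < c)
    (hlow : ∀ k : ℕ, c / √((k : ℝ) + 1) ≤ coeff k a) (hanti : Antitone fun k => coeff k a)
    (hdiff : ∀ k, coeff k a - coeff (k + 1) a ≤ C * decay k) :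
    ∃ c' K : ℝ, 0 < c' ∧ (∀ n : ℕ, c' / √((n : ℝ) + 1) ≤ coeff n (a.subst b)) ∧
      ∀ n, |coeff (n + 1) (a.subst b) - coeff n (a.subst b)| ≤ K * decay n := by
  obtain ⟨y, hy1, hy⟩ := h.exists_summable
  obtain ⟨c₁, hc₁, hc₁2⟩ := h.exists_le_renewal
  have ha0 : ∀ k, 0 < coeff k a := fun k => lt_of_lt_of_le (by positivity) (hlow k)
  have hC : 0 ≤ C := by
    have h1 := hdiff 0
    have h2 : coeff 1 a ≤ coeff 0 a := hanti (Nat.zero_le 1)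
    rw [decay_zero, mul_one] at h1
    simp only [zero_add] at h1
    linarith
  -- The 4 is L^2 with L = 2, the cost of the index shift from k to k + 1.
  have he : ∀ k, |coeff k ((1 - X) * a)| ≤ (coeff 0 a + C * 4) * decay k := by
    intro k
    cases k with
    | zero =>
      rw [coeff_one_sub_X_mul_zero, decay_zero, mul_one, abs_of_pos (ha0 0)]
      linarith
    | succ k =>
      have h1 : coeff (k + 1) a ≤ coeff k a := hanti k.le_succ
      rw [coeff_one_sub_X_mul_succ, abs_sub_comm, abs_of_nonneg (sub_nonneg.2 h1)]
      have h2 := decay_le (L := 2) (k := k) (n := k + 1) (by omega) (by omega)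
      have h3 := mul_le_mul_of_nonneg_left h2 hC
      have h4 := mul_nonneg (ha0 0).le (decay_pos (k + 1)).le
      have h5 := hdiff k
      push_cast at h3
      linarith
  obtain ⟨K₁, hK₁⟩ := h.exists_coeff_subst_le_decay he
  obtain ⟨K, hK⟩ := exists_coeff_mul_le_decay hy1 hy hK₁
  refine ⟨c * c₁, K, by positivity, fun n => ?_, fun n => ?_⟩
  -- Only k ≤ n occur and a is decreasing, so a_n can be taken out and a renewal coefficient
  -- remains.
  · rw [coeff_subst_eq_sum h.zero _ n.lt_succ_self]
    calc c * c₁ / √((n : ℝ) + 1) = c / √((n : ℝ) + 1) * c₁ := by ring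
      _ ≤ coeff n a * coeff n (renewalSeries b) :=
        mul_le_mul (hlow n) (hc₁2 n) hc₁.le (ha0 n).le
      _ ≤ _ := by
        rw [h.coeff_renewalSeries, Finset.mul_sum]
        exact Finset.sum_le_sum fun k hk => mul_le_mul_of_nonneg_right
          (hanti (Nat.lt_succ_iff.1 (Finset.mem_range.1 hk))) (h.nonneg.pow k n)
  -- The differences factor as (1 - w)/(1 - b(w)), with exponentially decaying coefficients, times
  -- (1 - b) a(b), with coefficients of order n^(-3/2).
  · have h1 : (1 - X) * renewalSeries b * ((1 - X) * a).subst b = (1 - X) * a.subst b := by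
      rw [← one_sub_mul_subst h.zero]
      calc (1 - X) * renewalSeries b * ((1 - b) * a.subst b)
          = (1 - X) * ((1 - b) * renewalSeries b) * a.subst b := by ring
        _ = _ := by rw [one_sub_mul_renewalSeries h.zero, mul_one]
    have h2 := hK (n + 1)
    rw [h1, coeff_one_sub_X_mul_succ] at h2
    have hK0 : 0 ≤ K := by
      have := (abs_nonneg _).trans (hK 0)
      rwa [decay_zero, mul_one] at this
    exact h2.trans (mul_le_mul_of_nonneg_left (decay_succ_le n) hK0)

end IsRenewalLaw

/-! ### Stirling bounds for the coefficients of C'. -/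

/-- The normalised coefficients `k ^ k / (k! e ^ k)`, indexed from `k = 1`. -/
def stirlingWeight (k : ℕ) : ℝ :=
  ((k + 1 : ℕ) : ℝ) ^ (k + 1) / ((k + 1).factorial : ℝ) * Real.exp (-1) ^ (k + 1)

theorem stirlingWeight_pos (k : ℕ) : 0 < stirlingWeight k := by unfold stirlingWeight; positivity

theorem stirlingWeight_eq (k : ℕ) :
    stirlingWeight k = 1 / (Stirling.stirlingSeq (k + 1) * √(2 * ((k + 1 : ℕ) : ℝ))) := by
  unfold stirlingWeight Stirling.stirlingSeq
  have h1 : (0 : ℝ) < ((k + 1 : ℕ) : ℝ) := by positivity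
  have h2 : (0 : ℝ) < √(2 * ((k + 1 : ℕ) : ℝ)) := by positivity
  rw [Real.exp_neg, inv_pow, div_pow]
  field_simp

/-- Stirling's sequence decreases from its first value e/√2, which gives this bound, and stays above
√π ≥ 1, which gives `stirlingWeight_le`. -/
theorem le_stirlingWeight (k : ℕ) : Real.exp (-1) / √((k : ℝ) + 1) ≤ stirlingWeight k := by
  have h1 : Stirling.stirlingSeq (k + 1) ≤ Real.exp 1 / √2 := by
    rw [← Stirling.stirlingSeq_one]
    exact Stirling.stirlingSeq'_antitone (Nat.zero_le k)
  have h2 := Stirling.stirlingSeq'_pos k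
  rw [stirlingWeight_eq, Real.exp_neg, Real.sqrt_mul (by norm_num), ← one_div, div_div]
  refine one_div_le_one_div_of_le (by positivity) ?_
  calc Stirling.stirlingSeq (k + 1) * (√2 * √((k + 1 : ℕ) : ℝ))
      ≤ Real.exp 1 / √2 * (√2 * √((k + 1 : ℕ) : ℝ)) :=
        mul_le_mul_of_nonneg_right h1 (by positivity)
    _ = Real.exp 1 * √((k : ℝ) + 1) := by
      push_cast
      have : √(2 : ℝ) ≠ 0 := by positivity
      field_simp

theorem stirlingWeight_le (k : ℕ) : stirlingWeight k ≤ 1 / √((k : ℝ) + 1) := by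
  rw [stirlingWeight_eq]
  refine one_div_le_one_div_of_le (by positivity) ?_
  have h1 : 1 ≤ Stirling.stirlingSeq (k + 1) :=
    le_trans (Real.one_le_sqrt.2 (by linarith [Real.pi_gt_three]))
      (Stirling.sqrt_pi_le_stirlingSeq k.succ_ne_zero)
  have h2 : √((k : ℝ) + 1) ≤ √(2 * ((k + 1 : ℕ) : ℝ)) := by
    refine Real.sqrt_le_sqrt ?_
    push_cast
    linarith [Nat.cast_nonneg (α := ℝ) k]
  nlinarith [Real.sqrt_nonneg (2 * ((k + 1 : ℕ) : ℝ))]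

theorem stirlingWeight_succ (k : ℕ) :
    stirlingWeight (k + 1) =
      stirlingWeight k * (1 + 1 / ((k : ℝ) + 1)) ^ (k + 1) * Real.exp (-1) := by
  unfold stirlingWeight
  rw [Nat.factorial_succ (k + 1), one_add_div (by positivity), div_pow]
  push_cast
  have h1 : (0 : ℝ) < (k : ℝ) + 1 := by positivity
  have h2 : ((k : ℝ) + 1 + 1) ≠ 0 := by positivity
  field_simp
  ring

theorem stirlingWeight_antitone : Antitone stirlingWeight := by
  refine antitone_nat_of_succ_le fun k => ?_
  have h1 : (1 + 1 / ((k : ℝ) + 1)) ^ (k + 1) ≤ Real.exp 1 := by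
    have h2 := Real.add_one_le_exp (1 / ((k : ℝ) + 1))
    calc (1 + 1 / ((k : ℝ) + 1)) ^ (k + 1) ≤ Real.exp (1 / ((k : ℝ) + 1)) ^ (k + 1) :=
          pow_le_pow_left₀ (by positivity) (by linarith) _
      _ = Real.exp 1 := by
        rw [← Real.exp_nat_mul]
        congr 1
        push_cast
        field_simp
  rw [stirlingWeight_succ, mul_assoc]
  refine mul_le_of_le_one_right (stirlingWeight_pos k).le ?_
  calc _ ≤ Real.exp 1 * Real.exp (-1) := mul_le_mul_of_nonneg_right h1 (Real.exp_nonneg _)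
    _ = 1 := by rw [← Real.exp_add]; simp

/-- The ratio of consecutive weights is (1 + 1/(k+1))^(k+1) / e ≥ exp(-1/(k+2)) ≥ 1 - 1/(k+1), so
the difference is at most 1/(k+1) times a weight of order (k+1)^(-1/2). -/
theorem stirlingWeight_sub_le (k : ℕ) :
    stirlingWeight k - stirlingWeight (k + 1) ≤ 1 * decay k := by
  have h0 : (0 : ℝ) < (k : ℝ) + 1 := by positivity
  have h1 : Real.exp (1 - 1 / ((k : ℝ) + 2)) ≤ (1 + 1 / ((k : ℝ) + 1)) ^ (k + 1) := by
    have h2 := Real.add_one_le_exp (-(1 / ((k : ℝ) + 2)))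
    have h3 : Real.exp (1 / ((k : ℝ) + 2)) ≤ 1 + 1 / ((k : ℝ) + 1) := by
      rw [Real.exp_neg] at h2
      have h4 : -(1 / ((k : ℝ) + 2)) + 1 = (1 + 1 / ((k : ℝ) + 1))⁻¹ := by
        field_simp; ring
      rw [h4] at h2
      exact (inv_le_inv₀ (by positivity) (Real.exp_pos _)).1 h2
    calc Real.exp (1 - 1 / ((k : ℝ) + 2)) = Real.exp (1 / ((k : ℝ) + 2)) ^ (k + 1) := by
          rw [← Real.exp_nat_mul]
          congr 1
          push_cast
          field_simp
          ring
      _ ≤ _ := pow_le_pow_left₀ (Real.exp_nonneg _) h3 _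
  have h5 : 1 - 1 / ((k : ℝ) + 1) ≤ (1 + 1 / ((k : ℝ) + 1)) ^ (k + 1) * Real.exp (-1) := by
    refine le_trans ?_ (mul_le_mul_of_nonneg_right h1 (Real.exp_nonneg _))
    rw [← Real.exp_add]
    have h6 := Real.add_one_le_exp (1 - 1 / ((k : ℝ) + 2) + -1)
    have h7 : 1 / ((k : ℝ) + 2) ≤ 1 / ((k : ℝ) + 1) :=
      one_div_le_one_div_of_le h0 (by linarith)
    linarith
  rw [stirlingWeight_succ, mul_assoc]
  have h8 := mul_le_mul_of_nonneg_left h5 (stirlingWeight_pos k).le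
  have h9 : stirlingWeight k * (1 / ((k : ℝ) + 1)) ≤ decay k := by
    calc _ ≤ 1 / √((k : ℝ) + 1) * (1 / ((k : ℝ) + 1)) :=
          mul_le_mul_of_nonneg_right (stirlingWeight_le k) (by positivity)
      _ = decay k := by unfold decay; field_simp
  linarith

end PolyaForest

/-! ### The renewal law of the forest sizes and the ratio of weights. -/

namespace PolyaForest

open PowerSeries Filter Topology

/-- The distribution with generating function `e ρ w D(ρ w)`. -/
def forestLaw : ℝ⟦X⟧ := C (Real.exp 1) * rescale rho (X * seriesD)

theorem coeff_forestLaw_pow (n k : ℕ) :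
    coeff n (forestLaw ^ k) = Real.exp 1 ^ k * (rho ^ n * coeff n ((X * seriesD) ^ k)) := by
  rw [forestLaw, mul_pow, ← map_pow, ← map_pow, coeff_C_mul, coeff_rescale]

theorem coeff_forestLaw_succ (n : ℕ) :
    coeff (n + 1) forestLaw = Real.exp 1 * rho * (d n * rho ^ n) := by
  have := coeff_forestLaw_pow (n + 1) 1
  rw [pow_one, pow_one, pow_one, coeff_succ_X_mul] at this
  rw [this, d]
  ring

theorem coeff_forestLaw_zero : coeff 0 forestLaw = 0 := by
  have := coeff_forestLaw_pow 0 1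
  rw [pow_one, pow_one, pow_one, coeff_zero_X_mul] at this
  rw [this]
  ring

/-- The total mass is e ρ D(ρ) = 1, and the exponential moment x = t/ρ with ρ < t < √ρ exists
because D converges beyond ρ. -/
theorem exists_isRenewalLaw : ∃ x, IsRenewalLaw forestLaw x := by
  obtain ⟨t, ht1, ht2⟩ := exists_between rho_lt_sqrt
  have hρ := rho_pos
  refine ⟨t / rho, fun n => ?_, ?_, ?_, ?_, ?_, ?_⟩
  · cases n with
    | zero => rw [coeff_forestLaw_zero]
    | succ n =>
      rw [coeff_forestLaw_succ]
      exact mul_nonneg (by positivity) (mul_nonneg (d_nonneg n) (by positivity))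
  · rw [← coeff_zero_eq_constantCoeff_apply, coeff_forestLaw_zero]
  · rw [coeff_forestLaw_succ 0, d_zero]
    positivity
  · rwa [one_lt_div hρ]
  · refine (summable_nat_add_iff 1).1 (((summable_d_mul_pow (hρ.le.trans ht1.le) ht2).mul_left
      (Real.exp 1 * t)).congr fun n => ?_)
    rw [coeff_forestLaw_succ, div_pow, pow_succ rho, pow_succ t]
    field_simp
  · have h1 := ((summable_d_mul_pow hρ.le rho_lt_sqrt).hasSum.mul_left (Real.exp 1 * rho))
    rw [mul_assoc, rho_mul_tsum, ← Real.exp_add, add_neg_cancel, Real.exp_zero] at h1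
    rw [← hasSum_nat_add_iff' 1, Finset.sum_range_one, coeff_forestLaw_zero, sub_zero]
    exact h1.congr_fun fun n => coeff_forestLaw_succ n

/-- The coefficients of `C'(z D(z))`, normalised by the radius of convergence. -/
def scaledDeriv (n : ℕ) : ℝ := coeffDerivC n * rho ^ n

theorem scaledDeriv_eq (n : ℕ) :
    scaledDeriv n = Real.exp 1 * coeff n ((mk stirlingWeight).subst forestLaw) := by
  obtain ⟨x, hx⟩ := exists_isRenewalLaw
  rw [coeff_subst_eq_sum hx.zero _ n.lt_succ_self, scaledDeriv, coeffDerivC, Finset.sum_mul,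
    Finset.mul_sum]
  refine Finset.sum_congr rfl fun k _ => ?_
  have h : Real.exp (-1) ^ (k + 1) * Real.exp 1 ^ k * Real.exp 1 = 1 := by
    rw [mul_assoc, ← pow_succ, ← mul_pow, ← Real.exp_add]
    simp
  rw [coeff_forestLaw_pow, coeff_mk, stirlingWeight, smul_eq_mul]
  linear_combination (-(((k + 1 : ℕ) : ℝ) ^ (k + 1) / ((k + 1).factorial : ℝ) *
    coeff n ((X * seriesD) ^ k) * rho ^ n)) * h

theorem exists_scaledDeriv_bounds :
    ∃ c K : ℝ, 0 < c ∧ 0 ≤ K ∧ (∀ n : ℕ, c / √((n : ℝ) + 1) ≤ scaledDeriv n) ∧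
      ∀ n, |scaledDeriv (n + 1) - scaledDeriv n| ≤ K * decay n := by
  obtain ⟨x, hx⟩ := exists_isRenewalLaw
  obtain ⟨c, K, hc, h1, h2⟩ := hx.exists_coeff_subst_bounds (a := mk stirlingWeight)
    (Real.exp_pos (-1)) (fun k => by rw [coeff_mk]; exact le_stirlingWeight k)
    (by simpa using stirlingWeight_antitone)
    (fun k => by rw [coeff_mk, coeff_mk]; exact stirlingWeight_sub_le k)
  have hK : 0 ≤ K := by
    have := (abs_nonneg _).trans (h2 0)
    rwa [decay_zero, mul_one] at this
  refine ⟨Real.exp 1 * c, Real.exp 1 * K, by positivity, by positivity, fun n => ?_, fun n => ?_⟩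
  · rw [scaledDeriv_eq, mul_div_assoc]
    exact mul_le_mul_of_nonneg_left (h1 n) (Real.exp_nonneg _)
  · rw [scaledDeriv_eq, scaledDeriv_eq, ← mul_sub, abs_mul, abs_of_pos (Real.exp_pos 1), mul_assoc]
    exact mul_le_mul_of_nonneg_left (h2 n) (Real.exp_nonneg _)

theorem scaledDeriv_pos (n : ℕ) : 0 < scaledDeriv n := by
  obtain ⟨c, K, hc, _, h, _⟩ := exists_scaledDeriv_bounds
  exact lt_of_lt_of_le (by positivity) (h n)

/-- Telescoping over m steps, each costing at most `decay (n - m)`, which is bounded by a polynomial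
in m times `decay n`. -/
theorem abs_scaledDeriv_sub_le {K : ℝ} (hK : 0 ≤ K)
    (h : ∀ n, |scaledDeriv (n + 1) - scaledDeriv n| ≤ K * decay n) (n m : ℕ) (hm : m ≤ n) :
    |scaledDeriv (n - m) - scaledDeriv n| ≤ m * ((m : ℝ) + 1) ^ 2 * (K * decay n) := by
  have hd := decay_pos n
  induction m with
  | zero => simp
  | succ m ih =>
    have h1 := ih (by omega)
    have h2 := h (n - (m + 1))
    rw [show n - (m + 1) + 1 = n - m by omega, abs_sub_comm] at h2
    have h3 : decay (n - (m + 1)) ≤ ((m : ℝ) + 2) ^ 2 * decay n := by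
      have := decay_le (L := m + 2) (k := n - (m + 1)) (n := n) (by omega) (by
        obtain ⟨j, rfl⟩ : ∃ j, n = j + (m + 1) := ⟨n - (m + 1), by omega⟩
        rw [Nat.add_sub_cancel]
        nlinarith)
      push_cast at this
      exact this
    have h4 := mul_le_mul_of_nonneg_left h3 hK
    have h5 := abs_sub_le (scaledDeriv (n - (m + 1))) (scaledDeriv (n - m)) (scaledDeriv n)
    have h6 : (m : ℝ) * ((m : ℝ) + 1) ^ 2 * (K * decay n) ≤
        m * ((m : ℝ) + 2) ^ 2 * (K * decay n) := by
      gcongr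
      norm_num
    push_cast
    calc _ ≤ (m : ℝ) * ((m : ℝ) + 2) ^ 2 * (K * decay n) +
          K * (((m : ℝ) + 2) ^ 2 * decay n) := by linarith
      _ = _ := by ring

/-- The factor by which the weight of a forest of size `m` differs from its limit. -/
def forestRatio (n m : ℕ) : ℝ :=
  if m < n then scaledDeriv (n - 1 - m) / scaledDeriv (n - 1) else 0

theorem forestRatio_nonneg (n m : ℕ) : 0 ≤ forestRatio n m := by
  unfold forestRatio
  split_ifs
  · exact (div_pos (scaledDeriv_pos _) (scaledDeriv_pos _)).le
  · exact le_rfl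

/-- Differences of order n^(-3/2) against a lower bound of order n^(-1/2) leave a relative error of
order 1/n. For m ≥ n the ratio is 0 and the bound holds since m + 1 ≥ n. -/
theorem exists_abs_forestRatio_sub_one_le :
    ∃ K : ℝ, 0 ≤ K ∧ ∀ n m : ℕ, 1 ≤ n → |forestRatio n m - 1| ≤ K * ((m : ℝ) + 1) ^ 3 / n := by
  obtain ⟨c, K, hc, hK, hlow, hdiff⟩ := exists_scaledDeriv_bounds
  refine ⟨K / c + 1, by positivity, fun n m hn => ?_⟩
  have hn' : (0 : ℝ) < n := by exact_mod_cast hn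
  unfold forestRatio
  split_ifs with hm
  · have h1 := abs_scaledDeriv_sub_le hK hdiff (n - 1) m (by omega)
    have h2 := hlow (n - 1)
    have h3 : ((n - 1 : ℕ) : ℝ) + 1 = n := by
      rw [Nat.cast_sub hn]; simp
    have hg := scaledDeriv_pos (n - 1)
    have h4 : decay (n - 1) ≤ scaledDeriv (n - 1) / (c * n) := by
      rw [le_div_iff₀ (by positivity)]
      refine le_trans (le_of_eq ?_) h2
      unfold decay
      rw [h3]
      field_simp
    have h5 := mul_nonneg hK (decay_pos (n - 1)).le
    rw [div_sub_one hg.ne', abs_div, abs_of_pos hg, div_le_div_iff₀ hg hn']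
    calc |scaledDeriv (n - 1 - m) - scaledDeriv (n - 1)| * n
        ≤ ((m : ℝ) + 1) * ((m : ℝ) + 1) ^ 2 * (K * (scaledDeriv (n - 1) / (c * n))) * n := by
          refine mul_le_mul_of_nonneg_right (h1.trans ?_) hn'.le
          gcongr
          all_goals linarith
      _ = K / c * ((m : ℝ) + 1) ^ 3 * scaledDeriv (n - 1) := by field_simp
      _ ≤ _ := by
        gcongr
        linarith
  · rw [zero_sub, abs_neg, abs_one, le_div_iff₀ hn', one_mul]
    have h1 : (n : ℝ) ≤ (m : ℝ) + 1 := by exact_mod_cast (by omega : n ≤ m + 1)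
    have h2 : (m : ℝ) + 1 ≤ ((m : ℝ) + 1) ^ 3 :=
      le_self_pow₀ (by linarith [Nat.cast_nonneg (α := ℝ) m]) (by norm_num)
    have h3 : 0 ≤ K / c := by positivity
    nlinarith

/-- The last factor does not depend on m and cancels in the probabilities. -/
theorem forestWeight_eq_mul_forestRatio {n : ℕ} (hn : 1 ≤ n) (m : ℕ) :
    forestWeight n m =
      d m * rho ^ m * forestRatio n m * (scaledDeriv (n - 1) / rho ^ (n - 1)) := by
  rw [forestWeight_eq, forestRatio]
  split_ifs with hm
  · have hg := (scaledDeriv_pos (n - 1)).ne'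
    have hρ := rho_pos.ne'
    have h : rho ^ (n - 1) = rho ^ (n - 1 - m) * rho ^ m := by
      rw [← pow_add]; congr 1; omega
    rw [mul_assoc, div_mul_div_comm, mul_comm (scaledDeriv (n - 1 - m)),
      mul_div_mul_left _ _ hg, scaledDeriv, h]
    field_simp
  · ring

/-- The normalised generating function of the weights of the attached forests. -/
def forestSum (n : ℕ) (u : ℂ) : ℂ :=
  ∑ m ∈ Finset.range n, ((d m * rho ^ m * forestRatio n m : ℝ) : ℂ) * u ^ m

/-- The total normalised weight of the attached forests. -/
def forestTotal (n : ℕ) : ℝ := ∑ m ∈ Finset.range n, d m * rho ^ m * forestRatio n m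

theorem one_le_forestTotal {n : ℕ} (hn : 1 ≤ n) : 1 ≤ forestTotal n := by
  have h := Finset.single_le_sum (f := fun m => d m * rho ^ m * forestRatio n m)
    (fun m _ => mul_nonneg (mul_nonneg (d_nonneg m) (pow_nonneg rho_pos.le m))
      (forestRatio_nonneg n m)) (Finset.mem_range.2 (by omega : 0 < n))
  have h0 : d 0 * rho ^ 0 * forestRatio n 0 = 1 := by
    rw [forestRatio, if_pos (by omega), d_zero, Nat.sub_zero, div_self (scaledDeriv_pos _).ne']
    norm_num
  rwa [h0] at h

theorem ofReal_forestTotal (n : ℕ) : (forestTotal n : ℂ) = forestSum n 1 := by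
  rw [forestTotal, forestSum, Complex.ofReal_sum]
  simp

theorem forestProb_eq {n : ℕ} (hn : 1 ≤ n) (m : ℕ) :
    forestProb n m = d m * rho ^ m * forestRatio n m / forestTotal n := by
  have h0 : scaledDeriv (n - 1) / rho ^ (n - 1) ≠ 0 :=
    (div_pos (scaledDeriv_pos _) (pow_pos rho_pos _)).ne'
  have h : cNodeWeight n = forestTotal n * (scaledDeriv (n - 1) / rho ^ (n - 1)) := by
    rw [cNodeWeight_eq, forestTotal, Finset.sum_mul]
    refine Finset.sum_congr rfl fun m hm => ?_
    rw [← forestWeight_eq_mul_forestRatio hn, forestWeight_eq, if_pos (Finset.mem_range.1 hm)]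
  rw [forestProb, h, forestWeight_eq_mul_forestRatio hn, mul_div_mul_right _ _ h0]

theorem forestPGF_eq {n : ℕ} (hn : 1 ≤ n) (u : ℂ) :
    forestPGF n u = forestSum n u / forestTotal n := by
  rw [forestPGF, forestSum, Finset.sum_div]
  refine Finset.sum_congr rfl fun m _ => ?_
  rw [forestProb_eq hn, Complex.ofReal_div]
  ring

theorem evalD_real (x : ℝ) : evalD x = ∑' n, d n * x ^ n := rfl

theorem evalD_complex (z : ℂ) : evalD z = ∑' n, ((d n : ℝ) : ℂ) * z ^ n := rfl

theorem evalD_ofReal (x : ℝ) : evalD (x : ℂ) = ((evalD x : ℝ) : ℂ) := by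
  rw [evalD_real, evalD_complex, Complex.ofReal_tsum]
  push_cast
  rfl

/-- The constant is a multiple of ∑ d_m (ρr)^m (m+1)^3, which converges because ρr < √ρ leaves room
for the polynomial. -/
theorem exists_norm_forestSum_sub_le {r : ℝ} (hr : 0 ≤ r) (hr2 : r < 1 / √rho) :
    ∃ K : ℝ, 0 ≤ K ∧ ∀ n : ℕ, 1 ≤ n → ∀ u : ℂ, ‖u‖ ≤ r →
      ‖forestSum n u - evalD ((rho : ℂ) * u)‖ ≤ K / n := by
  obtain ⟨K, hK, hK2⟩ := exists_abs_forestRatio_sub_one_le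
  have hρ := rho_pos
  have ht : rho * r < √rho := by
    rw [lt_div_iff₀ (Real.sqrt_pos.2 hρ)] at hr2
    have h1 := Real.mul_self_sqrt hρ.le
    have h2 : 0 < √rho := Real.sqrt_pos.2 hρ
    nlinarith
  obtain ⟨s, hs1, hs2⟩ := exists_between ht
  have ht0 : 0 ≤ rho * r := by positivity
  have hs0 : 0 < s := ht0.trans_lt hs1
  have hsum : Summable fun m : ℕ => d m * (rho * r) ^ m * ((m : ℝ) + 1) ^ 3 := by
    rcases ht0.eq_or_lt with h0 | h0
    · refine summable_of_ne_finset_zero (s := {0}) fun m hm => ?_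
      rw [← h0, zero_pow (by simpa using hm)]
      ring
    · obtain ⟨A, hA, hA2⟩ := exists_pow_le_mul_pow 3 ((one_lt_div h0).2 hs1)
      refine Summable.of_nonneg_of_le (fun m => mul_nonneg (mul_nonneg (d_nonneg m) (by positivity))
        (by positivity)) (fun m => ?_) ((summable_d_mul_pow hs0.le hs2).mul_left A)
      have h1 := hA2 m
      rw [div_pow, ← mul_div_assoc, le_div_iff₀ (by positivity)] at h1
      have h2 := mul_le_mul_of_nonneg_left h1 (d_nonneg m)
      linarith
  refine ⟨K * ∑' m : ℕ, d m * (rho * r) ^ m * ((m : ℝ) + 1) ^ 3, mul_nonneg hK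
    (tsum_nonneg fun m => mul_nonneg (mul_nonneg (d_nonneg m) (by positivity)) (by positivity)),
    fun n hn u hu => ?_⟩
  have hru : ‖(rho : ℂ) * u‖ ≤ rho * r := by
    rw [norm_mul, Complex.norm_real, Real.norm_of_nonneg hρ.le]
    exact mul_le_mul_of_nonneg_left hu hρ.le
  have hD := (summable_d_mul_pow_complex (hru.trans_lt ht)).hasSum
  rw [← evalD_complex] at hD
  -- As the ratio vanishes for m ≥ n, the finite sum is an infinite one, and the tail of D needs no
  -- separate estimate.
  have hA : HasSum (fun m => ((d m * rho ^ m * forestRatio n m : ℝ) : ℂ) * u ^ m)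
      (forestSum n u) := hasSum_sum_of_ne_finset_zero fun m hm => by
    rw [forestRatio, if_neg (by simpa using hm)]
    simp
  have hsub := hA.sub hD
  rw [← hsub.tsum_eq]
  have hs3 := hsum.mul_left (K / n)
  refine (tsum_of_norm_bounded hs3.hasSum fun m => ?_).trans (le_of_eq ?_)
  · have e1 : ((d m * rho ^ m * forestRatio n m : ℝ) : ℂ) * u ^ m -
        ((d m : ℝ) : ℂ) * ((rho : ℂ) * u) ^ m =
        ((d m : ℝ) : ℂ) * ((rho : ℂ) * u) ^ m * ((forestRatio n m - 1 : ℝ) : ℂ) := by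
      push_cast
      ring
    rw [e1, norm_mul, norm_mul, norm_pow, Complex.norm_real, Complex.norm_real,
      Real.norm_of_nonneg (d_nonneg m), Real.norm_eq_abs]
    calc d m * ‖(rho : ℂ) * u‖ ^ m * |forestRatio n m - 1|
        ≤ d m * (rho * r) ^ m * (K * ((m : ℝ) + 1) ^ 3 / n) := by
          have := d_nonneg m
          gcongr
          exact hK2 n m hn
      _ = _ := by ring
  · rw [tsum_mul_left]
    ring

/-! ### A lower bound for |D|, and the two asymptotic statements. -/

/-- The reciprocal of `D`. -/
def seriesDInv : ℝ⟦X⟧ := (exp ℝ).subst (-seriesS)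

/-- The expansions of exp(-S) and exp(S) differ only in signs, and S has nonnegative coefficients.
-/
theorem abs_coeff_seriesDInv_le (n : ℕ) : |coeff n seriesDInv| ≤ d n := by
  have h0 : constantCoeff (-seriesS) = 0 := by rw [map_neg, constantCoeff_seriesS, neg_zero]
  have hd : d n = ∑ k ∈ Finset.range (n + 1), coeff k (exp ℝ) • coeff n (seriesS ^ k) := by
    rw [d, seriesD, coeff_subst_eq_sum constantCoeff_seriesS _ n.lt_succ_self]
  rw [seriesDInv, coeff_subst_eq_sum h0 _ n.lt_succ_self, hd]
  refine (Finset.abs_sum_le_sum_abs _ _).trans (Finset.sum_le_sum fun k _ => ?_)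
  rw [smul_eq_mul, smul_eq_mul, abs_mul, abs_of_nonneg (nonnegCoeff_exp k), neg_pow]
  refine mul_le_mul_of_nonneg_left (le_of_eq ?_) (nonnegCoeff_exp k)
  rcases neg_one_pow_eq_or ℝ⟦X⟧ k with h | h <;>
    simp [h, abs_of_nonneg (nonnegCoeff_seriesS.pow k n)]

theorem seriesD_mul_seriesDInv : seriesD * seriesDInv = 1 :=
  exp_subst_mul_exp_subst_neg constantCoeff_seriesS

/-- This is |1/D(z)| ≤ D(t), a bound uniform in |z| ≤ t that turns additive errors into relative
ones and excludes zeros of D. -/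
theorem one_le_norm_evalD_mul {t : ℝ} (ht : 0 ≤ t) (ht2 : t < √rho) {z : ℂ} (hz : ‖z‖ ≤ t) :
    1 ≤ ‖evalD z‖ * ∑' n, d n * t ^ n := by
  have hs := summable_d_mul_pow ht ht2
  have h1 : ∀ n, ‖((d n : ℝ) : ℂ) * z ^ n‖ ≤ d n * t ^ n := fun n => by
    rw [norm_mul, norm_pow, Complex.norm_real, Real.norm_of_nonneg (d_nonneg n)]
    exact mul_le_mul_of_nonneg_left (pow_le_pow_left₀ (norm_nonneg z) hz n) (d_nonneg n)
  have h2 : ∀ n, ‖((coeff n seriesDInv : ℝ) : ℂ) * z ^ n‖ ≤ d n * t ^ n := fun n => by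
    rw [norm_mul, norm_pow, Complex.norm_real, Real.norm_eq_abs]
    exact mul_le_mul (abs_coeff_seriesDInv_le n) (pow_le_pow_left₀ (norm_nonneg z) hz n)
      (by positivity) (d_nonneg n)
  have h3 := tsum_mul_tsum_eq_tsum_sum_antidiagonal_of_summable_norm
    (Summable.of_nonneg_of_le (fun n => norm_nonneg _) h1 hs)
    (Summable.of_nonneg_of_le (fun n => norm_nonneg _) h2 hs)
  have h4 : ∀ n, ∑ p ∈ Finset.HasAntidiagonal.antidiagonal n,
      ((d p.1 : ℝ) : ℂ) * z ^ p.1 * (((coeff p.2 seriesDInv : ℝ) : ℂ) * z ^ p.2) =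
      if n = 0 then 1 else 0 := by
    intro n
    have e1 := congrArg (fun f => ((coeff n f : ℝ) : ℂ) * z ^ n) seriesD_mul_seriesDInv
    simp only [coeff_mul, coeff_one] at e1
    rw [Complex.ofReal_sum, Finset.sum_mul] at e1
    have e2 : (((if n = 0 then 1 else 0 : ℝ)) : ℂ) * z ^ n = if n = 0 then 1 else 0 := by
      split_ifs with h
      · simp [h]
      · simp
    rw [← e2, ← e1]
    refine Finset.sum_congr rfl fun p hp => ?_
    rw [← Finset.HasAntidiagonal.mem_antidiagonal.1 hp, pow_add, d]
    push_cast
    ring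
  rw [tsum_congr h4, tsum_ite_eq, ← evalD_complex] at h3
  have h5 := congrArg norm h3
  rw [norm_mul, norm_one] at h5
  rw [← h5]
  exact mul_le_mul_of_nonneg_left (tsum_of_norm_bounded hs.hasSum h2) (norm_nonneg _)

theorem evalD_rho_pos : 0 < evalD rho := by
  rw [evalD_real]
  have h1 := rho_mul_tsum
  have h2 := Real.exp_pos (-1)
  rw [← h1] at h2
  exact pos_of_mul_pos_right h2 rho_pos.le

theorem one_lt_one_div_sqrt_rho : 1 < 1 / √rho := by
  rw [one_lt_div (Real.sqrt_pos.2 rho_pos), Real.sqrt_lt' one_pos, one_pow]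
  exact rho_lt_one

theorem exists_abs_evalD_div_forestTotal_sub_one_le :
    ∃ K : ℝ, 0 ≤ K ∧ ∀ n : ℕ, 1 ≤ n → |evalD rho / forestTotal n - 1| ≤ K / n := by
  obtain ⟨K, hK, h⟩ := exists_norm_forestSum_sub_le zero_le_one one_lt_one_div_sqrt_rho
  refine ⟨K, hK, fun n hn => ?_⟩
  have h1 := h n hn 1 (by simp)
  rw [mul_one, ← ofReal_forestTotal, evalD_ofReal, ← Complex.ofReal_sub, Complex.norm_real,
    Real.norm_eq_abs, abs_sub_comm] at h1
  have h2 := one_le_forestTotal hn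
  have h3 : 0 < forestTotal n := by linarith
  rw [div_sub_one h3.ne', abs_div, abs_of_pos h3]
  exact (div_le_self (abs_nonneg _) h2).trans h1

theorem forestProb_asymptotics (m : ℕ) : ∃ ε : ℕ → ℝ,
    ε =O[atTop] (fun n : ℕ => (1 : ℝ) / (n : ℝ)) ∧
    ∀ n : ℕ, 1 ≤ n → forestProb n m = d m * rho ^ m / evalD rho * (1 + ε n) := by
  obtain ⟨K₁, hK₁, h₁⟩ := exists_abs_forestRatio_sub_one_le
  obtain ⟨K₂, hK₂, h₂⟩ := exists_abs_evalD_div_forestTotal_sub_one_le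
  refine ⟨fun n => forestRatio n m * (evalD rho / forestTotal n) - 1, ?_, fun n hn => ?_⟩
  · refine Asymptotics.IsBigO.of_bound (K₁ * ((m : ℝ) + 1) ^ 3 * (1 + K₂) + K₂) ?_
    filter_upwards [eventually_ge_atTop 1] with n hn
    have hn' : (1 : ℝ) ≤ n := by exact_mod_cast hn
    have e1 := h₁ n m hn
    have e2 := h₂ n hn
    set α := forestRatio n m
    set β := evalD rho / forestTotal n
    have e3 : |β| ≤ 1 + K₂ := by
      have := abs_sub_abs_le_abs_sub β 1
      have h4 : K₂ / n ≤ K₂ := div_le_self hK₂ hn'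
      rw [abs_one] at this
      linarith
    rw [Real.norm_eq_abs, Real.norm_of_nonneg (by positivity)]
    calc |α * β - 1| = |(α - 1) * β + (β - 1)| := by ring_nf
      _ ≤ |α - 1| * |β| + |β - 1| := (abs_add_le _ _).trans_eq (by rw [abs_mul])
      _ ≤ K₁ * ((m : ℝ) + 1) ^ 3 / n * (1 + K₂) + K₂ / n :=
        add_le_add (mul_le_mul e1 e3 (abs_nonneg _) (by positivity)) e2
      _ = _ := by ring
  · rw [forestProb_eq hn]
    have h3 := evalD_rho_pos.ne'
    have h4 : forestTotal n ≠ 0 := by linarith [one_le_forestTotal hn]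
    field_simp
    ring

theorem forestPGF_asymptotics (r : ℝ) (hr : r < 1 / √rho) :
    ∃ K : ℝ, ∀ n : ℕ, 1 ≤ n → ∀ u : ℂ, ‖u‖ ≤ r → ∃ ε : ℂ, ‖ε‖ ≤ K / (n : ℝ) ∧
      forestPGF n u = evalD ((rho : ℂ) * u) / evalD (rho : ℂ) * (1 + ε) := by
  rcases lt_or_ge r 0 with hr0 | hr0
  · exact ⟨0, fun n _ u hu => absurd ((norm_nonneg u).trans hu) (not_le.2 hr0)⟩
  obtain ⟨K₁, hK₁, h₁⟩ := exists_norm_forestSum_sub_le hr0 hr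
  obtain ⟨K₂, hK₂, h₂⟩ := exists_abs_evalD_div_forestTotal_sub_one_le
  have hρ := rho_pos
  have ht : rho * r < √rho := by
    rw [lt_div_iff₀ (Real.sqrt_pos.2 hρ)] at hr
    have h1 := Real.mul_self_sqrt hρ.le
    have h2 : 0 < √rho := Real.sqrt_pos.2 hρ
    nlinarith
  set M := ∑' n, d n * (rho * r) ^ n
  have hM : 0 ≤ M := tsum_nonneg fun n => mul_nonneg (d_nonneg n) (by positivity)
  refine ⟨K₁ * M * (1 + K₂) + K₂, fun n hn u hu => ?_⟩
  have hn' : (1 : ℝ) ≤ n := by exact_mod_cast hn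
  have hru : ‖(rho : ℂ) * u‖ ≤ rho * r := by
    rw [norm_mul, Complex.norm_real, Real.norm_of_nonneg hρ.le]
    exact mul_le_mul_of_nonneg_left hu hρ.le
  have hDM := one_le_norm_evalD_mul (by positivity) ht hru
  have hD0 : evalD ((rho : ℂ) * u) ≠ 0 := by
    intro h0
    rw [h0, norm_zero, zero_mul] at hDM
    linarith
  have hDn := norm_pos_iff.2 hD0
  have hDρ : (evalD (rho : ℂ)) ≠ 0 := by
    rw [evalD_ofReal]
    exact_mod_cast evalD_rho_pos.ne'
  have hF : (forestTotal n : ℂ) ≠ 0 := by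
    have : forestTotal n ≠ 0 := by linarith [one_le_forestTotal hn]
    exact_mod_cast this
  -- The error combines the relative errors of the numerator at u and of the normalisation, which is
  -- the same sum at u = 1.
  refine ⟨forestSum n u / evalD ((rho : ℂ) * u) * (evalD (rho : ℂ) / forestTotal n) - 1, ?_, ?_⟩
  · have e1 : ‖forestSum n u / evalD ((rho : ℂ) * u) - 1‖ ≤ K₁ * M / n := by
      rw [div_sub_one hD0, norm_div, div_le_iff₀ hDn]
      refine (h₁ n hn u hu).trans ?_
      have e2 := mul_le_mul_of_nonneg_left hDM (div_nonneg hK₁ (zero_le_one.trans hn'))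
      rw [mul_one] at e2
      refine e2.trans_eq (by ring)
    have e2 : ‖evalD (rho : ℂ) / forestTotal n - 1‖ ≤ K₂ / n := by
      have := h₂ n hn
      rwa [← Real.norm_eq_abs, ← Complex.norm_real, Complex.ofReal_sub, Complex.ofReal_div,
        ← evalD_ofReal, Complex.ofReal_one] at this
    set α := forestSum n u / evalD ((rho : ℂ) * u)
    set β := evalD (rho : ℂ) / (forestTotal n : ℂ)
    have e3 : ‖β‖ ≤ 1 + K₂ := by
      have := norm_sub_norm_le β 1
      have h4 : K₂ / n ≤ K₂ := div_le_self hK₂ hn'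
      rw [norm_one] at this
      linarith
    calc ‖α * β - 1‖ = ‖(α - 1) * β + (β - 1)‖ := by ring_nf
      _ ≤ ‖α - 1‖ * ‖β‖ + ‖β - 1‖ := (norm_add_le _ _).trans_eq (by rw [norm_mul])
      _ ≤ K₁ * M / n * (1 + K₂) + K₂ / n :=
        add_le_add (mul_le_mul e1 e3 (norm_nonneg _) (by positivity)) e2
      _ = _ := by ring
  · rw [forestPGF_eq hn]
    field_simp
    ring

end PolyaForest

end

theorem theorem3 :
    -- the bivariate generating function
    (∀ m : ℕ, PolyaForest.markedT m =
      PolyaForest.seriesC.subst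
        (PowerSeries.C (Polynomial.X : Polynomial ℝ) * PowerSeries.X *
            PowerSeries.map Polynomial.C (PowerSeries.monomial m (PolyaForest.d m)) +
          PowerSeries.X *
            PowerSeries.map Polynomial.C
              (PolyaForest.seriesD - PowerSeries.monomial m (PolyaForest.d m)))) ∧
    -- the radius of convergence of `T` lies in `(0, 1)`, and `D` converges for `|z| < √ρ`
    (0 < PolyaForest.rho ∧ PolyaForest.rho < 1 ∧
      ∀ z : ℂ, ‖z‖ < √PolyaForest.rho →
        Summable fun k : ℕ => ((PolyaForest.d k : ℝ) : ℂ) * z ^ k) ∧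
    -- the probability that the attached forest has size `m`
    (∀ m : ℕ, ∃ ε : ℕ → ℝ,
      ε =O[Filter.atTop] (fun n : ℕ => (1 : ℝ) / (n : ℝ)) ∧
      ∀ n : ℕ, 1 ≤ n →
        PolyaForest.forestProb n m =
          PolyaForest.d m * PolyaForest.rho ^ m / PolyaForest.evalD PolyaForest.rho *
            (1 + ε n)) ∧
    -- the probability generating function, uniformly for `|u| ≤ r`, for each `r < 1 / √ρ`
    (∀ r : ℝ, r < 1 / √PolyaForest.rho → ∃ K : ℝ, ∀ n : ℕ, 1 ≤ n → ∀ u : ℂ, ‖u‖ ≤ r →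
      ∃ ε : ℂ, ‖ε‖ ≤ K / (n : ℝ) ∧
        PolyaForest.forestPGF n u =
          PolyaForest.evalD ((PolyaForest.rho : ℂ) * u) /
            PolyaForest.evalD (PolyaForest.rho : ℂ) * (1 + ε)) := by
  exact ⟨PolyaForest.markedT_eq,
    ⟨PolyaForest.rho_pos, PolyaForest.rho_lt_one,
      fun _ hz => PolyaForest.summable_d_mul_pow_complex hz⟩,
    PolyaForest.forestProb_asymptotics, PolyaForest.forestPGF_asymptotics⟩
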